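/- Let $d\ge 1$, $E=\mathbb R^d$ with the Euclidean norm $|\cdot|$, and let $\pi$ be a probability measure on $E$ with Lebesgue density $\exp(-U)$, where $U:E\to\mathbb R$ is differentiable and $L$-smooth for some $L\in(0,\infty)$: $U(x+h)-U(x)-\langle\nabla U(x),h\rangle\le \frac L2|h|^2$ for all $x,h\in E$. For measurable $A$ let $A_r=\{x:\mathrm{dist}(x,A)\le r\}$, $\pi^+(A)=\liminf_{r\to0^+}\frac{\pi(A_r)-\pi(A)}{r}$, and $I_\pi(p)=\inf\{\pi^+(A):\pi(A)=p\}$ for $p\in(0,1)$. Suppose that $\tilde I_\pi:(0,1)\to(0,\infty)$ is a regular, convex isoperimetric minorant of $\pi$: $\tilde I_\pi\le I_\pi$ pointwise, $\tilde I_\pi$ is continuous, symmetric about $\frac12$, and monotone increasing and convex on $(0,\frac12]$. Let $\varsigma>0$, and let $P$ be the Random Walk Metropolis kernel with target $\pi$ and step size $\sigma=\varsigma\,(Ld)^{-1/2}$, i.e. $P(x,A)=\int_A \alpha(x,y)\,Q(x,dy)+\mathbf 1_A(x)\bigl(1-\int_E\alpha(x,y)\,Q(x,dy)\bigr)$ with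 $Q(x,\cdot)=\mathcal N(x,\sigma^2 I_d)$ and $\alpha(x,y)=\min\{1,e^{U(x)-U(y)}\}$. Assume that $2\varsigma L^{-1/2}\tilde I_\pi(\frac14)\le d^{1/2}$. Write $\|f\|_2$ for the norm of $L^2(\pi)$, $\|f\|_{\mathrm{osc}}=\mathrm{ess\,sup}_\pi f-\mathrm{ess\,inf}_\pi f$, $\mathcal E(P,f)=\frac12\int\pi(dx)P(x,dy)|f(y)-f(x)|^2$, and $\chi^2(\rho,\pi)=\mathrm{var}_\pi(d\rho/d\pi)$ for probability measures $\rho\ll\pi$ (and $\chi^2(\rho,\pi)=\infty$ if $\rho\not\ll\pi$). Then the following hold. 1. $P$ has a positive weak conductance profile: for every $v\in(0,\frac12]$, $$\Phi_P^{\mathrm W}(v):=\inf\Bigl\{\tfrac{\int_A P(x,A^{c})\,\pi(dx)}{\pi(A)}:A\text{ measurable},\ v\le\pi(A)\le\tfrac12\Bigr\}>0,$$ and $$\Phi_P^{\mathrm W}(v)\ge 2^{-6}\,\varsigma\, e^{-\varsigma^2}(Ld)^{-1/2}\,\frac{\tilde I_\pi(v/2)}{v/2}.$$ 2. $P$ satisfies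 a $K^*$-weak Poincaré inequality with respect to $\|\cdot\|_{\mathrm{osc}}^2$. That is, with $\mathfrak a=\sup\{\|f\|_2^2/\|f\|_{\mathrm{osc}}^2: f\in L^2(\pi),\ \pi(f)=0,\ f\ne0\}$ (here $\mathfrak a=\frac14$), there is a nonnegative, convex, strictly increasing function $K^*$ on $[0,\mathfrak a]$ with $K^*(0)=0$ such that $$\frac{\mathcal E(P,f)}{\|f\|_{\mathrm{osc}}^2}\ge K^*\Bigl(\frac{\|f\|_2^2}{\|f\|_{\mathrm{osc}}^2}\Bigr)\quad\text{whenever } f\in L^2(\pi),\ \pi(f)=0,\ 0<\|f\|_{\mathrm{osc}}<\infty,$$ and, for every $v\in(0,\frac14]$, $$K^*(v)\ge 2^{-11}\,\varsigma^2 e^{-2\varsigma^2}(Ld)^{-1}\,\frac{\tilde I_\pi(2^{-3}v)^2}{2^{-3}v}.$$ 3. For every measurable $f$ with $0<\|f\|_{\mathrm{osc}}<\infty$ and every integer $n\ge0$, the quantity $v_n:=\|P^nf-\pi(f)\|_2^2/\|f\|_{\mathrm{osc}}^2$ lies in $[0,\frac14]$, and $$n\le 2^{14}\,\varsigma^{-2}e^{2\varsigma^2}L\,d\int_{2^{-3}v_n}^{2^{-3}v_0}\frac{v\,dv}{\tilde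 I_\pi(v)^2},$$ where the integral of the nonnegative integrand takes values in $[0,\infty]$. 4. Let $\nu\ll\pi$ be a probability measure with $u:=\|d\nu/d\pi\|_{\mathrm{osc}}^2\in(0,\infty)$, let $\varepsilon_{\mathrm{Mix}}>0$, and let $n\ge0$ be an integer with $$n\ge 1+2^{14}\,\varsigma^{-2}e^{2\varsigma^2}L\,d\int_{2^{-3}\varepsilon_{\mathrm{Mix}}u^{-1}}^{2^{-5}}\frac{v\,dv}{\tilde I_\pi(v)^2}.$$ Then $\chi^2(\nu P^n,\pi)\le\varepsilon_{\mathrm{Mix}}$. (The integral is oriented. If its lower limit is at least $1$, $\tilde I_\pi$ may be given any real values on $[1,\infty)$. If $u=0$, then $\nu=\pi$ and the conclusion is immediate.) -/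

import Mathlib

open MeasureTheory ProbabilityTheory Filter Topology Set
open scoped ENNReal

noncomputable section

namespace RWMWeakPoincare

section General

variable {E : Type*} [MeasurableSpace E]

/-- The essential oscillation `‖f‖_osc = ess sup f - ess inf f` with respect to `μ`,
with values in `[0, ∞]`. -/
def eOsc (μ : Measure E) (f : E → ℝ) : ℝ≥0∞ :=
  (essSup (fun x => (f x : EReal)) μ - essInf (fun x => (f x : EReal)) μ).toENNReal

/-- The Dirichlet form `𝓔(P, f) = 1/2 ∫ μ(dx) P(x, dy) |f(y) - f(x)|²`. -/
def dirichletForm (μ : Measure E) (P : Kernel E E) (f : E → ℝ) : ℝ≥0∞ :=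
  (1 / 2) * ∫⁻ x, ∫⁻ y, ENNReal.ofReal ((f y - f x) ^ 2) ∂(P x) ∂μ

/-- The weak conductance profile
`Φ(v) = inf {(μ ⊗ P)(A × Aᶜ) / μ(A) : v ≤ μ(A) ≤ 1/2}`, the infimum being over measurable sets. -/
def weakConductanceProfile (μ : Measure E) (P : Kernel E E) (v : ℝ) : ℝ≥0∞ :=
  ⨅ (A : Set E) (_ : MeasurableSet A ∧ ENNReal.ofReal v ≤ μ A ∧ μ A ≤ 1 / 2),
    (∫⁻ x in A, P x Aᶜ ∂μ) / μ A

/-- `P` has a positive weak conductance profile. -/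
def HasPositiveWCP (μ : Measure E) (P : Kernel E E) : Prop :=
  ∀ v ∈ Ioc (0 : ℝ) (1 / 2), 0 < weakConductanceProfile μ P v

/-- Membership in `L²₀(μ)`: square integrable with mean zero. -/
def MemL2Zero (μ : Measure E) (f : E → ℝ) : Prop :=
  MemLp f 2 μ ∧ ∫ x, f x ∂μ = 0

/-- The constant `𝔞 = sup {‖f‖₂² / Ψ(f) : f ∈ L²₀(μ), f ≠ 0}` of a functional `Ψ`. -/
def sieveConst (μ : Measure E) (Ψ : (E → ℝ) → ℝ≥0∞) : ℝ≥0∞ :=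
  ⨆ (f : E → ℝ) (_ : MemL2Zero μ f ∧ ¬ f =ᵐ[μ] 0), eLpNorm f 2 μ ^ 2 / Ψ f

/-- The interval `[0, 𝔞]`. It is closed on the right because `‖f‖₂² / Ψ(f)` may attain `𝔞`. -/
def sieveInterval (μ : Measure E) (Ψ : (E → ℝ) → ℝ≥0∞) : Set ℝ :=
  {v | 0 ≤ v ∧ ENNReal.ofReal v ≤ sieveConst μ Ψ}

/-- `P` satisfies a `(Ψ, K)`-weak Poincaré inequality, in the `K*` parametrization. -/
structure KStarWPI (μ : Measure E) (P : Kernel E E) (Ψ : (E → ℝ) → ℝ≥0∞) (K : ℝ → ℝ) :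
    Prop where
  nonneg : ∀ v ∈ sieveInterval μ Ψ, 0 ≤ K v
  convexOn : ConvexOn ℝ (sieveInterval μ Ψ) K
  strictMonoOn : StrictMonoOn K (sieveInterval μ Ψ)
  map_zero : K 0 = 0
  le_dirichletForm : ∀ f : E → ℝ, MemL2Zero μ f → 0 < Ψ f → Ψ f < ∞ →
    ENNReal.ofReal (K (eLpNorm f 2 μ ^ 2 / Ψ f).toReal) ≤ dirichletForm μ P f / Ψ f

/-- `‖Pⁿ f - μ(f)‖₂² / ‖f‖_osc²`. -/
def decayRatio (μ : Measure E) (P : Kernel E E) (f : E → ℝ) (n : ℕ) : ℝ≥0∞ :=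
  eLpNorm (fun x => (∫ y, f y ∂((P ^ n) x)) - ∫ y, f y ∂μ) 2 μ ^ 2 / eOsc μ f ^ 2

open Classical in
/-- The divergence `χ²(ν, μ)`: the variance of `dν/dμ` under `μ` if `ν ≪ μ`, and `∞` otherwise. -/
def chiSq (ν μ : Measure E) : ℝ≥0∞ :=
  if ν ≪ μ then evariance (fun x => (ν.rnDeriv μ x).toReal) μ else ∞

/-- The Metropolis acceptance probability `α(x, y) = min (1, ϖ(y) / ϖ(x))`. -/
def acceptance (ϖ : E → ℝ) (x y : E) : ℝ≥0∞ :=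
  ENNReal.ofReal (min 1 (ϖ y / ϖ x))

/-- The Metropolis kernel with proposal `Q` for the density `ϖ`:
`P(x, A) = ∫_A Q(x, dy) α(x, y) + 1_A(x) (1 - ∫ Q(x, dy) α(x, y))`. -/
def metropolisKernel (Q : Kernel E E) [IsSFiniteKernel Q] (ϖ : E → ℝ) : Kernel E E :=
  Q.withDensity (acceptance ϖ) +
    Kernel.withDensity Kernel.id (fun x _ => 1 - ∫⁻ y, acceptance ϖ x y ∂(Q x))

theorem measurable_acceptance {ϖ : E → ℝ} (hϖ : Measurable ϖ) :
    Measurable (Function.uncurry (acceptance ϖ)) := by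
  unfold acceptance Function.uncurry
  fun_prop

theorem metropolisKernel_apply (Q : Kernel E E) [IsSFiniteKernel Q] {ϖ : E → ℝ}
    (hϖ : Measurable ϖ) (x : E) {A : Set E} (hA : MeasurableSet A) :
    metropolisKernel Q ϖ x A = (∫⁻ y in A, acceptance ϖ x y ∂(Q x)) +
      A.indicator (fun x => 1 - ∫⁻ y, acceptance ϖ x y ∂(Q x)) x := by
  have h1 := measurable_acceptance hϖ
  have h2 : Measurable (Function.uncurry
      (fun (x _ : E) => 1 - ∫⁻ y, acceptance ϖ x y ∂(Q x))) :=
    (measurable_const.sub h1.lintegral_kernel_prod_right).comp measurable_fst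
  rw [metropolisKernel, _root_.add_apply, Measure.add_apply, Kernel.withDensity_apply' _ h1,
    Kernel.withDensity_apply' _ h2, Kernel.id_apply, setLIntegral_const, Measure.dirac_apply' x hA]
  by_cases hx : x ∈ A <;> simp [hx]

end General

section Isoperimetry

variable {E : Type*} [PseudoEMetricSpace E] [MeasurableSpace E]

/-- The Minkowski content `π⁺(A) = liminf_{r → 0+} (π(A_r) - π(A)) / r`, with
`A_r = {x : dist(x, A) ≤ r}`. -/
def minkowskiContent (π : Measure E) (A : Set E) : ℝ≥0∞ :=
  liminf (fun r : ℝ => (π (Metric.cthickening r A) - π A) / ENNReal.ofReal r) (𝓝[>] 0)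

/-- The isoperimetric profile `I_π(p) = inf {π⁺(A) : A measurable, π(A) = p}`. -/
def isoProfile (π : Measure E) (p : ℝ) : ℝ≥0∞ :=
  ⨅ (A : Set E) (_ : MeasurableSet A ∧ π A = ENNReal.ofReal p), minkowskiContent π A

/-- `I` is a regular, convex isoperimetric minorant of `π`: a positive function on `(0, 1)`, lying
below the isoperimetric profile, symmetric about `1/2`, continuous, and increasing and convex on
`(0, 1/2]`. (A symmetric function that is increasing on `(0, 1/2]` and convex on all of `(0, 1)`
would be constant.) -/
structure IsRegularConvexIsoMinorant (π : Measure E) (I : ℝ → ℝ) : Prop where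
  pos : ∀ p ∈ Ioo (0 : ℝ) 1, 0 < I p
  le_isoProfile : ∀ p ∈ Ioo (0 : ℝ) 1, ENNReal.ofReal (I p) ≤ isoProfile π p
  symm : ∀ p ∈ Ioo (0 : ℝ) 1, I (1 - p) = I p
  continuousOn : ContinuousOn I (Ioo 0 1)
  monotoneOn : MonotoneOn I (Ioc 0 (1 / 2))
  convexOn : ConvexOn ℝ (Ioc 0 (1 / 2)) I

end Isoperimetry

section Euclidean

variable {d : ℕ}

/-- `U` is `L`-smooth: it is differentiable and
`U(x + h) - U(x) - ⟨∇U(x), h⟩ ≤ (L/2) |h|²` for all `x, h`. -/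
def IsLSmooth (L : ℝ) (U : EuclideanSpace ℝ (Fin d) → ℝ) : Prop :=
  Differentiable ℝ U ∧
    ∀ x h, U (x + h) - U x - inner ℝ (gradient U x) h ≤ L / 2 * ‖h‖ ^ 2

/-- The Gaussian random walk proposal: `Q(x, ·)` is the law of `x + σ z` with `z ∼ N(0, I_d)`. -/
def gaussianProposal (d : ℕ) (σ : ℝ) :
    Kernel (EuclideanSpace ℝ (Fin d)) (EuclideanSpace ℝ (Fin d)) :=
  Kernel.map (Kernel.id ×ₖ Kernel.const _ (stdGaussian (EuclideanSpace ℝ (Fin d))))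
    (fun p => p.1 + σ • p.2)

instance (σ : ℝ) : IsMarkovKernel (gaussianProposal d σ) :=
  Kernel.IsMarkovKernel.map _ (by fun_prop)

theorem gaussianProposal_apply (σ : ℝ) (x : EuclideanSpace ℝ (Fin d)) :
    gaussianProposal d σ x =
      (stdGaussian (EuclideanSpace ℝ (Fin d))).map (fun z => x + σ • z) := by
  rw [gaussianProposal, Kernel.map_apply _ (by fun_prop), Kernel.prod_apply, Kernel.id_apply,
    Kernel.const_apply, Measure.dirac_prod, Measure.map_map (by fun_prop) (by fun_prop)]
  rfl

/-- The Random Walk Metropolis kernel with step size `σ` for the target density `exp(-U)`. -/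
def rwmKernel (σ : ℝ) (U : EuclideanSpace ℝ (Fin d) → ℝ) :
    Kernel (EuclideanSpace ℝ (Fin d)) (EuclideanSpace ℝ (Fin d)) :=
  metropolisKernel (gaussianProposal d σ) (fun x => Real.exp (-U x))

end Euclidean

end RWMWeakPoincare

end

/-! The route is: overlap of transition laws, isoperimetry, a nonlinear Cheeger inequality, then a
discrete differential inequality. Write σ for the step size.

Overlap. Smoothness bounds `U (x + σ z) - U x` by a term odd in `z` plus `L σ² |z|² / 2`. For one of
`z` and `-z` the odd term is harmless, so by Jensen the acceptance rate is at least `e^{-ς²/2} / 2`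
at every point (`le_lintegral_acceptance`). Gaussian proposals from points at distance `r` differ by
at most `r / (2σ)` in total variation, so chains started at distance of order `e^{-ς²/2} σ` have
overlapping transition laws (`sub_le_add_metropolisKernel`).

Isoperimetry. Call a point sticky if the chain is unlikely to cross from its side of `A` to the
other. By overlap, sticky points of `A` and of `Aᶜ` are far apart. Either many points are not
sticky, or the three-set inequality puts mass between the two sticky sets. In each case the flow out
of `A` is large (`le_flow_of_closeCoupling`); the step-size hypothesis makes the isoperimetric term
the binding one. The outcome is a flow of at least `2k I(π(A)/2)` with `k = 2⁻⁶ e^{-ς²} σ`, and the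
conductance bound follows because `I(t)/t` is nondecreasing.

Cheeger. The co-area formula and Jensen's inequality for the convex profile turn the flow bound into
an `L¹` inequality; applying it to squares and using Cauchy-Schwarz gives the weak Poincaré
inequality with `K*(v) = 2k² I(v/8)² / (v/8)`. Extending `I` convexly and continuously to `0` by the
value `0` requires `I(0+) = 0`, which comes from testing half-spaces
(`IsRegularConvexIsoMinorant.exists_lt`).

Decay. A Gaussian step of size σ is two independent steps of size `σ/√2` from a common midpoint, and
`min` is a positive semidefinite kernel, so `P` is a positive operator
(`integral_mul_markovOp_nonneg`). Then `‖Pf‖² ≤ ‖f‖² - 𝓔(P, f)`, which yields `v_{n+1} ≤ v_n -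
K*(v_n)`, and comparison with the integral of `1/K*` bounds `n`. By reversibility the density of `ν
Pⁿ` is `Pⁿ (dν/dπ)`, so the same decay controls the divergence `χ²`. -/

namespace RWMWeakPoincare

/-! ### Reversible kernels: quadratic forms on bounded functions -/

section Forms

variable {E : Type*} [MeasurableSpace E]

/-- A bounded measurable real function. -/
structure BddMeas (f : E → ℝ) : Prop where
  measurable : Measurable f
  bdd : ∃ C, ∀ x, |f x| ≤ C

namespace BddMeas

theorem of_mem_Icc {f : E → ℝ} {a b : ℝ} (hf : Measurable f) (h : ∀ x, f x ∈ Icc a b) :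
    BddMeas f :=
  ⟨hf, max |a| |b|, fun x => abs_le_max_abs_abs (h x).1 (h x).2⟩

theorem integrable {f : E → ℝ} (hf : BddMeas f) (μ : Measure E) [IsFiniteMeasure μ] :
    Integrable f μ := by
  obtain ⟨C, hC⟩ := hf.bdd
  exact Integrable.of_bound hf.measurable.aestronglyMeasurable C (ae_of_all _ hC)

theorem mul {f g : E → ℝ} (hf : BddMeas f) (hg : BddMeas g) : BddMeas (fun x => f x * g x) := by
  obtain ⟨C, hC⟩ := hf.bdd
  obtain ⟨D, hD⟩ := hg.bdd
  refine ⟨hf.measurable.mul hg.measurable, C * D, fun x => ?_⟩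
  rw [abs_mul]
  exact mul_le_mul (hC x) (hD x) (abs_nonneg _) ((abs_nonneg _).trans (hC x))

theorem sub {f g : E → ℝ} (hf : BddMeas f) (hg : BddMeas g) : BddMeas (fun x => f x - g x) := by
  obtain ⟨C, hC⟩ := hf.bdd
  obtain ⟨D, hD⟩ := hg.bdd
  exact ⟨hf.measurable.sub hg.measurable, C + D,
    fun x => (abs_sub _ _).trans (add_le_add (hC x) (hD x))⟩

theorem add {f g : E → ℝ} (hf : BddMeas f) (hg : BddMeas g) : BddMeas (fun x => f x + g x) := by
  obtain ⟨C, hC⟩ := hf.bdd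
  obtain ⟨D, hD⟩ := hg.bdd
  exact ⟨hf.measurable.add hg.measurable, C + D,
    fun x => (abs_add_le _ _).trans (add_le_add (hC x) (hD x))⟩

theorem const (c : ℝ) : BddMeas (fun _ : E => c) := ⟨measurable_const, |c|, fun _ => le_rfl⟩

theorem comp {F : Type*} [MeasurableSpace F] {f : E → ℝ} (hf : BddMeas f) {g : F → E}
    (hg : Measurable g) : BddMeas (fun x => f (g x)) :=
  ⟨hf.measurable.comp hg, hf.bdd.choose, fun _ => hf.bdd.choose_spec _⟩

theorem const_mul {f : E → ℝ} (hf : BddMeas f) (c : ℝ) : BddMeas (fun x => c * f x) :=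
  (const c).mul hf

theorem sq {f : E → ℝ} (hf : BddMeas f) : BddMeas (fun x => f x ^ 2) := by
  simpa only [pow_two] using hf.mul hf

theorem abs {f : E → ℝ} (hf : BddMeas f) : BddMeas (fun x => |f x|) :=
  ⟨hf.measurable.abs, hf.bdd.choose, fun x => by simpa using hf.bdd.choose_spec x⟩

end BddMeas

/-- The Cauchy-Schwarz inequality for bounded measurable functions. -/
theorem sq_integral_mul_le {μ : Measure E} [IsFiniteMeasure μ] {f g : E → ℝ}
    (hf : BddMeas f) (hg : BddMeas g) :
    (∫ x, f x * g x ∂μ) ^ 2 ≤ (∫ x, f x ^ 2 ∂μ) * ∫ x, g x ^ 2 ∂μ := by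
  have key : ∀ t : ℝ, 0 ≤ (∫ x, g x ^ 2 ∂μ) * (t * t) + (-2 * ∫ x, f x * g x ∂μ) * t
      + ∫ x, f x ^ 2 ∂μ := by
    intro t
    have h : ∫ x, (f x - t * g x) ^ 2 ∂μ = (∫ x, g x ^ 2 ∂μ) * (t * t)
        + (-2 * ∫ x, f x * g x ∂μ) * t + ∫ x, f x ^ 2 ∂μ := by
      have e : ∀ x, (f x - t * g x) ^ 2 = (t * t) * g x ^ 2 + (-2 * t) * (f x * g x) + f x ^ 2 :=
        fun x => by ring
      simp_rw [e]
      rw [integral_add (((hg.sq.const_mul _).add ((hf.mul hg).const_mul _)).integrable μ)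
        (hf.sq.integrable μ),
        integral_add ((hg.sq.integrable μ).const_mul _) (((hf.mul hg).integrable μ).const_mul _),
        integral_const_mul, integral_const_mul]
      ring
    rw [← h]
    positivity
  have := discrim_le_zero key
  rw [discrim] at this
  nlinarith

variable {μ : Measure E} {P : Kernel E E}

/-- The action `P f (x) = ∫ f(y) P(x, dy)` of a kernel on functions. -/
noncomputable def markovOp (P : Kernel E E) (f : E → ℝ) (x : E) : ℝ := ∫ y, f y ∂(P x)

/-- The Dirichlet form of a bounded function, as a real number. -/
noncomputable def energy (μ : Measure E) (P : Kernel E E) (f : E → ℝ) : ℝ :=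
  (1 / 2) * ∫ p, (f p.2 - f p.1) ^ 2 ∂(μ ⊗ₘ P)

theorem energy_nonneg (f : E → ℝ) : 0 ≤ energy μ P f :=
  mul_nonneg (by norm_num) (integral_nonneg fun _ => sq_nonneg _)

theorem measurable_markovOp [IsSFiniteKernel P] {f : E → ℝ} (hf : Measurable f) :
    Measurable (markovOp P f) :=
  (hf.stronglyMeasurable.integral_kernel (κ := P)).measurable

theorem markovOp_mem_Icc [IsMarkovKernel P] {f : E → ℝ} {a b : ℝ} (hf : Measurable f)
    (h : ∀ x, f x ∈ Icc a b) (x : E) : markovOp P f x ∈ Icc a b := by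
  have hi := (BddMeas.of_mem_Icc hf h).integrable (P x)
  constructor
  · have := integral_mono (integrable_const a) hi fun y => (h y).1
    simpa [markovOp] using this
  · have := integral_mono hi (integrable_const b) fun y => (h y).2
    simpa [markovOp] using this

theorem BddMeas.markovOp [IsMarkovKernel P] {f : E → ℝ} (hf : BddMeas f) :
    BddMeas (markovOp P f) := by
  obtain ⟨C, hC⟩ := hf.bdd
  exact .of_mem_Icc (measurable_markovOp hf.measurable)
    (markovOp_mem_Icc hf.measurable fun x => abs_le.1 (hC x))

variable [IsProbabilityMeasure μ] [IsMarkovKernel P]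

/-- Reversibility is symmetry of the joint law of one step, and rectangles determine that law. -/
theorem map_swap_compProd (hP : P.IsReversible μ) :
    (μ ⊗ₘ P).map Prod.swap = μ ⊗ₘ P := by
  have : IsProbabilityMeasure ((μ ⊗ₘ P).map Prod.swap) :=
    Measure.isProbabilityMeasure_map measurable_swap.aemeasurable
  refine Measure.ext_prod fun {s t} hs ht => ?_
  rw [Measure.map_apply measurable_swap (hs.prod ht), Set.preimage_swap_prod,
    Measure.compProd_apply_prod ht hs, Measure.compProd_apply_prod hs ht, hP ht hs]

theorem integral_swap_compProd (hP : P.IsReversible μ) (F : E × E → ℝ) :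
    ∫ p, F p.swap ∂(μ ⊗ₘ P) = ∫ p, F p ∂(μ ⊗ₘ P) := by
  have h : MeasurePreserving (MeasurableEquiv.prodComm (α := E) (β := E)) (μ ⊗ₘ P) (μ ⊗ₘ P) :=
    ⟨MeasurableEquiv.prodComm.measurable, map_swap_compProd hP⟩
  exact h.integral_comp' F

theorem integral_fst_compProd {f : E → ℝ} (hf : BddMeas f) :
    ∫ p, f p.1 ∂(μ ⊗ₘ P) = ∫ x, f x ∂μ := by
  rw [Measure.integral_compProd ((hf.comp measurable_fst).integrable _)]
  simp

theorem integral_snd_compProd (hP : P.IsReversible μ) {f : E → ℝ} (hf : BddMeas f) :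
    ∫ p, f p.2 ∂(μ ⊗ₘ P) = ∫ x, f x ∂μ := by
  rw [← integral_fst_compProd (P := P) hf, ← integral_swap_compProd hP]
  rfl

theorem integral_mul_compProd {f g : E → ℝ} (hf : BddMeas f) (hg : BddMeas g) :
    ∫ p, f p.1 * g p.2 ∂(μ ⊗ₘ P) = ∫ x, f x * markovOp P g x ∂μ := by
  rw [Measure.integral_compProd
    (((hf.comp measurable_fst).mul (hg.comp measurable_snd)).integrable _)]
  simp [integral_const_mul, markovOp]

theorem integral_mul_markovOp_comm (hP : P.IsReversible μ) {f g : E → ℝ}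
    (hf : BddMeas f) (hg : BddMeas g) :
    ∫ x, f x * markovOp P g x ∂μ = ∫ x, markovOp P f x * g x ∂μ := by
  rw [← integral_mul_compProd hf hg, ← integral_swap_compProd hP]
  simp only [Prod.fst_swap, Prod.snd_swap, mul_comm (f _)]
  rw [integral_mul_compProd hg hf]
  simp only [mul_comm (g _)]

theorem integral_markovOp (hP : P.IsReversible μ) {f : E → ℝ} (hf : BddMeas f) :
    ∫ x, markovOp P f x ∂μ = ∫ x, f x ∂μ := by
  have := integral_mul_markovOp_comm hP (.const 1) hf
  simpa [markovOp] using this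

/-- Expand the square: both marginals of `μ ⊗ₘ P` are `μ`, the second one by reversibility. -/
theorem energy_eq (hP : P.IsReversible μ) {f : E → ℝ} (hf : BddMeas f) :
    energy μ P f = ∫ x, f x ^ 2 ∂μ - ∫ x, f x * markovOp P f x ∂μ := by
  have e : ∀ p : E × E, (f p.2 - f p.1) ^ 2 = f p.2 ^ 2 + f p.1 ^ 2 - 2 * (f p.1 * f p.2) :=
    fun p => by ring
  have h1 := hf.sq.comp (measurable_fst (α := E) (β := E))
  have h2 := hf.sq.comp (measurable_snd (α := E) (β := E))
  have h3 := (hf.comp (measurable_fst (α := E) (β := E))).mul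
    (hf.comp (measurable_snd (α := E) (β := E)))
  simp_rw [energy, e]
  rw [integral_sub ((h2.add h1).integrable _) ((h3.integrable _).const_mul 2),
    integral_add (h2.integrable _) (h1.integrable _), integral_const_mul,
    integral_mul_compProd hf hf, integral_fst_compProd hf.sq, integral_snd_compProd hP hf.sq]
  ring

theorem dirichletForm_eq {f : E → ℝ} (hf : BddMeas f) :
    dirichletForm μ P f = ENNReal.ofReal (energy μ P f) := by
  have h : BddMeas (fun p : E × E => (f p.2 - f p.1) ^ 2) :=
    ((hf.comp measurable_snd).sub (hf.comp measurable_fst)).sq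
  rw [dirichletForm, energy, ENNReal.ofReal_mul (by norm_num),
    ofReal_integral_eq_lintegral_ofReal (h.integrable _) (ae_of_all _ fun _ => sq_nonneg _),
    Measure.lintegral_compProd h.measurable.ennreal_ofReal]
  congr 1
  simp

-- By invariance a `μ`-null set is `P x`-null for almost every `x`. Through this the Dirichlet form
-- depends only on the almost-everywhere class of a function.
omit [IsProbabilityMeasure μ] in
theorem ae_ae_kernel (hP : P.IsReversible μ) {p : E → Prop} (h : ∀ᵐ x ∂μ, p x) :
    ∀ᵐ x ∂μ, ∀ᵐ y ∂(P x), p y := by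
  apply Measure.ae_ae_of_ae_comp
  rwa [hP.invariant.def]

omit [IsProbabilityMeasure μ] in
theorem dirichletForm_congr (hP : P.IsReversible μ) {f g : E → ℝ} (h : f =ᵐ[μ] g) :
    dirichletForm μ P f = dirichletForm μ P g := by
  unfold dirichletForm
  congr 1
  refine lintegral_congr_ae ?_
  filter_upwards [h, ae_ae_kernel hP h] with x hx hy
  refine lintegral_congr_ae ?_
  filter_upwards [hy] with y hy
  rw [hx, hy]

/-- For a reversible kernel with nonnegative quadratic form,
`‖P f‖² ≤ ‖f‖² - 𝓔(P, f)`. -/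
theorem integral_sq_markovOp_le (hP : P.IsReversible μ)
    (hpos : ∀ f : E → ℝ, BddMeas f → 0 ≤ ∫ x, f x * markovOp P f x ∂μ)
    {f : E → ℝ} (hf : BddMeas f) :
    ∫ x, markovOp P f x ^ 2 ∂μ ≤ ∫ x, f x ^ 2 ∂μ - energy μ P f := by
  set g := markovOp P f with hg
  have hgb : BddMeas g := hf.markovOp
  rw [energy_eq hP hf, sub_sub_cancel]
  -- The goal is now `P² ≤ P` as quadratic forms. It follows from `P - P² = (1 - P) P (1 - P) + P (1
  -- - P) P`: the first term is `h1`, the second is `h2`.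
  have h1 := hpos _ (hf.sub hgb)
  have h2 := energy_nonneg (μ := μ) (P := P) g
  rw [energy_eq hP hgb] at h2
  have e1 : markovOp P (fun x => f x - g x) = fun x => g x - markovOp P g x := by
    ext x
    simp only [markovOp]
    rw [integral_sub (hf.integrable _) (hgb.integrable _)]
    rfl
  have e2 : ∫ x, (f x - g x) * markovOp P (fun x => f x - g x) x ∂μ
      = ∫ x, f x * g x ∂μ - 2 * ∫ x, g x ^ 2 ∂μ + ∫ x, g x * markovOp P g x ∂μ := by
    have e3 : ∀ x, (f x - g x) * (g x - markovOp P g x)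
        = f x * g x - f x * markovOp P g x - g x ^ 2 + g x * markovOp P g x := fun x => by ring
    simp_rw [e1, e3]
    have i1 := hf.mul hgb
    have i2 := hf.mul (hgb.markovOp (P := P))
    have i3 := hgb.sq
    have i4 := hgb.mul (hgb.markovOp (P := P))
    rw [integral_add (((i1.sub i2).sub i3).integrable μ) (i4.integrable μ),
      integral_sub ((i1.sub i2).integrable μ) (i3.integrable μ),
      integral_sub (i1.integrable μ) (i2.integrable μ), integral_mul_markovOp_comm hP hf hgb, ← hg]
    simp_rw [← pow_two]
    ring
  linarith

end Forms

/-! ### Cheeger's inequality for a convex flow profile -/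

section Cheeger

/-- Layer-cake formula for the positive part of a difference of functions with values in
`[0, 1]`. -/
theorem lintegral_ofReal_sub_eq {X : Type*} [MeasurableSpace X] (ν : Measure X) [SFinite ν]
    {u w : X → ℝ} (hu : Measurable u) (hw : Measurable w) (hw0 : ∀ x, 0 ≤ w x)
    (hu1 : ∀ x, u x ≤ 1) :
    ∫⁻ x, ENNReal.ofReal (u x - w x) ∂ν
      = ∫⁻ t in Ico (0 : ℝ) 1, ν {x | w x ≤ t ∧ t < u x} := by
  have hm : MeasurableSet {q : X × ℝ | w q.1 ≤ q.2 ∧ q.2 < u q.1} :=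
    (measurableSet_le (hw.comp measurable_fst) measurable_snd).inter
      (measurableSet_lt measurable_snd (hu.comp measurable_fst))
  -- The positive part of `u x - w x` is the length of `[w x, u x)`, which lies in `[0, 1)`. Tonelli
  -- then exchanges the integrals.
  have h1 : ∀ x, ENNReal.ofReal (u x - w x)
      = ∫⁻ t in Ico (0 : ℝ) 1, {q : X × ℝ | w q.1 ≤ q.2 ∧ q.2 < u q.1}.indicator 1 (x, t) := by
    intro x
    have : (fun t => {q : X × ℝ | w q.1 ≤ q.2 ∧ q.2 < u q.1}.indicator (1 : X × ℝ → ℝ≥0∞) (x, t))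
        = (Ico (w x) (u x)).indicator 1 := by
      ext t; simp [indicator, mem_Ico]
    rw [this, lintegral_indicator_one measurableSet_Ico, Measure.restrict_apply measurableSet_Ico,
      inter_eq_left.2 (Ico_subset_Ico (hw0 x) (hu1 x)), Real.volume_Ico]
  simp_rw [h1]
  rw [lintegral_lintegral_swap (f := fun x t =>
    {q : X × ℝ | w q.1 ≤ q.2 ∧ q.2 < u q.1}.indicator (1 : X × ℝ → ℝ≥0∞) (x, t))
    ((measurable_one.indicator hm).aemeasurable)]
  refine lintegral_congr fun t => ?_
  exact lintegral_indicator_one (measurable_prodMk_right hm)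

variable {E : Type*} [MeasurableSpace E]

/-- Every random variable has a median. -/
theorem exists_median (μ : Measure E) [IsProbabilityMeasure μ] {f : E → ℝ} (hf : Measurable f)
    {a b : ℝ} (hab : ∀ x, f x ∈ Icc a b) :
    ∃ m ∈ Icc a b, μ {x | m < f x} ≤ 1 / 2 ∧ μ {x | f x < m} ≤ 1 / 2 := by
  set S : Set ℝ := {t | μ {x | t < f x} ≤ 1 / 2} with hS
  have hb : b ∈ S := by
    have : {x | b < f x} = ∅ := by ext x; simpa using (hab x).2
    simp [hS, this]
  have ha : ∀ t ∈ S, a ≤ t := by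
    intro t ht
    by_contra! h
    have : {x | t < f x} = univ := by ext x; simpa using h.trans_le (hab x).1
    rw [hS, mem_ofPred_eq, this, measure_univ] at ht
    exact absurd ht (by simp)
  have hbdd : BddBelow S := ⟨a, ha⟩
  -- Both bounds are continuity from below along the levels `sInf S ± 1 / (n + 1)`, which lie on a
  -- known side of the infimum.
  refine ⟨sInf S, ⟨le_csInf ⟨b, hb⟩ ha, csInf_le hbdd hb⟩, ?_, ?_⟩
  · have e : {x | sInf S < f x} = ⋃ n : ℕ, {x | sInf S + 1 / ((n : ℝ) + 1) < f x} := by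
      ext x
      simp only [mem_ofPred_eq, mem_iUnion]
      constructor
      · intro h
        obtain ⟨n, hn⟩ := exists_nat_one_div_lt (sub_pos.2 h)
        exact ⟨n, by linarith⟩
      · rintro ⟨n, hn⟩
        have : 0 < 1 / ((n : ℝ) + 1) := by positivity
        linarith
    have hmono : Monotone fun n : ℕ => {x | sInf S + 1 / ((n : ℝ) + 1) < f x} := by
      intro i j hij x hx
      have := one_div_le_one_div_of_le (by positivity : (0 : ℝ) < i + 1)
        (by have : (i : ℝ) ≤ j := by exact_mod_cast hij
            linarith : (i : ℝ) + 1 ≤ j + 1)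
      simp only [mem_ofPred_eq] at hx ⊢
      linarith
    rw [e, hmono.measure_iUnion]
    refine iSup_le fun n => ?_
    obtain ⟨t, ht, htn⟩ := exists_lt_of_csInf_lt ⟨b, hb⟩
      (lt_add_of_pos_right (sInf S) (by positivity : 0 < 1 / ((n : ℝ) + 1)))
    exact (measure_mono fun x (hx : _ < _) => htn.trans hx).trans ht
  · have e : {x | f x < sInf S} = ⋃ n : ℕ, {x | f x ≤ sInf S - 1 / ((n : ℝ) + 1)} := by
      ext x
      simp only [mem_ofPred_eq, mem_iUnion]
      constructor
      · intro h
        obtain ⟨n, hn⟩ := exists_nat_one_div_lt (sub_pos.2 h)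
        exact ⟨n, by linarith⟩
      · rintro ⟨n, hn⟩
        have : 0 < 1 / ((n : ℝ) + 1) := by positivity
        linarith
    have hmono : Monotone fun n : ℕ => {x | f x ≤ sInf S - 1 / ((n : ℝ) + 1)} := by
      intro i j hij x hx
      have := one_div_le_one_div_of_le (by positivity : (0 : ℝ) < i + 1)
        (by have : (i : ℝ) ≤ j := by exact_mod_cast hij
            linarith : (i : ℝ) + 1 ≤ j + 1)
      simp only [mem_ofPred_eq] at hx ⊢
      linarith
    rw [e, hmono.measure_iUnion]
    refine iSup_le fun n => ?_
    set t := sInf S - 1 / ((n : ℝ) + 1)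
    have ht : t ∉ S := notMem_of_lt_csInf (sub_lt_self _ (by positivity)) hbdd
    have hc : {x | f x ≤ t} = {x | t < f x}ᶜ := by ext x; simp
    rw [hc, prob_compl_eq_one_sub (measurableSet_lt measurable_const hf)]
    have h2 : 1 / 2 < μ {x | t < f x} := not_le.1 ht
    calc 1 - μ {x | t < f x} ≤ 1 - 1 / 2 := tsub_le_tsub_left h2.le _
      _ = 1 / 2 := by simp

variable {μ : Measure E} {P : Kernel E E} [IsProbabilityMeasure μ] [IsMarkovKernel P]

/-- An isoperimetric-type lower bound for the flow through sets yields an `L¹` Poincaré-type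
inequality. -/
theorem le_integral_posPart {J : ℝ → ℝ} (hJc : ConvexOn ℝ (Icc 0 (1 / 2)) J)
    (hJcont : ContinuousOn J (Icc 0 (1 / 2))) (hJm : MonotoneOn J (Icc 0 (1 / 2)))
    (hJ0 : J 0 = 0)
    (hflow : ∀ A, MeasurableSet A → μ A ≤ 1 / 2 →
      ENNReal.ofReal (J (μ.real A)) ≤ ∫⁻ x in A, P x Aᶜ ∂μ)
    {a : E → ℝ} (ha : Measurable a) (ha01 : ∀ x, a x ∈ Icc (0 : ℝ) 1)
    (hhalf : μ {x | 0 < a x} ≤ 1 / 2) :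
    J (∫ x, a x ∂μ) ≤ ∫ p, max (a p.1 - a p.2) 0 ∂(μ ⊗ₘ P) := by
  set lam : Measure ℝ := volume.restrict (Ico (0 : ℝ) 1) with hlam
  have hlamP : IsProbabilityMeasure lam := ⟨by simp [hlam]⟩
  have hab := BddMeas.of_mem_Icc ha ha01
  -- Only levels in `[0, 1)` matter; `max t 0` keeps `m` antitone and at most `1/2` on the whole
  -- line.
  set m : ℝ → ℝ := fun t => μ.real {x | max t 0 < a x} with hm
  have hmeas : ∀ t : ℝ, MeasurableSet {x | t < a x} := fun t => measurableSet_lt measurable_const ha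
  have hle : ∀ t : ℝ, μ {x | max t 0 < a x} ≤ 1 / 2 := fun t =>
    (measure_mono fun x (hx : _ < _) => (le_max_right t 0).trans_lt hx).trans hhalf
  have hm01 : ∀ t, m t ∈ Icc (0 : ℝ) (1 / 2) := by
    refine fun t => ⟨measureReal_nonneg, ?_⟩
    have := ENNReal.toReal_mono (by simp) (hle t)
    simpa [hm, Measure.real] using this
  have hmanti : Antitone m := fun s t hst =>
    measureReal_mono fun x (hx : _ < _) => (max_le_max_right 0 hst).trans_lt hx
  have hJmanti : Antitone fun t => J (m t) := fun s t hst =>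
    hJm (hm01 t) (hm01 s) (hmanti hst)
  have hJm01 : ∀ t, J (m t) ∈ Icc 0 (J (1 / 2)) := fun t =>
    ⟨hJ0 ▸ hJm ⟨le_rfl, by norm_num⟩ (hm01 t) (hm01 t).1,
      hJm (hm01 t) ⟨by norm_num, le_rfl⟩ (hm01 t).2⟩
  have hmB := BddMeas.of_mem_Icc hmanti.measurable hm01
  have hJB := BddMeas.of_mem_Icc hJmanti.measurable hJm01
  have hint : ∫ t, m t ∂lam = ∫ x, a x ∂μ := by
    rw [integral_eq_lintegral_of_nonneg_ae (ae_of_all _ fun t => (hm01 t).1)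
      hmB.measurable.aestronglyMeasurable,
      integral_eq_lintegral_of_nonneg_ae (ae_of_all _ fun x => (ha01 x).1)
      ha.aestronglyMeasurable]
    have := lintegral_ofReal_sub_eq μ ha measurable_const (fun _ => le_refl (0 : ℝ))
      fun x => (ha01 x).2
    simp only [sub_zero] at this
    rw [this]
    congr 1
    refine setLIntegral_congr_fun measurableSet_Ico fun t ht => ?_
    simp only [hm, max_eq_left ht.1, ht.1, true_and]
    exact ENNReal.ofReal_toReal (measure_ne_top μ _)
  -- By layer-cake `∫ a` is the mean of `m` over a uniform level, so Jensen moves `J` inside. The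
  -- flow bound then applies to each level set `{a > t}`, and the layer-cake formula on pairs resums
  -- the flows.
  have hjensen := hJc.map_integral_le hJcont isClosed_Icc (ae_of_all lam hm01)
    (hmB.integrable lam) (hJB.integrable lam)
  rw [hint] at hjensen
  refine hjensen.trans ?_
  have hF : BddMeas fun p : E × E => max (a p.1 - a p.2) 0 := by
    refine .of_mem_Icc (a := 0) (b := 1) (by fun_prop) fun p => ⟨le_max_right _ _, ?_⟩
    have h1 := (ha01 p.1).2
    have h2 := (ha01 p.2).1
    exact max_le (by linarith) zero_le_one
  have hF0 : 0 ≤ ∫ p, max (a p.1 - a p.2) 0 ∂(μ ⊗ₘ P) := integral_nonneg fun _ => le_max_right _ _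
  rw [← ENNReal.ofReal_le_ofReal_iff hF0,
    ofReal_integral_eq_lintegral_ofReal (hJB.integrable lam) (ae_of_all _ fun t => (hJm01 t).1),
    ofReal_integral_eq_lintegral_ofReal (hF.integrable _) (ae_of_all _ fun t => le_max_right _ _)]
  have e : ∀ p : E × E, ENNReal.ofReal (max (a p.1 - a p.2) 0) = ENNReal.ofReal (a p.1 - a p.2) :=
    fun p => by
      rcases le_total (a p.1 - a p.2) 0 with h | h
      · rw [max_eq_right h, ENNReal.ofReal_of_nonpos h, ENNReal.ofReal_zero]
      · rw [max_eq_left h]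
  simp_rw [e]
  rw [lintegral_ofReal_sub_eq (μ ⊗ₘ P) (u := fun p => a p.1) (w := fun p => a p.2)
    (ha.comp measurable_fst) (ha.comp measurable_snd) (fun p => (ha01 p.2).1)
    fun p => (ha01 p.1).2]
  refine setLIntegral_mono' measurableSet_Ico fun t ht => ?_
  have hset : {p : E × E | a p.2 ≤ t ∧ t < a p.1} = {x | t < a x} ×ˢ {x | t < a x}ᶜ := by
    ext p; simp [and_comm]
  rw [hset, Measure.compProd_apply_prod (hmeas t) (hmeas t).compl]
  have := hle t
  simp only [max_eq_left ht.1] at this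
  simp only [hm, max_eq_left ht.1]
  exact hflow _ (hmeas t) this

/-- Cheeger's inequality, for functions supported in a set of measure at most one half. -/
theorem sq_le_energy_mul (hP : P.IsReversible μ)
    {J : ℝ → ℝ} (hJc : ConvexOn ℝ (Icc 0 (1 / 2)) J)
    (hJcont : ContinuousOn J (Icc 0 (1 / 2))) (hJm : MonotoneOn J (Icc 0 (1 / 2)))
    (hJ0 : J 0 = 0)
    (hflow : ∀ A, MeasurableSet A → μ A ≤ 1 / 2 →
      ENNReal.ofReal (J (μ.real A)) ≤ ∫⁻ x in A, P x Aᶜ ∂μ)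
    {g : E → ℝ} (hg : Measurable g) (hg01 : ∀ x, g x ∈ Icc (0 : ℝ) 1)
    (hhalf : μ {x | 0 < g x} ≤ 1 / 2) :
    ∫ x, g x ^ 2 ∂μ ≤ 1 / 2 ∧
      J (∫ x, g x ^ 2 ∂μ) ^ 2 ≤ 2 * energy μ P g * ∫ x, g x ^ 2 ∂μ := by
  have hgb := BddMeas.of_mem_Icc hg hg01
  have hsq01 : ∀ x, g x ^ 2 ∈ Icc (0 : ℝ) 1 := fun x =>
    ⟨sq_nonneg _, pow_le_one₀ (hg01 x).1 (hg01 x).2⟩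
  have hs : ∫ x, g x ^ 2 ∂μ ≤ 1 / 2 := by
    have hms : MeasurableSet {x | 0 < g x} := measurableSet_lt measurable_const hg
    calc ∫ x, g x ^ 2 ∂μ ≤ ∫ x, {x | 0 < g x}.indicator 1 x ∂μ := by
          refine integral_mono (hgb.sq.integrable μ)
            ((integrable_const (1 : ℝ)).indicator hms) fun x => ?_
          by_cases hx : 0 < g x
          · simpa [indicator, hx] using (hsq01 x).2
          · have : g x = 0 := le_antisymm (not_lt.1 hx) (hg01 x).1
            simp [indicator, this]
      _ = μ.real {x | 0 < g x} := integral_indicator_one hms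
      _ ≤ 1 / 2 := by
          have := ENNReal.toReal_mono (by simp) hhalf
          simpa [Measure.real] using this
  refine ⟨hs, ?_⟩
  have hs0 : 0 ≤ ∫ x, g x ^ 2 ∂μ := integral_nonneg fun _ => sq_nonneg _
  have hJ0' : 0 ≤ J (∫ x, g x ^ 2 ∂μ) :=
    hJ0 ▸ hJm ⟨le_rfl, by norm_num⟩ ⟨hs0, hs⟩ hs0
  -- The `L¹` inequality is applied to `g ^ 2`, whose positivity set is that of `g`.
  have h1 := le_integral_posPart hJc hJcont hJm hJ0 hflow (hg.pow_const 2) hsq01 (by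
    refine (measure_mono fun x (hx : 0 < g x ^ 2) => ?_).trans hhalf
    exact (hg01 x).1.lt_of_ne' fun h => by simp [h] at hx)
  have hg1 := hgb.comp (measurable_fst (α := E) (β := E))
  have hg2 := hgb.comp (measurable_snd (α := E) (β := E))
  have hposB : BddMeas fun p : E × E => max (g p.1 ^ 2 - g p.2 ^ 2) 0 := by
    obtain ⟨C, hC⟩ := (hg1.sq.sub hg2.sq).bdd
    exact ⟨by fun_prop, C, fun p => by
      rw [abs_of_nonneg (le_max_right _ _)]
      exact max_le ((le_abs_self _).trans (hC p)) ((abs_nonneg _).trans (hC p))⟩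
  have hposB' : BddMeas fun p : E × E => max (g p.2 ^ 2 - g p.1 ^ 2) 0 :=
    hposB.comp measurable_swap
  -- By reversibility the positive and negative parts of `g(x)² - g(y)²` have equal integrals, each
  -- half that of the absolute value. The latter factorises, which prepares Cauchy-Schwarz.
  have h2 : ∫ p, max (g p.1 ^ 2 - g p.2 ^ 2) 0 ∂(μ ⊗ₘ P)
      = (1 / 2) * ∫ p, |g p.2 - g p.1| * (g p.1 + g p.2) ∂(μ ⊗ₘ P) := by
    have e : ∀ p : E × E, |g p.2 - g p.1| * (g p.1 + g p.2)
        = max (g p.1 ^ 2 - g p.2 ^ 2) 0 + max (g p.2 ^ 2 - g p.1 ^ 2) 0 := by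
      intro p
      have p1 := (hg01 p.1).1
      have p2 := (hg01 p.2).1
      rcases le_total (g p.1) (g p.2) with h | h
      · rw [abs_of_nonneg (by linarith), max_eq_right (by nlinarith), max_eq_left (by nlinarith)]
        ring
      · rw [abs_of_nonpos (by linarith), max_eq_left (by nlinarith), max_eq_right (by nlinarith)]
        ring
    simp_rw [e]
    rw [integral_add (hposB.integrable _) (hposB'.integrable _),
      ← integral_swap_compProd hP fun p => max (g p.2 ^ 2 - g p.1 ^ 2) 0]
    simp only [Prod.snd_swap, Prod.fst_swap]
    ring
  have h3 := sq_integral_mul_le (μ := μ ⊗ₘ P) (hg2.sub hg1).abs (hg1.add hg2)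
  have h4 : ∫ p, |g p.2 - g p.1| ^ 2 ∂(μ ⊗ₘ P) = 2 * energy μ P g := by
    simp_rw [sq_abs, energy]; ring
  have h5 : ∫ p, (g p.1 + g p.2) ^ 2 ∂(μ ⊗ₘ P) ≤ 4 * ∫ x, g x ^ 2 ∂μ := by
    calc ∫ p, (g p.1 + g p.2) ^ 2 ∂(μ ⊗ₘ P)
        ≤ ∫ p, (2 * g p.1 ^ 2 + 2 * g p.2 ^ 2) ∂(μ ⊗ₘ P) := by
          refine integral_mono ((hg1.add hg2).sq.integrable _)
            (((hg1.sq.const_mul 2).add (hg2.sq.const_mul 2)).integrable _) fun p => ?_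
          simp only
          nlinarith [sq_nonneg (g p.1 - g p.2)]
      _ = 4 * ∫ x, g x ^ 2 ∂μ := by
          rw [integral_add ((hg1.sq.const_mul 2).integrable _) ((hg2.sq.const_mul 2).integrable _),
            integral_const_mul, integral_const_mul, integral_fst_compProd hgb.sq,
            integral_snd_compProd hP hgb.sq]
          ring
  rw [h2] at h1
  rw [h4] at h3
  have hE : 0 ≤ 2 * energy μ P g := mul_nonneg zero_le_two (energy_nonneg _)
  calc J (∫ x, g x ^ 2 ∂μ) ^ 2
      ≤ ((1 / 2) * ∫ p, |g p.2 - g p.1| * (g p.1 + g p.2) ∂(μ ⊗ₘ P)) ^ 2 :=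
        pow_le_pow_left₀ hJ0' h1 2
    _ = (1 / 4) * (∫ p, |g p.2 - g p.1| * (g p.1 + g p.2) ∂(μ ⊗ₘ P)) ^ 2 := by ring
    _ ≤ (1 / 4) * (2 * energy μ P g * (4 * ∫ x, g x ^ 2 ∂μ)) := by
        gcongr
        exact h3.trans (mul_le_mul_of_nonneg_left h5 hE)
    _ = _ := by ring

theorem energy_le_energy_of_abs_sub_le {f g : E → ℝ} (hf : BddMeas f) (hg : BddMeas g)
    (h : ∀ x y, |g y - g x| ≤ |f y - f x|) : energy μ P g ≤ energy μ P f := by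
  refine mul_le_mul_of_nonneg_left (integral_mono ?_ ?_ fun p => ?_) (by norm_num)
  · exact ((hg.comp measurable_snd).sub (hg.comp measurable_fst)).sq.integrable _
  · exact ((hf.comp measurable_snd).sub (hf.comp measurable_fst)).sq.integrable _
  · exact sq_le_sq.2 (h _ _)

/-- Cheeger's inequality for functions with values in `[0, 1]`. -/
theorem exists_sq_le_energy_mul (hP : P.IsReversible μ)
    {J : ℝ → ℝ} (hJc : ConvexOn ℝ (Icc 0 (1 / 2)) J)
    (hJcont : ContinuousOn J (Icc 0 (1 / 2))) (hJm : MonotoneOn J (Icc 0 (1 / 2)))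
    (hJ0 : J 0 = 0)
    (hflow : ∀ A, MeasurableSet A → μ A ≤ 1 / 2 →
      ENNReal.ofReal (J (μ.real A)) ≤ ∫⁻ x in A, P x Aᶜ ∂μ)
    {f : E → ℝ} (hf : Measurable f) (hf01 : ∀ x, f x ∈ Icc (0 : ℝ) 1) :
    ∃ s, (∫ x, (f x - ∫ y, f y ∂μ) ^ 2 ∂μ) / 2 ≤ s ∧ s ≤ 1 / 2 ∧
      J s ^ 2 ≤ 2 * energy μ P f * s := by
  have hfb := BddMeas.of_mem_Icc hf hf01
  obtain ⟨m, hm, hm1, hm2⟩ := exists_median μ hf hf01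
  -- Splitting at a median gives two functions, each supported in a set of measure at most `1/2`.
  -- Both are 1-Lipschitz functions of `f`, so their energies do not exceed that of `f`; the one
  -- with the larger second moment carries at least half of the variance.
  set g₁ : E → ℝ := fun x => max (f x - m) 0 with hg₁
  set g₂ : E → ℝ := fun x => max (m - f x) 0 with hg₂
  have hg₁01 : ∀ x, g₁ x ∈ Icc (0 : ℝ) 1 := fun x =>
    ⟨le_max_right _ _, max_le (by linarith [(hf01 x).2, hm.1]) zero_le_one⟩
  have hg₂01 : ∀ x, g₂ x ∈ Icc (0 : ℝ) 1 := fun x =>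
    ⟨le_max_right _ _, max_le (by linarith [(hf01 x).1, hm.2]) zero_le_one⟩
  have hg₁m : Measurable g₁ := by fun_prop
  have hg₂m : Measurable g₂ := by fun_prop
  have hg₁b := BddMeas.of_mem_Icc hg₁m hg₁01
  have hg₂b := BddMeas.of_mem_Icc hg₂m hg₂01
  obtain ⟨s1, c1⟩ := sq_le_energy_mul hP hJc hJcont hJm hJ0 hflow hg₁m hg₁01
    (by simpa [hg₁, lt_max_iff] using hm1)
  obtain ⟨s2, c2⟩ := sq_le_energy_mul hP hJc hJcont hJm hJ0 hflow hg₂m hg₂01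
    (by simpa [hg₂, lt_max_iff] using hm2)
  have e1 : energy μ P g₁ ≤ energy μ P f := energy_le_energy_of_abs_sub_le hfb hg₁b fun x y => by
    simpa [hg₁] using abs_max_sub_max_le_abs (f y - m) (f x - m) 0
  have e2 : energy μ P g₂ ≤ energy μ P f := energy_le_energy_of_abs_sub_le hfb hg₂b fun x y => by
    have := abs_max_sub_max_le_abs (m - f y) (m - f x) 0
    rwa [sub_sub_sub_cancel_left, abs_sub_comm (f x)] at this
  -- The variance is at most the second moment about `m`; the two differ by `(m - c) ^ 2`.
  have hvar : ∫ x, (f x - ∫ y, f y ∂μ) ^ 2 ∂μ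
      ≤ ∫ x, g₁ x ^ 2 ∂μ + ∫ x, g₂ x ^ 2 ∂μ := by
    set c := ∫ y, f y ∂μ
    have a1 : ∀ x, (f x - c) ^ 2 = (f x - m) ^ 2 + (2 * (m - c) * f x + (c ^ 2 - m ^ 2)) :=
      fun x => by ring
    have a2 : ∀ x, (f x - m) ^ 2 = g₁ x ^ 2 + g₂ x ^ 2 := fun x => by
      rcases le_total (f x) m with h | h
      · rw [hg₁, hg₂]; simp only
        rw [max_eq_right (by linarith), max_eq_left (by linarith)]; ring
      · rw [hg₁, hg₂]; simp only
        rw [max_eq_left (by linarith), max_eq_right (by linarith)]; ring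
    simp_rw [a1]
    rw [integral_add ((hfb.sub (.const m)).sq.integrable μ)
      (((hfb.const_mul _).add (.const _)).integrable μ),
      integral_add ((hfb.const_mul _).integrable μ) (integrable_const _), integral_const_mul]
    simp_rw [a2]
    rw [integral_add (hg₁b.sq.integrable μ) (hg₂b.sq.integrable μ)]
    simp only [integral_const, probReal_univ, one_smul]
    change _ + (2 * (m - c) * c + _) ≤ _
    nlinarith [sq_nonneg (m - c)]
  have n1 : 0 ≤ ∫ x, g₁ x ^ 2 ∂μ := integral_nonneg fun _ => sq_nonneg _
  have n2 : 0 ≤ ∫ x, g₂ x ^ 2 ∂μ := integral_nonneg fun _ => sq_nonneg _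
  rcases le_total (∫ x, g₁ x ^ 2 ∂μ) (∫ x, g₂ x ^ 2 ∂μ) with h | h
  · exact ⟨_, by linarith, s2, c2.trans (by gcongr)⟩
  · exact ⟨_, by linarith, s1, c1.trans (by gcongr)⟩

end Cheeger

/-! ### Convex profiles and the function `J(t)² / t` -/

/-- A convex increasing function on `[0, 1/2]`, vanishing at `0` and positive elsewhere. -/
structure IsConvexProfile (J : ℝ → ℝ) : Prop where
  convexOn : ConvexOn ℝ (Icc 0 (1 / 2)) J
  continuousOn : ContinuousOn J (Icc 0 (1 / 2))
  monotoneOn : MonotoneOn J (Icc 0 (1 / 2))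
  map_zero : J 0 = 0
  pos : ∀ t ∈ Ioc (0 : ℝ) (1 / 2), 0 < J t

namespace IsConvexProfile

variable {J : ℝ → ℝ}

theorem nonneg (hJ : IsConvexProfile J) {t : ℝ} (ht : t ∈ Icc (0 : ℝ) (1 / 2)) : 0 ≤ J t := by
  rcases ht.1.eq_or_lt with h | h
  · rw [← h, hJ.map_zero]
  · exact (hJ.pos t ⟨h, ht.2⟩).le

/-- Convexity with value `0` at the origin makes `J t / t` nondecreasing; the cross-multiplied form
also covers the origin. -/
theorem mul_le_mul (hJ : IsConvexProfile J) {s t : ℝ} (hs : 0 ≤ s) (hst : s ≤ t)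
    (ht : t ≤ 1 / 2) : J s * t ≤ J t * s := by
  rcases (hs.trans hst).eq_or_lt with h | h
  · have : s = 0 := le_antisymm (h ▸ hst) hs
    rw [← h, this, hJ.map_zero]
  have := hJ.convexOn.2 (x := t) (y := 0) ⟨h.le, ht⟩ ⟨le_rfl, by norm_num⟩
    (div_nonneg hs h.le) (sub_nonneg.2 ((div_le_one h).2 hst)) (by ring)
  simp only [smul_eq_mul, mul_zero, add_zero, hJ.map_zero] at this
  rw [div_mul_cancel₀ _ h.ne', div_mul_eq_mul_div, le_div_iff₀ h] at this
  linarith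

/-- The function `J(t)² / t`. -/
theorem div_sq_mono (hJ : IsConvexProfile J) {s t : ℝ} (hs : 0 ≤ s) (hst : s ≤ t)
    (ht : t ≤ 1 / 2) : J s ^ 2 / s * t ≤ J t ^ 2 / t * s := by
  rcases hs.eq_or_lt with h | h
  · simp [← h]
  have h1 := hJ.mul_le_mul hs hst ht
  have h0 : 0 ≤ J s * t := mul_nonneg (hJ.nonneg ⟨hs, hst.trans ht⟩) (hs.trans hst)
  have htp := h.trans_le hst
  rw [div_mul_eq_mul_div, div_mul_eq_mul_div, div_le_div_iff₀ h htp]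
  have := pow_le_pow_left₀ h0 h1 2
  nlinarith

/-- Since `J(t)² / t²` is nondecreasing, doubling the argument at least doubles `J(t)² / t`. This
trades the argument `w/4` coming from Cheeger's inequality for `w/8` with an extra factor `2`. -/
theorem two_mul_div_le (hJ : IsConvexProfile J) {t : ℝ} (h0 : 0 ≤ t) (ht : t ≤ 1 / 4) :
    2 * (J t ^ 2 / t) ≤ J (2 * t) ^ 2 / (2 * t) := by
  rcases h0.eq_or_lt with h | h
  · simp [← h]
  have := hJ.div_sq_mono h0 (by linarith : t ≤ 2 * t) (by linarith)
  refine le_of_mul_le_mul_right ?_ h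
  linarith

/-- The growth is at least linear and the value at the larger point is positive, hence strictness.
At the origin the quotient is `0` by the convention for division. -/
theorem div_sq_strictMonoOn (hJ : IsConvexProfile J) :
    StrictMonoOn (fun t => J t ^ 2 / t) (Icc 0 (1 / 2)) := by
  intro s hs t ht hst
  have htp : 0 < t := hs.1.trans_lt hst
  have hp : 0 < J t ^ 2 / t := div_pos (pow_pos (hJ.pos t ⟨htp, ht.2⟩) 2) htp
  have h1 := hJ.div_sq_mono hs.1 hst.le ht.2
  refine lt_of_mul_lt_mul_right (h1.trans_lt ?_) htp.le
  exact mul_lt_mul_of_pos_left hst hp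

/-- `J² / t` is the supremum over `l` of `2 l J(t) - l² t`, which is convex for `l ≥ 0`. The
supremum is attained at `l = J(z) / z`, so testing this single `l` at the convex combination `z`
suffices. -/
theorem div_sq_convexOn (hJ : IsConvexProfile J) :
    ConvexOn ℝ (Icc 0 (1 / 2)) (fun t => J t ^ 2 / t) := by
  have key : ∀ x ∈ Icc (0 : ℝ) (1 / 2), ∀ l : ℝ, 2 * l * J x - l ^ 2 * x ≤ J x ^ 2 / x := by
    intro x hx l
    rcases hx.1.eq_or_lt with h | h
    · simp [← h, hJ.map_zero]
    · rw [le_div_iff₀ h]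
      nlinarith [sq_nonneg (J x - l * x)]
  refine ⟨convex_Icc _ _, fun x hx y hy a b ha hb hab => ?_⟩
  have hz := (convex_Icc (0 : ℝ) (1 / 2)) hx hy ha hb hab
  have hJz := hJ.convexOn.2 hx hy ha hb hab
  simp only [smul_eq_mul] at hz hJz ⊢
  set z := a * x + b * y with hzdef
  rcases hz.1.eq_or_lt with h | h
  · rw [← h, div_zero]
    exact add_nonneg (mul_nonneg ha (div_nonneg (sq_nonneg _) hx.1))
      (mul_nonneg hb (div_nonneg (sq_nonneg _) hy.1))
  · set l := J z / z with hl
    have hl0 : 0 ≤ l := div_nonneg (hJ.nonneg hz) h.le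
    have e : J z ^ 2 / z = 2 * l * J z - l ^ 2 * z := by
      rw [hl]; field_simp; ring
    have k1 := mul_le_mul_of_nonneg_left (key x hx l) ha
    have k2 := mul_le_mul_of_nonneg_left (key y hy l) hb
    have k3 := mul_le_mul_of_nonneg_left hJz (by linarith : 0 ≤ 2 * l)
    rw [e]
    rw [hzdef] at k3 ⊢
    linarith

end IsConvexProfile

/-! ### From a flow bound to the weak Poincaré inequality -/

section WeakPoincare

variable {E : Type*} [MeasurableSpace E] {μ : Measure E} {P : Kernel E E}

/-- A function of finite essential oscillation has a bounded version. -/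
theorem exists_bounded_version [IsProbabilityMeasure μ] {f : E → ℝ} (hf : AEMeasurable f μ)
    (hosc : eOsc μ f ≠ ∞) :
    ∃ (a b : ℝ) (g : E → ℝ), Measurable g ∧ f =ᵐ[μ] g ∧ (∀ x, g x ∈ Icc a b) ∧
      eOsc μ f = ENNReal.ofReal (b - a) ∧ ∀ c : ℝ, (∀ᵐ x ∂μ, c ≤ f x) → c ≤ a := by
  set S := essSup (fun x => (f x : EReal)) μ with hS
  set R := essInf (fun x => (f x : EReal)) μ with hR
  have h1 : ∀ᵐ x ∂μ, (f x : EReal) ≤ S := ae_le_essSup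
  have h2 : ∀ᵐ x ∂μ, R ≤ (f x : EReal) := ae_essInf_le
  obtain ⟨x₀, hx1, hx2⟩ := (h1.and h2).exists
  have hSb : S ≠ ⊥ := fun h => by simp [h] at hx1
  have hRt : R ≠ ⊤ := fun h => by simp [h] at hx2
  have hosc' : S - R ≠ ⊤ := fun h => hosc (by rw [eOsc, ← hS, ← hR, h]; rfl)
  have hSt : S ≠ ⊤ := fun h => hosc' (by rw [h]; exact EReal.top_sub hRt)
  have hRb : R ≠ ⊥ := fun h => hosc' (by rw [h]; exact EReal.sub_bot hSb)
  lift S to ℝ using ⟨hSt, hSb⟩ with b hb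
  lift R to ℝ using ⟨hRt, hRb⟩ with a ha
  have hab : a ≤ b := by exact_mod_cast hx2.trans hx1
  refine ⟨a, b, fun x => max a (min b (hf.mk f x)),
    measurable_const.max (measurable_const.min hf.measurable_mk), ?_, fun x =>
      ⟨le_max_left _ _, max_le hab (min_le_left _ _)⟩, ?_, fun c hc => ?_⟩
  · filter_upwards [h1, h2, hf.ae_eq_mk] with x k1 k2 k3
    have k1' : f x ≤ b := by exact_mod_cast k1
    have k2' : a ≤ f x := by exact_mod_cast k2
    rw [← k3, min_eq_right k1', max_eq_right k2']
  · rw [eOsc, ← hS, ← hR, ← EReal.coe_sub, EReal.toENNReal_of_ne_top (EReal.coe_ne_top _),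
      EReal.toReal_coe]
  -- This clause later shows that the bounded version of a probability density is nonnegative.
  · have : (c : EReal) ≤ essInf (fun x => (f x : EReal)) μ :=
      le_essInf_of_ae_le _ (hc.mono fun x hx => EReal.coe_le_coe_iff.2 hx)
    rw [← hR] at this
    exact_mod_cast this

theorem eLpNorm_two_sq {f : E → ℝ} [IsFiniteMeasure μ] (hf : BddMeas f) :
    eLpNorm f 2 μ ^ 2 = ENNReal.ofReal (∫ x, f x ^ 2 ∂μ) := by
  rw [ofReal_integral_eq_lintegral_ofReal (hf.sq.integrable μ) (ae_of_all _ fun _ => sq_nonneg _),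
    eLpNorm_eq_lintegral_rpow_enorm_toReal (by simp) (by simp), ← ENNReal.rpow_natCast,
    ← ENNReal.rpow_mul]
  simp [Real.enorm_eq_ofReal_abs, ← ENNReal.ofReal_pow]

/-- Popoviciu's inequality, the source of the constant `1/4`. -/
theorem integral_sub_sq_le [IsProbabilityMeasure μ] {f : E → ℝ} {a b : ℝ} (hf : Measurable f)
    (hab : ∀ x, f x ∈ Icc a b) :
    ∫ x, (f x - ∫ y, f y ∂μ) ^ 2 ∂μ ≤ (b - a) ^ 2 / 4 := by
  rw [← variance_eq_integral hf.aemeasurable]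
  have := variance_le_sq_of_bounded (μ := μ) (ae_of_all _ hab) hf.aemeasurable
  linarith

/-- The function `c J(v/8)² / (v/8)` of the weak Poincaré inequality. -/
noncomputable def wpiFun (J : ℝ → ℝ) (c v : ℝ) : ℝ := c * (J (v / 8) ^ 2 / (v / 8))

variable [IsProbabilityMeasure μ] [IsMarkovKernel P]

/-- The weak Poincaré inequality for a bounded function. -/
theorem wpiFun_mul_le_energy (hP : P.IsReversible μ) {J : ℝ → ℝ} (hJ : IsConvexProfile J)
    {k : ℝ} (hk : 0 < k)
    (hflow : ∀ A, MeasurableSet A → μ A ≤ 1 / 2 →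
      ENNReal.ofReal (2 * k * J (μ.real A / 2)) ≤ ∫⁻ x in A, P x Aᶜ ∂μ)
    {f : E → ℝ} (hf : Measurable f) {a b : ℝ} (hab : a < b) (hfab : ∀ x, f x ∈ Icc a b) :
    (b - a) ^ 2 * wpiFun J (2 * k ^ 2)
      ((∫ x, (f x - ∫ y, f y ∂μ) ^ 2 ∂μ) / (b - a) ^ 2) ≤ energy μ P f := by
  have ho : 0 < b - a := sub_pos.2 hab
  set o := b - a with hodef
  have hfb := BddMeas.of_mem_Icc hf hfab
  set F : E → ℝ := fun x => (f x - a) / o with hF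
  have hFm : Measurable F := by fun_prop
  have hF01 : ∀ x, F x ∈ Icc (0 : ℝ) 1 := fun x =>
    ⟨div_nonneg (sub_nonneg.2 (hfab x).1) ho.le, (div_le_one ho).2 (by linarith [(hfab x).2])⟩
  have hhalf : ∀ t ∈ Icc (0 : ℝ) (1 / 2), t / 2 ∈ Icc (0 : ℝ) (1 / 2) := fun t ht =>
    ⟨by linarith [ht.1], by linarith [ht.1, ht.2]⟩
  have hc : ConvexOn ℝ (Icc 0 (1 / 2)) fun t => 2 * k * J (t / 2) := by
    refine ⟨convex_Icc _ _, fun x hx y hy p q hp hq hpq => ?_⟩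
    have := hJ.convexOn.2 (hhalf x hx) (hhalf y hy) hp hq hpq
    simp only [smul_eq_mul] at this ⊢
    have e : p * (x / 2) + q * (y / 2) = (p * x + q * y) / 2 := by ring
    rw [e] at this
    nlinarith
  have hcont : ContinuousOn (fun t => 2 * k * J (t / 2)) (Icc 0 (1 / 2)) :=
    continuousOn_const.mul (hJ.continuousOn.comp (continuous_id.div_const 2).continuousOn hhalf)
  have hmono : MonotoneOn (fun t => 2 * k * J (t / 2)) (Icc 0 (1 / 2)) := fun x hx y hy hxy =>
    mul_le_mul_of_nonneg_left (hJ.monotoneOn (hhalf x hx) (hhalf y hy) (by linarith)) (by linarith)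
  -- Cheeger's inequality for the normalised function, with profile `t ↦ 2 k J(t/2)`.
  obtain ⟨s, hs1, hs2, hs3⟩ := exists_sq_le_energy_mul hP hc hcont hmono
    (by simp [hJ.map_zero]) hflow hFm hF01
  have hvar : ∫ x, (F x - ∫ y, F y ∂μ) ^ 2 ∂μ = (∫ x, (f x - ∫ y, f y ∂μ) ^ 2 ∂μ) / o ^ 2 := by
    have e1 : ∫ y, F y ∂μ = ((∫ y, f y ∂μ) - a) / o := by
      rw [hF, integral_div, integral_sub (hfb.integrable μ) (integrable_const a)]
      simp
    have e2 : ∀ x, (F x - ∫ y, F y ∂μ) ^ 2 = (f x - ∫ y, f y ∂μ) ^ 2 / o ^ 2 := fun x => by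
      rw [e1, hF]; field_simp; ring
    simp_rw [e2]
    rw [integral_div]
  have hen : energy μ P f = o ^ 2 * energy μ P F := by
    have e : ∀ p : E × E, (f p.2 - f p.1) ^ 2 = o ^ 2 * (F p.2 - F p.1) ^ 2 := fun p => by
      simp only [hF]; field_simp; ring
    simp_rw [energy, e]
    rw [integral_const_mul]
    ring
  rw [hen, ← hvar]
  set w := ∫ x, (F x - ∫ y, F y ∂μ) ^ 2 ∂μ with hw
  have hw0 : 0 ≤ w := integral_nonneg fun _ => sq_nonneg _
  refine mul_le_mul_of_nonneg_left ?_ (sq_nonneg _)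
  rcases (by linarith : 0 ≤ s).eq_or_lt with h | h
  · have : w = 0 := by linarith
    simp [wpiFun, this, energy_nonneg]
  -- This is `(2 k J(s/2))² ≤ 2 𝓔 s` divided by `2 s`.
  · have c1 : k ^ 2 * (J (s / 2) ^ 2 / (s / 2)) ≤ energy μ P F := by
      rw [← mul_div_assoc, div_le_iff₀ (by linarith)]
      nlinarith
    have c2 : J (w / 4) ^ 2 / (w / 4) ≤ J (s / 2) ^ 2 / (s / 2) :=
      hJ.div_sq_strictMonoOn.monotoneOn ⟨by linarith, by linarith⟩ ⟨by linarith, by linarith⟩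
        (by linarith)
    have c3 := hJ.two_mul_div_le (t := w / 8) (by linarith) (by linarith)
    rw [show 2 * (w / 8) = w / 4 by ring] at c3
    calc wpiFun J (2 * k ^ 2) w = k ^ 2 * (2 * (J (w / 8) ^ 2 / (w / 8))) := by
          rw [wpiFun]; ring
      _ ≤ k ^ 2 * (J (s / 2) ^ 2 / (s / 2)) :=
          mul_le_mul_of_nonneg_left (c3.trans c2) (sq_nonneg k)
      _ ≤ _ := c1

omit [IsMarkovKernel P] in
/-- The ratio `‖f‖₂² / ‖f‖_osc²` is at most `1/4` on centred functions. -/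
theorem sieveInterval_subset : sieveInterval μ (fun f => eOsc μ f ^ 2) ⊆ Icc 0 (1 / 4) := by
  rintro v ⟨hv0, hv⟩
  refine ⟨hv0, ?_⟩
  have h : sieveConst μ (fun f => eOsc μ f ^ 2) ≤ ENNReal.ofReal (1 / 4) := by
    refine iSup₂_le fun f hf => ?_
    obtain ⟨⟨hL2, hmean⟩, hne⟩ := hf
    by_cases hosc : eOsc μ f = ∞
    · simp [hosc]
    obtain ⟨a, b, g, hg, hfg, hgab, ho, -⟩ :=
      exists_bounded_version hL2.aestronglyMeasurable.aemeasurable hosc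
    have hgb := BddMeas.of_mem_Icc hg hgab
    have hmg : ∫ x, g x ∂μ = 0 := by rw [← integral_congr_ae hfg, hmean]
    have hle := integral_sub_sq_le (μ := μ) hg hgab
    simp only [hmg, sub_zero] at hle
    beta_reduce
    rw [eLpNorm_congr_ae hfg, eLpNorm_two_sq hgb, ho]
    have hab : a ≤ b := by
      obtain ⟨x⟩ := Measure.nonempty_of_neZero μ
      exact (hgab x).1.trans (hgab x).2
    rcases hab.eq_or_lt with h | h
    · exfalso
      apply hne
      have h0 : ∀ x, g x = a := fun x => le_antisymm (h ▸ (hgab x).2) (hgab x).1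
      have : a = 0 := by simpa [h0] using hmg
      filter_upwards [hfg] with x hx
      rw [hx, h0, this]; rfl
    · rw [← ENNReal.ofReal_pow (by linarith)]
      refine ENNReal.div_le_of_le_mul ?_
      rw [← ENNReal.ofReal_mul (by norm_num)]
      exact ENNReal.ofReal_le_ofReal (by linarith)
  exact (ENNReal.ofReal_le_ofReal_iff (by norm_num)).1 (hv.trans h)

/-- A lower bound on the flow by a convex profile implies a weak Poincaré inequality. -/
theorem kStarWPI_of_flow (hP : P.IsReversible μ) {J : ℝ → ℝ} (hJ : IsConvexProfile J)
    {k : ℝ} (hk : 0 < k)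
    (hflow : ∀ A, MeasurableSet A → μ A ≤ 1 / 2 →
      ENNReal.ofReal (2 * k * J (μ.real A / 2)) ≤ ∫⁻ x in A, P x Aᶜ ∂μ) :
    KStarWPI μ P (fun f => eOsc μ f ^ 2) (wpiFun J (2 * k ^ 2)) := by
  have hsub := sieveInterval_subset (μ := μ)
  have hk2 : 0 < 2 * k ^ 2 := by positivity
  have hconv : Convex ℝ (sieveInterval μ (fun f => eOsc μ f ^ 2)) := by
    have : OrdConnected (sieveInterval μ (fun f => eOsc μ f ^ 2)) :=
      ⟨fun x hx y hy z hz => ⟨hx.1.trans hz.1, (ENNReal.ofReal_le_ofReal hz.2).trans hy.2⟩⟩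
    exact this.convex
  have h8 : ∀ v ∈ sieveInterval μ (fun f => eOsc μ f ^ 2), v / 8 ∈ Icc (0 : ℝ) (1 / 2) :=
    fun v hv => ⟨by linarith [(hsub hv).1], by linarith [(hsub hv).2]⟩
  refine ⟨fun v hv => ?_, ⟨hconv, fun x hx y hy p q hp hq hpq => ?_⟩, fun x hx y hy hxy => ?_, ?_,
    fun f hf hΨ0 hΨ => ?_⟩
  · exact mul_nonneg hk2.le (div_nonneg (sq_nonneg _) (h8 v hv).1)
  · have := hJ.div_sq_convexOn.2 (h8 x hx) (h8 y hy) hp hq hpq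
    simp only [smul_eq_mul, wpiFun] at this ⊢
    have e : p * (x / 8) + q * (y / 8) = (p * x + q * y) / 8 := by ring
    rw [e] at this
    nlinarith
  · exact mul_lt_mul_of_pos_left
      (hJ.div_sq_strictMonoOn (h8 x hx) (h8 y hy) (by linarith)) hk2
  -- The value at `0` has a zero denominator, so it vanishes by the convention for division.
  · simp [wpiFun]
  · obtain ⟨hL2, hmean⟩ := hf
    have hosc : eOsc μ f ≠ ∞ := fun h => by simp [h] at hΨ
    obtain ⟨a, b, g, hg, hfg, hgab, ho, -⟩ :=
      exists_bounded_version hL2.aestronglyMeasurable.aemeasurable hosc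
    have hgb := BddMeas.of_mem_Icc hg hgab
    have hmg : ∫ x, g x ∂μ = 0 := by rw [← integral_congr_ae hfg, hmean]
    have hab : 0 < b - a := by
      by_contra! h
      rw [ho, ENNReal.ofReal_of_nonpos h] at hΨ0
      simp at hΨ0
    have hmain := wpiFun_mul_le_energy hP hJ hk hflow hg (sub_pos.1 hab) hgab
    simp only [hmg, sub_zero] at hmain
    have ho2 : 0 < (b - a) ^ 2 := by positivity
    rw [eLpNorm_congr_ae hfg, eLpNorm_two_sq hgb, ho, dirichletForm_congr hP hfg,
      dirichletForm_eq hgb, ← ENNReal.ofReal_pow hab.le, ← ENNReal.ofReal_div_of_pos ho2,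
      ← ENNReal.ofReal_div_of_pos ho2,
      ENNReal.toReal_ofReal (div_nonneg (integral_nonneg fun _ => sq_nonneg _) ho2.le)]
    refine ENNReal.ofReal_le_ofReal ?_
    rw [le_div_iff₀ ho2]
    linarith

end WeakPoincare

/-! ### Decay of the variance along the chain -/

section Decay

/-- On `(0, T]` the profile lies below the chord `(J T / T) t`, so the integrand dominates a
multiple of `1/t`. Hence the bound on `n` is trivial once the variance has reached zero. -/
theorem lintegral_div_sq_eq_top {J : ℝ → ℝ} (hJ : IsConvexProfile J) {T : ℝ} (hT : 0 < T)
    (hT' : T ≤ 1 / 2) : ∫⁻ t in Ioc 0 T, ENNReal.ofReal (t / J t ^ 2) = ∞ := by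
  have hJT := hJ.pos T ⟨hT, hT'⟩
  have hle : ∫⁻ t in Ioc 0 T, ENNReal.ofReal ((T / J T) ^ 2) * ENNReal.ofReal t⁻¹
      ≤ ∫⁻ t in Ioc 0 T, ENNReal.ofReal (t / J t ^ 2) := by
    refine setLIntegral_mono' measurableSet_Ioc fun t ht => ?_
    rw [← ENNReal.ofReal_mul (sq_nonneg _)]
    refine ENNReal.ofReal_le_ofReal ?_
    have hJt := hJ.pos t ⟨ht.1, ht.2.trans hT'⟩
    have h1 := hJ.mul_le_mul ht.1.le ht.2 hT'
    have h2 := pow_le_pow_left₀ (by positivity) h1 2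
    have ht0 := ht.1
    rw [div_pow, ← div_eq_mul_inv, div_div, div_le_div_iff₀ (by positivity) (by positivity)]
    nlinarith
  refine top_unique (le_trans (le_of_eq ?_) hle)
  rw [lintegral_const_mul _ (by fun_prop), eq_comm, ENNReal.mul_eq_top]
  refine Or.inl ⟨(ENNReal.ofReal_pos.2 (by positivity)).ne', ?_⟩
  by_contra hfin
  have hint : IntegrableOn (fun t : ℝ => t⁻¹) (Ioc 0 T) := by
    refine ⟨by fun_prop, ?_⟩
    rw [hasFiniteIntegral_iff_ofReal]
    · exact lt_top_iff_ne_top.2 hfin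
    · filter_upwards [ae_restrict_mem measurableSet_Ioc] with t ht using (inv_pos.2 ht.1).le
  rw [← intervalIntegrable_iff_integrableOn_Ioc_of_le hT.le, intervalIntegrable_inv_iff] at hint
  rcases hint with h | h
  · exact hT.ne h
  · exact h left_mem_uIcc

/-- A sequence with `v (n+1) ≤ v n - K (v n)` decreases at least at the rate prescribed by the
integral of `1 / K`. -/
theorem le_lintegral_of_decay {J : ℝ → ℝ} (hJ : IsConvexProfile J) {c : ℝ} (hc : 0 < c)
    {v : ℕ → ℝ} (hv : ∀ n, 0 ≤ v n) (hpos : 0 < v 0) (hle : v 0 ≤ 1 / 4)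
    (hstep : ∀ n, v (n + 1) ≤ v n - wpiFun J c (v n)) (n : ℕ) :
    (n : ℝ≥0∞) ≤ ENNReal.ofReal (8 / c) *
      ∫⁻ t in Ioc (v n / 8) (v 0 / 8), ENNReal.ofReal (t / J t ^ 2) := by
  have hK : ∀ n, 0 ≤ wpiFun J c (v n) := fun n =>
    mul_nonneg hc.le (div_nonneg (sq_nonneg _) (by linarith [hv n]))
  have hanti : Antitone v := antitone_nat_of_succ_le fun n => by linarith [hstep n, hK n]
  induction n with
  | zero => simp
  | succ n ih =>
    -- If `v n = 0` the sequence stays at zero and the right-hand side is infinite.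
    rcases (hv n).eq_or_lt with h | h
    · have h1 : v (n + 1) = 0 := le_antisymm (h ▸ hanti n.le_succ) (hv _)
      rw [h1, zero_div, lintegral_div_sq_eq_top hJ (by linarith) (by linarith),
        ENNReal.mul_top (by simpa using hc)]
      exact le_top
    · set T := v n / 8 with hT
      have hn0 : v n ≤ v 0 := hanti n.zero_le
      have hT0 : 0 < T := by positivity
      have hT2 : T ≤ 1 / 2 := by linarith
      have hH : 0 < J T ^ 2 / T := div_pos (pow_pos (hJ.pos T ⟨hT0, hT2⟩) 2) hT0
      have hsplit : Ioc (v (n + 1) / 8) (v 0 / 8) = Ioc (v (n + 1) / 8) T ∪ Ioc T (v 0 / 8) :=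
        (Ioc_union_Ioc_eq_Ioc (by linarith [hanti n.le_succ]) (by linarith)).symm
      rw [hsplit, lintegral_union measurableSet_Ioc (Ioc_disjoint_Ioc_of_le le_rfl), mul_add,
        Nat.cast_succ, add_comm]
      refine add_le_add ?_ ih
      -- The integrand is nonincreasing in `t`, hence at least its value at `T`. The interval has
      -- length at least `c J(T)² / (8 T)`, so each step adds at least `c / 8` to the integral.
      have h1 : ∫⁻ t in Ioc (v (n + 1) / 8) T, ENNReal.ofReal (J T ^ 2 / T)⁻¹
          ≤ ∫⁻ t in Ioc (v (n + 1) / 8) T, ENNReal.ofReal (t / J t ^ 2) := by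
        refine setLIntegral_mono' measurableSet_Ioc fun t ht => ENNReal.ofReal_le_ofReal ?_
        have ht0 : 0 < t := (div_nonneg (hv _) (by norm_num)).trans_lt ht.1
        have htp : 0 < J t ^ 2 / t := div_pos (pow_pos (hJ.pos t ⟨ht0, ht.2.trans hT2⟩) 2) ht0
        rw [← inv_div (J t ^ 2) t]
        exact inv_anti₀ htp (hJ.div_sq_strictMonoOn.monotoneOn ⟨ht0.le, ht.2.trans hT2⟩
          ⟨hT0.le, hT2⟩ ht.2)
      refine le_trans ?_ (mul_le_mul_right h1 _)
      rw [setLIntegral_const, Real.volume_Ioc, ← ENNReal.ofReal_mul (by positivity),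
        ← ENNReal.ofReal_mul (by positivity), ← ENNReal.ofReal_one]
      refine ENNReal.ofReal_le_ofReal ?_
      have h2 : c * (J T ^ 2 / T) ≤ 8 * (T - v (n + 1) / 8) := by
        have := hstep n
        rw [wpiFun, ← hT] at this
        linarith
      calc (1 : ℝ) = 8 / c * ((J T ^ 2 / T)⁻¹ * (c * (J T ^ 2 / T) / 8)) := by
            field_simp
            exact (div_self (hJ.pos T ⟨hT0, hT2⟩).ne').symm
        _ ≤ _ := by
            gcongr
            linarith

variable {E : Type*} [MeasurableSpace E] {μ : Measure E} {P : Kernel E E}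

instance isMarkovKernel_pow [IsMarkovKernel P] (n : ℕ) : IsMarkovKernel (P ^ n) := by
  induction n with
  | zero => exact inferInstanceAs (IsMarkovKernel Kernel.id)
  | succ n ih =>
    rw [pow_succ]
    exact inferInstanceAs (IsMarkovKernel ((P ^ n) ∘ₖ P))

theorem invariant_pow {P : Kernel E E} (h : P.Invariant μ) (n : ℕ) : (P ^ n).Invariant μ := by
  induction n with
  | zero => exact Measure.bind_dirac
  | succ n ih =>
    rw [pow_succ]
    exact ih.comp h

theorem markovOp_pow_zero {f : E → ℝ} (hf : Measurable f) : markovOp (P ^ 0) f = f := by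
  ext x
  exact integral_dirac' f x hf.stronglyMeasurable

theorem markovOp_pow_succ [IsMarkovKernel P] {f : E → ℝ} (hf : BddMeas f) (n : ℕ) :
    markovOp (P ^ (n + 1)) f = markovOp P (markovOp (P ^ n) f) := by
  ext x
  have h : P ^ (n + 1) = (P ^ n) ∘ₖ P := pow_succ P n
  rw [markovOp, h, Kernel.integral_comp (hf.integrable _)]
  rfl

theorem markovOp_pow_succ' [IsMarkovKernel P] {f : E → ℝ} (hf : BddMeas f) (n : ℕ) :
    markovOp (P ^ (n + 1)) f = markovOp (P ^ n) (markovOp P f) := by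
  ext x
  have h : P ^ (n + 1) = P ∘ₖ (P ^ n) := pow_succ' P n
  rw [markovOp, h, Kernel.integral_comp (hf.integrable _)]
  rfl

variable [IsProbabilityMeasure μ] [IsMarkovKernel P]

theorem integral_markovOp_pow (hP : P.IsReversible μ) {f : E → ℝ} (hf : BddMeas f) (n : ℕ) :
    ∫ x, markovOp (P ^ n) f x ∂μ = ∫ x, f x ∂μ := by
  induction n with
  | zero => rw [markovOp_pow_zero hf.measurable]
  | succ n ih => rw [markovOp_pow_succ hf, integral_markovOp hP hf.markovOp, ih]

theorem integral_mul_markovOp_pow_comm (hP : P.IsReversible μ) (n : ℕ) {f g : E → ℝ}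
    (hf : BddMeas f) (hg : BddMeas g) :
    ∫ x, f x * markovOp (P ^ n) g x ∂μ = ∫ x, markovOp (P ^ n) f x * g x ∂μ := by
  induction n generalizing f with
  | zero => rw [markovOp_pow_zero hf.measurable, markovOp_pow_zero hg.measurable]
  | succ n ih =>
    rw [markovOp_pow_succ hg, markovOp_pow_succ' hf, integral_mul_markovOp_comm hP hf hg.markovOp,
      ih hf.markovOp]

/-- `‖Pⁿ f - μ(f)‖₂²`. -/
noncomputable def powVar (μ : Measure E) (P : Kernel E E) (f : E → ℝ) (n : ℕ) : ℝ :=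
  ∫ x, (markovOp (P ^ n) f x - ∫ y, f y ∂μ) ^ 2 ∂μ

omit [IsProbabilityMeasure μ] [IsMarkovKernel P] in
theorem powVar_nonneg (f : E → ℝ) (n : ℕ) : 0 ≤ powVar μ P f n :=
  integral_nonneg fun _ => sq_nonneg _

theorem powVar_le (hP : P.IsReversible μ) {f : E → ℝ} (hf : Measurable f) {a b : ℝ}
    (hab : ∀ x, f x ∈ Icc a b) (n : ℕ) : powVar μ P f n ≤ (b - a) ^ 2 / 4 := by
  have := integral_sub_sq_le (μ := μ) (measurable_markovOp (P := P ^ n) hf)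
    (markovOp_mem_Icc hf hab)
  rwa [integral_markovOp_pow hP (.of_mem_Icc hf hab)] at this

theorem powVar_succ_le (hP : P.IsReversible μ)
    (hpos : ∀ f : E → ℝ, BddMeas f → 0 ≤ ∫ x, f x * markovOp P f x ∂μ)
    {f : E → ℝ} (hf : BddMeas f) (n : ℕ) :
    powVar μ P f (n + 1) ≤ powVar μ P f n - energy μ P (markovOp (P ^ n) f) := by
  set c := ∫ y, f y ∂μ with hc
  have hb : BddMeas (markovOp (P ^ n) f) := hf.markovOp
  have h := integral_sq_markovOp_le hP hpos (hb.sub (.const c))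
  have e1 : markovOp P (fun x => markovOp (P ^ n) f x - c)
      = fun x => markovOp (P ^ (n + 1)) f x - c := by
    rw [markovOp_pow_succ hf]
    ext x
    calc markovOp P (fun x => markovOp (P ^ n) f x - c) x
        = ∫ y, markovOp (P ^ n) f y ∂(P x) - ∫ _, c ∂(P x) :=
          integral_sub (hb.integrable (P x)) (integrable_const c)
      _ = _ := by simp [markovOp]
  have e2 : energy μ P (fun x => markovOp (P ^ n) f x - c) = energy μ P (markovOp (P ^ n) f) := by
    simp [energy]
  rw [e1, e2] at h
  exact h

/-- Quantitative decay of the variance along the chain. -/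
theorem le_lintegral_powVar (hP : P.IsReversible μ)
    (hpos : ∀ f : E → ℝ, BddMeas f → 0 ≤ ∫ x, f x * markovOp P f x ∂μ)
    {J : ℝ → ℝ} (hJ : IsConvexProfile J) {k : ℝ} (hk : 0 < k)
    (hflow : ∀ A, MeasurableSet A → μ A ≤ 1 / 2 →
      ENNReal.ofReal (2 * k * J (μ.real A / 2)) ≤ ∫⁻ x in A, P x Aᶜ ∂μ)
    {f : E → ℝ} (hf : Measurable f) {a b : ℝ} (hab : a < b) (hfab : ∀ x, f x ∈ Icc a b)
    (h0 : 0 < powVar μ P f 0) (n : ℕ) :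
    (n : ℝ≥0∞) ≤ ENNReal.ofReal (4 / k ^ 2) *
      ∫⁻ t in Ioc (powVar μ P f n / (b - a) ^ 2 / 8) (powVar μ P f 0 / (b - a) ^ 2 / 8),
        ENNReal.ofReal (t / J t ^ 2) := by
  have hb := BddMeas.of_mem_Icc hf hfab
  have ho : 0 < (b - a) ^ 2 := pow_pos (sub_pos.2 hab) 2
  rw [show 4 / k ^ 2 = 8 / (2 * k ^ 2) by field_simp; norm_num]
  refine le_lintegral_of_decay hJ (by positivity) (v := fun n => powVar μ P f n / (b - a) ^ 2)
    (fun n => div_nonneg (powVar_nonneg f n) ho.le) (div_pos h0 ho) ?_ (fun n => ?_) n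
  · rw [div_le_iff₀ ho]
    linarith [powVar_le hP hf hfab 0]
  · have h1 := powVar_succ_le hP hpos hb n
    -- `Pⁿ f` still takes values in `[a, b]`, so the same normalisation `(b - a)²` serves at every
    -- step.
    have h2 := wpiFun_mul_le_energy hP hJ hk hflow (measurable_markovOp (P := P ^ n) hf) hab
      (markovOp_mem_Icc hf hfab)
    rw [integral_markovOp_pow hP hb] at h2
    change (b - a) ^ 2 * wpiFun J (2 * k ^ 2) (powVar μ P f n / (b - a) ^ 2) ≤ _ at h2
    rw [div_le_iff₀ ho, sub_mul, div_mul_cancel₀ _ ho.ne']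
    linarith

theorem decayRatio_eq (hP : P.IsReversible μ) {f g : E → ℝ} (hfg : f =ᵐ[μ] g) (hg : Measurable g)
    {a b : ℝ} (hab : a < b) (hgab : ∀ x, g x ∈ Icc a b)
    (hosc : eOsc μ f = ENNReal.ofReal (b - a)) (n : ℕ) :
    decayRatio μ P f n = ENNReal.ofReal (powVar μ P g n / (b - a) ^ 2) := by
  have hgb := BddMeas.of_mem_Icc hg hgab
  have hae : (fun x => (∫ y, f y ∂((P ^ n) x)) - ∫ y, f y ∂μ)
      =ᵐ[μ] fun x => markovOp (P ^ n) g x - ∫ y, g y ∂μ := by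
    have : ∀ᵐ x ∂μ, ∀ᵐ y ∂((P ^ n) x), f y = g y := by
      apply Measure.ae_ae_of_ae_comp
      rwa [(invariant_pow hP.invariant n).def]
    filter_upwards [this] with x hx
    rw [integral_congr_ae hx, integral_congr_ae hfg]
    rfl
  have ho : 0 < b - a := sub_pos.2 hab
  rw [decayRatio, eLpNorm_congr_ae hae, eLpNorm_two_sq ((hgb.markovOp (P := P ^ n)).sub (.const _)),
    hosc, ← ENNReal.ofReal_pow ho.le, ← ENNReal.ofReal_div_of_pos (by positivity)]
  rfl

/-- With zero variance `f` is almost surely constant and its oscillation vanishes. The comparison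
with the integral must start from a positive value. -/
theorem powVar_zero_pos {f : E → ℝ} (hf : Measurable f)
    {a b : ℝ} (hab : a < b) (hfab : ∀ x, f x ∈ Icc a b)
    (hosc : eOsc μ f = ENNReal.ofReal (b - a)) : 0 < powVar μ P f 0 := by
  have hb := BddMeas.of_mem_Icc hf hfab
  refine (powVar_nonneg f 0).lt_of_ne' fun h => ?_
  rw [powVar, integral_eq_zero_iff_of_nonneg (fun _ => sq_nonneg _)
    (((hb.markovOp (P := P ^ 0)).sub (.const _)).sq.integrable μ),
    markovOp_pow_zero hf] at h
  set c := ∫ y, f y ∂μ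
  have hc : (fun x => (f x : EReal)) =ᵐ[μ] fun _ => (c : EReal) := by
    filter_upwards [h] with x hx
    have : f x - c = 0 := by simpa using hx
    rw [sub_eq_zero.1 this]
  rw [eOsc, essSup_congr_ae hc, essInf_congr_ae hc,
    essSup_const _ (NeZero.ne μ), essInf_const _ (NeZero.ne μ), ← EReal.coe_sub, sub_self] at hosc
  have := hosc.symm
  simp at this
  linarith

/-- For a reversible kernel, the density of `ν Pⁿ` is `Pⁿ (dν/dμ)`. -/
theorem bind_pow_withDensity (hP : P.IsReversible μ) {g : E → ℝ} (hg : BddMeas g)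
    (hg0 : ∀ x, 0 ≤ g x) (n : ℕ) :
    (μ.withDensity fun x => ENNReal.ofReal (g x)).bind (P ^ n)
      = μ.withDensity fun x => ENNReal.ofReal (markovOp (P ^ n) g x) := by
  ext A hA
  have hind : BddMeas (A.indicator (1 : E → ℝ)) :=
    .of_mem_Icc (a := 0) (b := 1) (measurable_one.indicator hA) fun x => by
      by_cases h : x ∈ A <;> simp [h]
  have hpg0 : ∀ x, 0 ≤ markovOp (P ^ n) g x := fun x => integral_nonneg hg0
  have h1 : ∀ x, (P ^ n) x A = ENNReal.ofReal (markovOp (P ^ n) (A.indicator 1) x) := fun x => by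
    rw [markovOp, integral_indicator_one hA, ofReal_measureReal]
  have hi0 : ∀ x, 0 ≤ A.indicator (1 : E → ℝ) x := fun x => indicator_nonneg (by simp) x
  have hpi0 : ∀ x, 0 ≤ markovOp (P ^ n) (A.indicator 1) x := fun x => integral_nonneg hi0
  rw [Measure.bind_apply hA (Kernel.aemeasurable _),
    lintegral_withDensity_eq_lintegral_mul _ hg.measurable.ennreal_ofReal
      (Kernel.measurable_coe _ hA), withDensity_apply _ hA, ← lintegral_indicator hA]
  have h2 : ∀ x, ((fun x => ENNReal.ofReal (g x)) * fun a => ((P ^ n) a) A) x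
      = ENNReal.ofReal (g x * markovOp (P ^ n) (A.indicator 1) x) := fun x => by
    rw [Pi.mul_apply, h1, ENNReal.ofReal_mul (hg0 x)]
  have h3 : ∀ x, A.indicator (fun x => ENNReal.ofReal (markovOp (P ^ n) g x)) x
      = ENNReal.ofReal (markovOp (P ^ n) g x * A.indicator 1 x) := fun x => by
    by_cases h : x ∈ A <;> simp [h]
  simp_rw [h2, h3]
  rw [← ofReal_integral_eq_lintegral_ofReal ((hg.mul hind.markovOp).integrable μ)
      (ae_of_all _ fun x => mul_nonneg (hg0 x) (hpi0 x)),
    ← ofReal_integral_eq_lintegral_ofReal ((hg.markovOp.mul hind).integrable μ)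
      (ae_of_all _ fun x => mul_nonneg (hpg0 x) (hi0 x)),
    integral_mul_markovOp_pow_comm hP n hg hind]

/-- The density evolves by `Pⁿ` itself, so the divergence is the variance of `Pⁿ` applied to the
initial density. -/
theorem chiSq_bind_pow (hP : P.IsReversible μ) {ν : Measure E} [SigmaFinite ν] (hν : ν ≪ μ)
    {g : E → ℝ} (hg : BddMeas g)
    (hg0 : ∀ x, 0 ≤ g x) (hνg : (fun x => (ν.rnDeriv μ x).toReal) =ᵐ[μ] g) (n : ℕ) :
    chiSq (ν.bind (P ^ n)) μ = ENNReal.ofReal (powVar μ P g n) := by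
  have hν' : ν = μ.withDensity fun x => ENNReal.ofReal (g x) := by
    rw [← Measure.withDensity_rnDeriv_eq ν μ hν]
    refine withDensity_congr_ae ?_
    filter_upwards [hνg, Measure.rnDeriv_lt_top ν μ] with x hx hx'
    rw [← hx, ENNReal.ofReal_toReal hx'.ne]
  rw [hν', bind_pow_withDensity hP hg hg0, chiSq, if_pos (withDensity_absolutelyContinuous _ _)]
  have hb : BddMeas (markovOp (P ^ n) g) := hg.markovOp
  have hae : (fun x => ((μ.withDensity fun x => ENNReal.ofReal (markovOp (P ^ n) g x)).rnDeriv
      μ x).toReal) =ᵐ[μ] markovOp (P ^ n) g := by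
    filter_upwards [Measure.rnDeriv_withDensity μ hb.measurable.ennreal_ofReal] with x hx
    rw [hx]
    exact ENNReal.toReal_ofReal (integral_nonneg hg0)
  rw [evariance_congr hae, evariance_eq_lintegral_ofReal, integral_markovOp_pow hP hg, powVar,
    ofReal_integral_eq_lintegral_ofReal ((hb.sub (.const _)).sq.integrable μ)
      (ae_of_all _ fun _ => sq_nonneg _)]

end Decay

/-! ### Decay for bounded functions and mixing from bounded densities -/

section Mixing

variable {E : Type*} [MeasurableSpace E] {μ : Measure E} {P : Kernel E E}
  [IsProbabilityMeasure μ] [IsMarkovKernel P]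

theorem decayRatio_le_and_le_lintegral (hP : P.IsReversible μ)
    (hpos : ∀ f : E → ℝ, BddMeas f → 0 ≤ ∫ x, f x * markovOp P f x ∂μ)
    {J : ℝ → ℝ} (hJ : IsConvexProfile J) {k : ℝ} (hk : 0 < k)
    (hflow : ∀ A, MeasurableSet A → μ A ≤ 1 / 2 →
      ENNReal.ofReal (2 * k * J (μ.real A / 2)) ≤ ∫⁻ x in A, P x Aᶜ ∂μ)
    {f : E → ℝ} (hf : Measurable f) (hosc0 : eOsc μ f ≠ 0) (hosc : eOsc μ f ≠ ∞) (n : ℕ) :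
    decayRatio μ P f n ≤ 1 / 4 ∧
      (n : ℝ≥0∞) ≤ ENNReal.ofReal (4 / k ^ 2) *
        ∫⁻ v in Ioc ((decayRatio μ P f n).toReal / 8) ((decayRatio μ P f 0).toReal / 8),
          ENNReal.ofReal (v / J v ^ 2) := by
  obtain ⟨a, b, g, hg, hfg, hgab, ho, -⟩ := exists_bounded_version hf.aemeasurable hosc
  have hab : a < b := by
    by_contra! h
    exact hosc0 (by rw [ho, ENNReal.ofReal_of_nonpos (by linarith)])
  have hosc' : eOsc μ g = ENNReal.ofReal (b - a) := by
    rw [← ho, eOsc, eOsc, essSup_congr_ae (hfg.mono fun x hx => congrArg _ hx),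
      essInf_congr_ae (hfg.mono fun x hx => congrArg _ hx)]
  have ho2 : 0 < (b - a) ^ 2 := pow_pos (sub_pos.2 hab) 2
  have hnn : ∀ m, 0 ≤ powVar μ P g m / (b - a) ^ 2 := fun m =>
    div_nonneg (powVar_nonneg g m) ho2.le
  rw [decayRatio_eq hP hfg hg hab hgab ho, decayRatio_eq hP hfg hg hab hgab ho,
    ENNReal.toReal_ofReal (hnn n), ENNReal.toReal_ofReal (hnn 0)]
  refine ⟨?_, le_lintegral_powVar hP hpos hJ hk hflow hg hab hgab
    (powVar_zero_pos hg hab hgab hosc') n⟩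
  have h : powVar μ P g n / (b - a) ^ 2 ≤ 1 / 4 := by
    rw [div_le_iff₀ ho2]
    linarith [powVar_le hP hg hgab n]
  refine (ENNReal.ofReal_le_ofReal h).trans (le_of_eq ?_)
  rw [ENNReal.ofReal_div_of_pos (by norm_num)]
  simp

/-- If the variance at time `n` exceeded `ε`, the decay integral would run inside `(ε/(8u), 1/32]`,
so `n` would be at most the integral term. The summand `1` in the hypothesis contradicts this. -/
theorem chiSq_bind_pow_le (hP : P.IsReversible μ)
    (hpos : ∀ f : E → ℝ, BddMeas f → 0 ≤ ∫ x, f x * markovOp P f x ∂μ)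
    {J : ℝ → ℝ} (hJ : IsConvexProfile J) {k : ℝ} (hk : 0 < k)
    (hflow : ∀ A, MeasurableSet A → μ A ≤ 1 / 2 →
      ENNReal.ofReal (2 * k * J (μ.real A / 2)) ≤ ∫⁻ x in A, P x Aᶜ ∂μ)
    {ν : Measure E} [SigmaFinite ν] (hν : ν ≪ μ)
    (hosc : eOsc μ (fun x => (ν.rnDeriv μ x).toReal) ≠ ∞)
    {u : ℝ} (hu : u = (eOsc μ (fun x => (ν.rnDeriv μ x).toReal)).toReal ^ 2)
    {ε : ℝ} (hε : 0 < ε) {n : ℕ}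
    (hn : 1 + 4 / k ^ 2 * (∫ v in (ε / (8 * u))..(1 / 32), v / J v ^ 2) ≤ (n : ℝ)) :
    chiSq (ν.bind (P ^ n)) μ ≤ ENNReal.ofReal ε := by
  obtain ⟨a, b, g, hg, hfg, hgab, ho, ha⟩ := exists_bounded_version
    (Measure.measurable_rnDeriv ν μ).ennreal_toReal.aemeasurable hosc
  have ha0 : 0 ≤ a := ha 0 (ae_of_all _ fun _ => ENNReal.toReal_nonneg)
  have hgb := BddMeas.of_mem_Icc hg hgab
  rw [chiSq_bind_pow hP hν hgb (fun x => ha0.trans (hgab x).1) hfg n]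
  refine ENNReal.ofReal_le_ofReal ?_
  have hle := powVar_le (P := P) hP hg hgab n
  obtain ⟨x₀⟩ := Measure.nonempty_of_neZero μ
  have hab' : a ≤ b := (hgab x₀).1.trans (hgab x₀).2
  rcases hab'.eq_or_lt with h | hab
  · rw [h, sub_self] at hle
    linarith
  have hosc' : eOsc μ g = ENNReal.ofReal (b - a) := by
    rw [← ho, eOsc, eOsc, essSup_congr_ae (hfg.mono fun x hx => congrArg _ hx),
      essInf_congr_ae (hfg.mono fun x hx => congrArg _ hx)]
  have hu' : u = (b - a) ^ 2 := by
    rw [hu, ho, ENNReal.toReal_ofReal (sub_nonneg.2 hab')]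
  have hu0 : 0 < u := hu' ▸ pow_pos (sub_pos.2 hab) 2
  by_contra! hlt
  rw [← hu'] at hle
  have hmain := le_lintegral_powVar hP hpos hJ hk hflow hg hab hgab
    (powVar_zero_pos hg hab hgab hosc') n
  have h0 := powVar_le (P := P) hP hg hgab 0
  rw [← hu'] at hmain h0
  set l := ε / (8 * u) with hl
  have hl0 : 0 < l := by positivity
  -- Because `ε` is below a variance that is at most `u / 4`, the limits are in order and the
  -- oriented integral is an ordinary one.
  have hl1 : l ≤ 1 / 32 := by
    rw [hl, div_le_iff₀ (by positivity)]
    linarith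
  have hsub : Ioc (powVar μ P g n / u / 8) (powVar μ P g 0 / u / 8) ⊆ Ioc l (1 / 32) := by
    refine Ioc_subset_Ioc ?_ ?_
    · rw [hl, div_div, mul_comm u]
      gcongr
    · rw [div_div, div_le_iff₀ (by positivity)]
      linarith
  have hcont : ContinuousOn (fun v => v / J v ^ 2) (Icc l (1 / 32)) := by
    have hs : Icc l (1 / 32) ⊆ Icc 0 (1 / 2) := Icc_subset_Icc hl0.le (by norm_num)
    refine continuousOn_id.div ((hJ.continuousOn.mono hs).pow 2) fun v hv => ?_
    exact (pow_pos (hJ.pos v ⟨hl0.trans_le hv.1, (hs hv).2⟩) 2).ne'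
  have hint : IntegrableOn (fun v => v / J v ^ 2) (Ioc l (1 / 32)) :=
    hcont.integrableOn_Icc.mono_set Ioc_subset_Icc_self
  have hnn : ∀ v ∈ Ioc l (1 / 32), 0 ≤ v / J v ^ 2 := fun v hv =>
    div_nonneg (hl0.trans hv.1).le (sq_nonneg _)
  have hfin := hmain.trans (mul_le_mul_right (lintegral_mono_set hsub) _)
  rw [← ofReal_integral_eq_lintegral_ofReal hint
      ((ae_restrict_mem measurableSet_Ioc).mono hnn),
    ← intervalIntegral.integral_of_le hl1, ← ENNReal.ofReal_mul (by positivity),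
    ← ENNReal.ofReal_natCast, ENNReal.ofReal_le_ofReal_iff] at hfin
  · linarith
  · exact mul_nonneg (by positivity) (intervalIntegral.integral_nonneg hl1 fun v hv =>
      div_nonneg (hl0.le.trans hv.1) (sq_nonneg _))

end Mixing

/-! ### From Minkowski content to the three-set inequality -/

section IsoperimetricGrowth

/-- A monotone function with lower right Dini derivative at least `c` on `[a, b)` grows at least
linearly with slope `c`. -/
theorem mul_le_sub_of_dini {f : ℝ → ℝ} {a b c : ℝ} (hab : a ≤ b) (hc : 0 < c)
    (hf : MonotoneOn f (Icc a b))
    (hD : ∀ s ∈ Ico a b, ∀ c' ∈ Ioo 0 c, ∀ᶠ r in 𝓝[>] (0 : ℝ), c' * r ≤ f (s + r) - f s) :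
    c * (b - a) ≤ f b - f a := by
  have key : ∀ c' ∈ Ioo 0 c, c' * (b - a) ≤ f b - f a := by
    intro c' hc'
    set S : Set ℝ := {s | s ∈ Icc a b ∧ c' * (s - a) ≤ f s - f a} with hS
    have haS : a ∈ S := ⟨⟨le_rfl, hab⟩, by simp⟩
    have hbdd : BddAbove S := ⟨b, fun s hs => hs.1.2⟩
    set m := sSup S with hm
    have ham : a ≤ m := le_csSup hbdd haS
    have hmb : m ≤ b := csSup_le ⟨a, haS⟩ fun s hs => hs.1.2
    -- Monotonicity replaces left continuity here: it lets the supremum inherit the inequality from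
    -- the points below it.
    have hmS : c' * (m - a) ≤ f m - f a := by
      have : m ≤ (f m - f a) / c' + a := by
        refine csSup_le ⟨a, haS⟩ fun s hs => ?_
        have h1 := hf hs.1 ⟨ham, hmb⟩ (le_csSup hbdd hs)
        have h2 : s - a ≤ (f m - f a) / c' := by
          rw [le_div_iff₀ hc'.1]
          linarith [hs.2]
        linarith
      have h2 : m - a ≤ (f m - f a) / c' := by linarith
      rw [le_div_iff₀ hc'.1] at h2
      linarith
    rcases hmb.eq_or_lt with h | h
    · rwa [h] at hmS
    · exfalso
      obtain ⟨r, h1, hr0, hr⟩ := ((hD m ⟨ham, h⟩ c' hc').and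
        (Ioo_mem_nhdsGT (sub_pos.2 h))).exists
      have : m + r ∈ S := ⟨⟨by linarith, by linarith⟩, by linarith⟩
      linarith [le_csSup hbdd this]
  by_contra! hlt
  rcases hab.eq_or_lt with h | h
  · rw [h] at hlt
    simp at hlt
  · have hba : 0 < b - a := sub_pos.2 h
    obtain ⟨c', h1, h2⟩ := exists_between (max_lt hc ((div_lt_iff₀ hba).2 hlt))
    have := key c' ⟨(le_max_left _ _).trans_lt h1, h2⟩
    have h3 := (div_lt_iff₀ hba).1 ((le_max_right _ _).trans_lt h1)
    linarith

variable {E : Type*} [NormedAddCommGroup E] [NormedSpace ℝ E] [MeasurableSpace E] [BorelSpace E]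
  {π : Measure E} [IsProbabilityMeasure π] {I : ℝ → ℝ}

omit [NormedSpace ℝ E] [BorelSpace E] in
/-- A regular isoperimetric minorant bounds from below the growth of enlargements. -/
theorem IsRegularConvexIsoMinorant.eventually_le (hI : IsRegularConvexIsoMinorant π I)
    {B : Set E} (hB : MeasurableSet B) {p : ℝ} (hp : π.real B = p) (hp01 : p ∈ Ioo (0 : ℝ) 1)
    {c : ℝ} (hc : c ∈ Ioo 0 (I p)) :
    ∀ᶠ r in 𝓝[>] (0 : ℝ), c * r ≤ π.real (Metric.cthickening r B) - π.real B := by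
  have h1 : ENNReal.ofReal (I p) ≤ minkowskiContent π B := by
    refine (hI.le_isoProfile p hp01).trans (iInf₂_le B ⟨hB, ?_⟩)
    rw [← hp, ofReal_measureReal]
  have h2 : ENNReal.ofReal c < minkowskiContent π B :=
    ((ENNReal.ofReal_lt_ofReal_iff (hI.pos p hp01)).2 hc.2).trans_le h1
  filter_upwards [eventually_lt_of_lt_liminf h2, self_mem_nhdsWithin] with r hr hr0
  have hr0' : ENNReal.ofReal r ≠ 0 := (ENNReal.ofReal_pos.2 hr0).ne'
  rw [ENNReal.lt_div_iff_mul_lt (Or.inl hr0') (Or.inl ENNReal.ofReal_ne_top),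
    ← ENNReal.ofReal_mul hc.1.le, ← ofReal_measureReal, ← ofReal_measureReal,
    ← ENNReal.ofReal_sub _ measureReal_nonneg] at hr
  exact ((ENNReal.ofReal_lt_ofReal_iff_of_nonneg (mul_nonneg hc.1.le (le_of_lt hr0))).1 hr).le

omit [NormedSpace ℝ E] [BorelSpace E] [IsProbabilityMeasure π] in
theorem IsRegularConvexIsoMinorant.le_of_mem_Icc (hI : IsRegularConvexIsoMinorant π I)
    {p q : ℝ} (hq : 0 < q) (hp : p ∈ Icc q (1 - q)) : I q ≤ I p := by
  have hq2 : q ≤ 1 / 2 := by linarith [hp.1, hp.2]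
  rcases le_total p (1 / 2) with h | h
  · exact hI.monotoneOn ⟨hq, hq2⟩ ⟨hq.trans_le hp.1, h⟩ hp.1
  · rw [← hI.symm p ⟨by linarith, by linarith [hp.2]⟩]
    exact hI.monotoneOn ⟨hq, hq2⟩ ⟨by linarith [hp.2], by linarith⟩ (by linarith [hp.2])

/-- The three-set isoperimetric inequality. -/
theorem IsRegularConvexIsoMinorant.three_set (hI : IsRegularConvexIsoMinorant π I)
    {A₁ A₂ : Set E} (h₂ : MeasurableSet A₂) {δ : ℝ} (hδ : 0 < δ)
    (hdist : ∀ x ∈ A₁, ∀ y ∈ A₂, δ ≤ dist x y) {q : ℝ} (hq : 0 < q)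
    (hq₁ : q ≤ π.real A₁) (hq₂ : q ≤ π.real A₂) :
    I q * δ ≤ π.real (A₁ ∪ A₂)ᶜ := by
  -- Enlargements of `A₁` by less than `δ` miss `A₂`, so their masses stay in `[q, 1 - q]`, where
  -- `I` is at least `I q`.
  have hdisj : ∀ s < δ, Disjoint (Metric.cthickening s A₁) A₂ := by
    intro s hs
    rw [Set.disjoint_left]
    intro y hy hy2
    have h1 : Metric.infEDist y A₁ < ENNReal.ofReal δ :=
      (Metric.mem_cthickening_iff.1 hy).trans_lt ((ENNReal.ofReal_lt_ofReal_iff hδ).2 hs)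
    obtain ⟨x, hx, hxy⟩ := Metric.infEDist_lt_iff.1 h1
    rw [edist_dist, ENNReal.ofReal_lt_ofReal_iff hδ, dist_comm] at hxy
    exact (hdist x hx y hy2).not_gt hxy
  set f : ℝ → ℝ := fun s => π.real (Metric.cthickening s A₁) with hf
  have hmeas : ∀ s, MeasurableSet (Metric.cthickening s A₁) := fun s =>
    Metric.isClosed_cthickening.measurableSet
  have hmem : ∀ s < δ, f s ∈ Icc q (1 - q) := by
    intro s hs
    refine ⟨hq₁.trans (measureReal_mono (Metric.self_subset_cthickening A₁)), ?_⟩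
    have h1 := measureReal_union (μ := π) (hdisj s hs) h₂
    have h2 : π.real (Metric.cthickening s A₁ ∪ A₂) ≤ 1 := measureReal_le_one
    simp only [hf]
    linarith
  have hq2 : q ≤ 1 - q := (hmem 0 hδ).1.trans (hmem 0 hδ).2
  have hqI : 0 < I q := hI.pos q ⟨hq, by linarith⟩
  have hgrow : ∀ t ∈ Ico 0 δ, I q * t ≤ π.real (A₁ ∪ A₂)ᶜ := by
    intro t ht
    -- In a normed space enlarging by `s` and then by `r` is enlarging by `s + r`, so the Minkowski
    -- content of the enlargement bounds the Dini derivative of `f`.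
    have hd := mul_le_sub_of_dini (f := f) ht.1 hqI
      (fun x _ y _ hxy => measureReal_mono (Metric.cthickening_mono hxy A₁)) (by
        intro s hs c hc
        have hs' := hmem s (hs.2.trans ht.2)
        have := hI.eventually_le (hmeas s) rfl (p := f s)
          ⟨hq.trans_le hs'.1, by linarith [hs'.2]⟩
          ⟨hc.1, hc.2.trans_le (hI.le_of_mem_Icc hq hs')⟩
        filter_upwards [this, self_mem_nhdsWithin] with r hr hr0
        rwa [cthickening_cthickening (le_of_lt hr0) hs.1, add_comm] at hr)
    have h3 : Metric.cthickening t A₁ ⊆ A₁ ∪ (A₁ ∪ A₂)ᶜ := by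
      intro x hx
      by_cases hx1 : x ∈ A₁
      · exact Or.inl hx1
      · refine Or.inr fun h => h.elim hx1 fun hx2 => ?_
        exact Set.disjoint_left.1 (hdisj t ht.2) hx hx2
    have h4 : f t ≤ π.real A₁ + π.real (A₁ ∪ A₂)ᶜ :=
      (measureReal_mono h3).trans (measureReal_union_le _ _)
    -- The enlargement of radius `0` is the closure, possibly of larger mass than `A₁`; only this
    -- inequality is needed.
    have h5 : π.real A₁ ≤ f 0 := measureReal_mono (Metric.self_subset_cthickening A₁)
    linarith
  by_contra! hlt
  obtain ⟨t, h1, h2⟩ := exists_between ((div_lt_iff₀' hqI).2 hlt)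
  have ht0 : 0 ≤ t := (div_nonneg measureReal_nonneg hqI.le).trans h1.le
  have := hgrow t ⟨ht0, h2⟩
  have h3 := (div_lt_iff₀' hqI).1 h1
  linarith

end IsoperimetricGrowth

/-! ### The isoperimetric minorant vanishes at zero -/

section Profile

variable {d : ℕ} {π : Measure (EuclideanSpace ℝ (Fin d))} [IsProbabilityMeasure π] {I : ℝ → ℝ}

theorem cthickening_halfSpace_subset (i : Fin d) (t : ℝ) {r : ℝ} (hr : 0 ≤ r) :
    Metric.cthickening r {x : EuclideanSpace ℝ (Fin d) | x i ≤ t} ⊆ {x | x i ≤ t + r} := by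
  intro x hx
  refine le_of_forall_pos_le_add (α := ℝ) fun e he => ?_
  have h1 : Metric.infEDist x {x : EuclideanSpace ℝ (Fin d) | x i ≤ t} < ENNReal.ofReal (r + e) :=
    (Metric.mem_cthickening_iff.1 hx).trans_lt
      ((ENNReal.ofReal_lt_ofReal_iff (by linarith)).2 (by linarith))
  obtain ⟨y, hy, hxy⟩ := Metric.infEDist_lt_iff.1 h1
  rw [edist_dist, ENNReal.ofReal_lt_ofReal_iff (by linarith), dist_eq_norm] at hxy
  have h2 := (PiLp.norm_apply_le (x - y) i).trans hxy.le
  rw [Real.norm_eq_abs] at h2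
  have h3 := (le_abs_self _).trans h2
  have hy' : y i ≤ t := hy
  simp only [PiLp.sub_apply] at h3
  linarith

/-- A convex isoperimetric minorant of a measure of full support vanishes at zero. -/
theorem IsRegularConvexIsoMinorant.exists_lt (hd : 0 < d) (hI : IsRegularConvexIsoMinorant π I)
    (hvol : (volume : Measure (EuclideanSpace ℝ (Fin d))) ≪ π) {e : ℝ} (he : 0 < e) :
    ∃ p ∈ Ioc (0 : ℝ) (1 / 2), I p < e := by
  -- If `I ≥ e` on `(0, 1/2]`, the distribution function `F` of one coordinate grows at speed at
  -- least `e` wherever `0 < F ≤ 1/2`. Full support makes `F` positive everywhere, so over a length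
  -- `1/e` to the left of `t₀` it gains `1`, although `F t₀ ≤ 1/2`.
  by_contra! hcon
  set i : Fin d := ⟨0, hd⟩
  have hmi : Measurable fun x : EuclideanSpace ℝ (Fin d) => x i := by fun_prop
  have hmeas : ∀ t : ℝ, MeasurableSet {x : EuclideanSpace ℝ (Fin d) | x i ≤ t} := fun t =>
    measurableSet_le hmi measurable_const
  set F : ℝ → ℝ := fun t => π.real {x : EuclideanSpace ℝ (Fin d) | x i ≤ t} with hF
  have hFmono : Monotone F := fun s t hst => measureReal_mono fun x (hx : _ ≤ _) => hx.trans hst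
  have hFpos : ∀ t, 0 < F t := by
    intro t
    refine measureReal_nonneg.lt_of_ne' fun h => ?_
    rw [measureReal_eq_zero_iff] at h
    have h1 : volume {x : EuclideanSpace ℝ (Fin d) | x i < t} = 0 :=
      measure_mono_null (ofPred_subset_ofPred.2 fun _ hx => hx.le) (hvol h)
    have hopen : IsOpen {x : EuclideanSpace ℝ (Fin d) | x i < t} :=
      isOpen_lt (by fun_prop) continuous_const
    refine (hopen.measure_pos volume ⟨EuclideanSpace.single i (t - 1), ?_⟩).ne' h1
    simp
  obtain ⟨t₀, ht₀⟩ : ∃ t₀, F t₀ ≤ 1 / 2 := by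
    have : IsProbabilityMeasure (π.map fun x => x i) :=
      Measure.isProbabilityMeasure_map hmi.aemeasurable
    have h1 := tendsto_cdf_atBot (π.map fun x => x i)
    obtain ⟨t₀, h2⟩ := (h1.eventually (gt_mem_nhds (by norm_num : (0 : ℝ) < 1 / 2))).exists
    refine ⟨t₀, ?_⟩
    rw [cdf_eq_real, map_measureReal_apply hmi measurableSet_Iic] at h2
    exact h2.le
  have hgrow := mul_le_sub_of_dini (f := F) (a := t₀ - 1 / e) (b := t₀)
    (sub_le_self _ (by positivity)) he (hFmono.monotoneOn _) (by
      intro s hs c hc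
      have hFs : F s ∈ Ioc (0 : ℝ) (1 / 2) := ⟨hFpos s, (hFmono hs.2.le).trans ht₀⟩
      have := hI.eventually_le (hmeas s) rfl (p := F s) ⟨hFs.1, by linarith [hFs.2]⟩
        ⟨hc.1, hc.2.trans_le (hcon _ hFs)⟩
      filter_upwards [this, self_mem_nhdsWithin] with r hr hr0
      exact hr.trans (sub_le_sub_right
        (measureReal_mono (cthickening_halfSpace_subset i s (le_of_lt hr0))) _))
  rw [sub_sub_cancel, mul_one_div_cancel he.ne'] at hgrow
  linarith [hFpos (t₀ - 1 / e)]

/-- The extension by zero of a function on the positive half-line. -/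
noncomputable def zeroExt (I : ℝ → ℝ) (t : ℝ) : ℝ := if t ≤ 0 then 0 else I t

theorem zeroExt_of_pos {I : ℝ → ℝ} {t : ℝ} (ht : 0 < t) : zeroExt I t = I t := if_neg ht.not_ge

theorem isConvexProfile_zeroExt (hd : 0 < d) (hI : IsRegularConvexIsoMinorant π I)
    (hvol : (volume : Measure (EuclideanSpace ℝ (Fin d))) ≪ π) :
    IsConvexProfile (zeroExt I) := by
  have hz : zeroExt I 0 = 0 := if_pos le_rfl
  have hpos : ∀ t ∈ Ioc (0 : ℝ) (1 / 2), 0 < zeroExt I t := fun t ht => by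
    rw [zeroExt_of_pos ht.1]
    exact hI.pos t ⟨ht.1, by linarith [ht.2]⟩
  have hmono : MonotoneOn (zeroExt I) (Icc 0 (1 / 2)) := by
    intro x hx y hy hxy
    rcases hx.1.eq_or_lt with h | h
    · rw [← h, hz]
      rcases hy.1.eq_or_lt with h' | h'
      · rw [← h', hz]
      · exact (hpos y ⟨h', hy.2⟩).le
    · rw [zeroExt_of_pos h, zeroExt_of_pos (h.trans_le hxy)]
      exact hI.monotoneOn ⟨h, hx.2⟩ ⟨h.trans_le hxy, hy.2⟩ hxy
  -- Convexity up to the origin: the origin is replaced by a point `p` with `I p < e`, and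
  -- monotonicity absorbs the shift from `b y` to `(1 - b) p + b y`.
  have hscale : ∀ y ∈ Ioc (0 : ℝ) (1 / 2), ∀ b ∈ Icc (0 : ℝ) 1,
      zeroExt I (b * y) ≤ b * zeroExt I y := by
    intro y hy b hb
    rcases hb.1.eq_or_lt with h | h
    · rw [← h, zero_mul, zero_mul, hz]
    have hby : 0 < b * y := mul_pos h hy.1
    rw [zeroExt_of_pos hby, zeroExt_of_pos hy.1]
    refine le_of_forall_pos_le_add fun e he => ?_
    obtain ⟨p, hp, hpe⟩ := hI.exists_lt hd hvol he
    have h1 := hI.convexOn.2 hp hy (sub_nonneg.2 hb.2) hb.1 (by ring)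
    have hmem := hI.convexOn.1 hp hy (sub_nonneg.2 hb.2) hb.1 (by ring)
    simp only [smul_eq_mul] at h1 hmem
    have h2 : b * y ≤ (1 - b) * p + b * y :=
      le_add_of_nonneg_left (mul_nonneg (sub_nonneg.2 hb.2) hp.1.le)
    have h3 := hI.monotoneOn ⟨hby, h2.trans hmem.2⟩ hmem h2
    have h4 : (1 - b) * I p ≤ e := by
      have := hI.pos p ⟨hp.1, by linarith [hp.2]⟩
      nlinarith [hb.1, hb.2]
    linarith
  refine ⟨⟨convex_Icc _ _, fun x hx y hy a b ha hb hab => ?_⟩, fun t ht => ?_, hmono, hz, hpos⟩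
  · simp only [smul_eq_mul]
    rcases hx.1.eq_or_lt with h | h
    · rw [← h, hz, mul_zero, zero_add, zero_add]
      rcases hy.1.eq_or_lt with h' | h'
      · rw [← h', mul_zero, hz, mul_zero]
      · exact hscale y ⟨h', hy.2⟩ b ⟨hb, by linarith⟩
    · rcases hy.1.eq_or_lt with h' | h'
      · rw [← h', hz, mul_zero, add_zero, add_zero]
        exact hscale x ⟨h, hx.2⟩ a ⟨ha, by linarith⟩
      · have hmem := hI.convexOn.1 ⟨h, hx.2⟩ ⟨h', hy.2⟩ ha hb hab
        simp only [smul_eq_mul] at hmem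
        rw [zeroExt_of_pos h, zeroExt_of_pos h', zeroExt_of_pos hmem.1]
        exact hI.convexOn.2 ⟨h, hx.2⟩ ⟨h', hy.2⟩ ha hb hab
  · rcases ht.1.eq_or_lt with h | h
    · rw [← h, ContinuousWithinAt, hz]
      refine Metric.tendsto_nhdsWithin_nhds.2 fun e he => ?_
      obtain ⟨p, hp, hpe⟩ := hI.exists_lt hd hvol he
      refine ⟨p, hp.1, fun {x} hx hxp => ?_⟩
      rw [Real.dist_eq, sub_zero, abs_of_nonneg hx.1] at hxp
      have h1 := hmono hx ⟨hp.1.le, hp.2⟩ hxp.le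
      have h0 := hmono ⟨le_rfl, by norm_num⟩ hx hx.1
      rw [hz] at h0
      rw [zeroExt_of_pos hp.1] at h1
      rw [Real.dist_eq, sub_zero, abs_of_nonneg h0]
      linarith
    · have h1 : ContinuousAt I t := hI.continuousOn.continuousAt
        (Ioo_mem_nhds h (by linarith [ht.2]))
      refine (h1.congr ?_).continuousWithinAt
      filter_upwards [Ioi_mem_nhds h] with x hx
      exact (zeroExt_of_pos hx).symm

end Profile

/-! ### Standard Gaussian vectors: linear images and total variation -/

section Gaussian

variable {E : Type*} [NormedAddCommGroup E] [InnerProductSpace ℝ E] [FiniteDimensional ℝ E]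
  [MeasurableSpace E] [BorelSpace E]
  {F : Type*} [NormedAddCommGroup F] [InnerProductSpace ℝ F] [FiniteDimensional ℝ F]
  [MeasurableSpace F] [BorelSpace F]
  {G : Type*} [NormedAddCommGroup G] [InnerProductSpace ℝ G] [FiniteDimensional ℝ G]
  [MeasurableSpace G] [BorelSpace G]

/-- A sum of linear images of independent standard Gaussian vectors with identity covariance is a
standard Gaussian vector. -/
theorem map_add_stdGaussian {A : F → E} {B : G → E} (hA : Measurable A) (hB : Measurable B)
    (A' : E → F) (B' : E → G) (hAA' : ∀ z t, inner ℝ (A z) t = inner ℝ z (A' t))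
    (hBB' : ∀ z t, inner ℝ (B z) t = inner ℝ z (B' t))
    (hcov : ∀ t, ‖A' t‖ ^ 2 + ‖B' t‖ ^ 2 = ‖t‖ ^ 2) :
    ((stdGaussian F).prod (stdGaussian G)).map (fun p => A p.1 + B p.2) = stdGaussian E := by
  have hm : Measurable fun p : F × G => A p.1 + B p.2 :=
    (hA.comp measurable_fst).add (hB.comp measurable_snd)
  have : IsProbabilityMeasure (((stdGaussian F).prod (stdGaussian G)).map
    (fun p => A p.1 + B p.2)) := Measure.isProbabilityMeasure_map hm.aemeasurable
  refine Measure.ext_of_charFun (E := E) ?_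
  ext t
  rw [charFun_apply, integral_map hm.aemeasurable (by fun_prop), charFun_stdGaussian]
  have e : ∀ p : F × G, Complex.exp (inner ℝ (A p.1 + B p.2) t * Complex.I)
      = Complex.exp (inner ℝ p.1 (A' t) * Complex.I)
        * Complex.exp (inner ℝ p.2 (B' t) * Complex.I) := fun p => by
    rw [inner_add_left, hAA', hBB', Complex.ofReal_add, add_mul, Complex.exp_add]
  simp_rw [e]
  rw [integral_prod_mul (fun z : F => Complex.exp (inner ℝ z (A' t) * Complex.I))
    (fun z : G => Complex.exp (inner ℝ z (B' t) * Complex.I)), ← charFun_apply, ← charFun_apply,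
    charFun_stdGaussian, charFun_stdGaussian, ← Complex.exp_add]
  congr 1
  have h := congrArg Complex.ofReal (hcov t)
  push_cast at h
  linear_combination (-1 / 2) * h

theorem stdGaussian_real : stdGaussian ℝ = gaussianReal 0 1 := by
  refine Measure.ext_of_charFun ?_
  ext t
  rw [charFun_stdGaussian, charFun_gaussianReal]
  simp [neg_div]
  norm_cast
  simp

variable (E) in
theorem map_neg_stdGaussian : (stdGaussian E).map (fun z => -z) = stdGaussian E :=
  stdGaussian_map (LinearIsometryEquiv.neg ℝ : E ≃ₗᵢ[ℝ] E)

-- Steps of size `σ/√2` from a common midpoint have endpoints whose difference is a standard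
-- Gaussian scaled by σ. The positivity of the Metropolis operator rests on this.
variable (E) in
theorem map_sub_stdGaussian :
    ((stdGaussian E).prod (stdGaussian E)).map (fun p => (√2)⁻¹ • (p.2 - p.1))
      = stdGaussian E := by
  have h := map_add_stdGaussian (F := E) (G := E) (E := E) (A := fun z => -((√2)⁻¹ • z))
    (B := fun z => (√2)⁻¹ • z) (by fun_prop) (by fun_prop) (fun t => -((√2)⁻¹ • t))
    (fun t => (√2)⁻¹ • t) (fun z t => by simp [inner_smul_left, inner_smul_right])
    (fun z t => by simp [inner_smul_left, inner_smul_right]) (fun t => by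
      rw [norm_neg, norm_smul, mul_pow, Real.norm_eq_abs, sq_abs, inv_pow,
        Real.sq_sqrt (by norm_num)]
      ring)
  refine Eq.trans (congrArg (fun f => Measure.map f _) (funext fun p => ?_)) h
  rw [smul_sub]
  abel

variable (E) in
theorem integrable_sq_norm_stdGaussian : Integrable (fun z : E => ‖z‖ ^ 2) (stdGaussian E) :=
  (IsGaussian.memLp_two_id (μ := stdGaussian E)).integrable_norm_pow (by norm_num)

variable (E) in
theorem integral_sq_norm_stdGaussian :
    ∫ z, ‖z‖ ^ 2 ∂(stdGaussian E) = Module.finrank ℝ E := by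
  set b := stdOrthonormalBasis ℝ E
  have e : ∀ z : E, ‖z‖ ^ 2 = ∑ i, (innerSL ℝ (b i) z) ^ 2 := fun z => by
    simp only [innerSL_apply_apply]
    exact (b.sum_sq_inner_right z).symm
  have hL2 : ∀ i, MemLp (innerSL ℝ (b i)) 2 (stdGaussian E) := fun i =>
    IsGaussian.memLp_dual _ _ 2 (by simp)
  have h1 : ∀ i, ∫ z, (innerSL ℝ (b i) z) ^ 2 ∂(stdGaussian E) = 1 := fun i => by
    have hv := variance_dual_stdGaussian (E := E) (innerSL ℝ (b i))
    rw [variance_eq_sub (hL2 i), integral_strongDual_stdGaussian, innerSL_apply_norm,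
      b.norm_eq_one] at hv
    simpa using hv
  simp_rw [e]
  rw [integral_finsetSum _ fun i _ => (hL2 i).integrable_sq]
  exact (Finset.sum_congr rfl fun i _ => h1 i).trans (by simp)

/-- Jensen's inequality for a Gaussian function of a standard Gaussian vector. -/
theorem exp_le_integral_exp_neg_sq_norm {c : ℝ} (hc : 0 ≤ c) :
    Real.exp (-(c * Module.finrank ℝ E)) ≤ ∫ z, Real.exp (-(c * ‖z‖ ^ 2)) ∂(stdGaussian E) := by
  set m := c * Module.finrank ℝ E
  have hi := integrable_sq_norm_stdGaussian E
  -- The tangent line of the exponential at `-m`; since `E‖z‖²` is the dimension, its integral is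
  -- exactly `e^{-m}`.
  have h1 : ∀ z : E, Real.exp (-m) * (1 + m - c * ‖z‖ ^ 2) ≤ Real.exp (-(c * ‖z‖ ^ 2)) := by
    intro z
    have h := Real.add_one_le_exp (m - c * ‖z‖ ^ 2)
    calc Real.exp (-m) * (1 + m - c * ‖z‖ ^ 2)
        ≤ Real.exp (-m) * Real.exp (m - c * ‖z‖ ^ 2) := by
          gcongr
          linarith
      _ = _ := by rw [← Real.exp_add]; congr 1; ring
  have h2 : ∫ z : E, Real.exp (-m) * (1 + m - c * ‖z‖ ^ 2) ∂(stdGaussian E) = Real.exp (-m) := by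
    rw [integral_const_mul, integral_sub (integrable_const _) (hi.const_mul c),
      integral_const_mul, integral_sq_norm_stdGaussian]
    simp only [integral_const, probReal_univ, one_smul]
    change _ * (1 + m - m) = _
    ring
  rw [← h2]
  refine integral_mono ((((integrable_const _).sub (hi.const_mul c))).const_mul _) ?_ h1
  refine Integrable.of_bound (C := 1) (by fun_prop) (ae_of_all _ fun z => ?_)
  rw [Real.norm_eq_abs, abs_of_pos (Real.exp_pos _), Real.exp_le_one_iff]
  have : 0 ≤ c * ‖z‖ ^ 2 := by positivity
  linarith

/-- The geometric mean of the two densities is `e^{-t²/8}` times the density of `N(t/2, 1)`, so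
their Hellinger affinity is `e^{-t²/8}`. -/
theorem gaussianPDFReal_mul_eq (t s : ℝ) :
    gaussianPDFReal 0 1 s * gaussianPDFReal t 1 s
      = (gaussianPDFReal (t / 2) 1 s * Real.exp (-t ^ 2 / 8)) ^ 2 := by
  have h : Real.exp (-(s - 0) ^ 2 / (2 * (1 : NNReal))) * Real.exp (-(s - t) ^ 2 / (2 * (1 : NNReal)))
      = (Real.exp (-(s - t / 2) ^ 2 / (2 * (1 : NNReal))) * Real.exp (-t ^ 2 / 8)) ^ 2 := by
    rw [← Real.exp_add, ← Real.exp_add, ← Real.exp_nat_mul]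
    congr 1
    push_cast
    ring
  simp only [gaussianPDFReal_def]
  linear_combination ((√(2 * Real.pi * (1 : NNReal)))⁻¹) ^ 2 * h

/-- The total variation distance between `N(0, 1)` and `N(t, 1)` is at most `|t| / 2`. -/
theorem integral_sub_integral_add_le {ψ : ℝ → ℝ} (hψ : Measurable ψ)
    (hψ01 : ∀ s, ψ s ∈ Icc (0 : ℝ) 1) {t : ℝ} (ht : 0 < t) :
    ∫ s, ψ s ∂(gaussianReal 0 1) - ∫ s, ψ (s + t) ∂(gaussianReal 0 1) ≤ t / 2 := by
  have e1 : ∫ s, ψ (s + t) ∂(gaussianReal 0 1) = ∫ s, ψ s ∂(gaussianReal t 1) := by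
    have h := gaussianReal_map_add_const (μ := 0) (v := 1) t
    rw [zero_add] at h
    rw [← h, integral_map (by fun_prop) hψ.aestronglyMeasurable]
  rw [e1, integral_gaussianReal_eq_integral_smul one_ne_zero,
    integral_gaussianReal_eq_integral_smul one_ne_zero]
  simp only [smul_eq_mul]
  set p := gaussianPDFReal 0 1 with hp
  set q := gaussianPDFReal t 1 with hq
  set r := gaussianPDFReal (t / 2) 1 with hr
  set ρ := Real.exp (-t ^ 2 / 8) with hρ
  have ip : Integrable p := integrable_gaussianPDFReal 0 1
  have iq : Integrable q := integrable_gaussianPDFReal t 1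
  have ir : Integrable r := integrable_gaussianPDFReal (t / 2) 1
  have Ip : ∫ s, p s = 1 := integral_gaussianPDFReal_eq_one 0 one_ne_zero
  have Iq : ∫ s, q s = 1 := integral_gaussianPDFReal_eq_one t one_ne_zero
  have Ir : ∫ s, r s = 1 := integral_gaussianPDFReal_eq_one (t / 2) one_ne_zero
  have hb : ∀ {f : ℝ → ℝ}, Integrable f → Integrable fun s => f s * ψ s := fun {f} hf =>
    hf.mul_bdd (c := 1) hψ.aestronglyMeasurable (ae_of_all _ fun s => by
      rw [Real.norm_eq_abs, abs_of_nonneg (hψ01 s).1]; exact (hψ01 s).2)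
  -- With `x = √p` and `y = √q`, the bound is `(p - q)/2 + |p - q|/2`, where `|p - q| = |x - y||x +
  -- y|` is split by AM-GM with weights `2/t` and `t/8`. After integration the first term vanishes,
  -- `∫(x - y)² = 2 - 2ρ ≤ t²/4` and `∫(x + y)² = 2 + 2ρ ≤ 4`, so the other two give `t/4` each.
  have hpt : ∀ s, p s * ψ s - q s * ψ s
      ≤ (1 / 2) * (p s - q s) + (1 / t) * (p s + q s - 2 * ρ * r s)
        + (t / 16) * (p s + q s + 2 * ρ * r s) := by
    intro s
    have hps : 0 ≤ p s := gaussianPDFReal_nonneg _ _ _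
    have hqs : 0 ≤ q s := gaussianPDFReal_nonneg _ _ _
    have hrs : 0 ≤ r s := gaussianPDFReal_nonneg _ _ _
    have hmul : √(p s) * √(q s) = ρ * r s := by
      rw [← Real.sqrt_mul hps, gaussianPDFReal_mul_eq, Real.sqrt_sq (by positivity), mul_comm]
    set x := √(p s)
    set y := √(q s)
    have hx : p s = x ^ 2 := (Real.sq_sqrt hps).symm
    have hy : q s = y ^ 2 := (Real.sq_sqrt hqs).symm
    have h1 : p s * ψ s - q s * ψ s ≤ (1 / 2) * (p s - q s) + (1 / 2) * |p s - q s| := by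
      have a1 := (hψ01 s).1
      have a2 := (hψ01 s).2
      rcases le_total (p s) (q s) with h | h
      · rw [abs_of_nonpos (by linarith)]; nlinarith
      · rw [abs_of_nonneg (by linarith)]; nlinarith
    have h2 : |p s - q s| ≤ (2 / t) * (x - y) ^ 2 + (t / 8) * (x + y) ^ 2 := by
      have hfac : |p s - q s| = |x - y| * |x + y| := by rw [← abs_mul, hx, hy]; congr 1; ring
      rw [hfac, ← sq_abs (x - y), ← sq_abs (x + y)]
      have h3 := sq_nonneg (4 * |x - y| - t * |x + y|)
      have h4 : (2 / t) * |x - y| ^ 2 + (t / 8) * |x + y| ^ 2 - |x - y| * |x + y|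
          = (4 * |x - y| - t * |x + y|) ^ 2 / (8 * t) := by field_simp; ring
      have h5 : 0 ≤ (4 * |x - y| - t * |x + y|) ^ 2 / (8 * t) := by positivity
      linarith
    have h6 : 2 * ρ * r s = 2 * (x * y) := by rw [hmul]; ring
    rw [h6]
    calc _ ≤ _ := h1
      _ ≤ (1 / 2) * (p s - q s) + (1 / 2) * ((2 / t) * (x - y) ^ 2 + (t / 8) * (x + y) ^ 2) := by
        gcongr
      _ = _ := by rw [hx, hy]; ring
  have hρ1 : 1 - t ^ 2 / 8 ≤ ρ := by
    have := Real.add_one_le_exp (-t ^ 2 / 8)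
    linarith
  have hρ2 : ρ ≤ 1 := Real.exp_le_one_iff.2 (by have := sq_nonneg t; linarith)
  have ipq : Integrable fun s => p s + q s := ip.add iq
  have i2 : Integrable fun s => 2 * ρ * r s := ir.const_mul _
  have ia : Integrable fun s => (1 / 2) * (p s - q s) := (ip.sub iq).const_mul _
  have ib : Integrable fun s => (1 / t) * (p s + q s - 2 * ρ * r s) := (ipq.sub i2).const_mul _
  have ic : Integrable fun s => (t / 16) * (p s + q s + 2 * ρ * r s) := (ipq.add i2).const_mul _
  have iab : Integrable fun s => (1 / 2) * (p s - q s) + (1 / t) * (p s + q s - 2 * ρ * r s) :=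
    ia.add ib
  have iabc : Integrable fun s => (1 / 2) * (p s - q s) + (1 / t) * (p s + q s - 2 * ρ * r s)
      + (t / 16) * (p s + q s + 2 * ρ * r s) := iab.add ic
  rw [← integral_sub (hb ip) (hb iq)]
  refine (integral_mono ((hb ip).sub (hb iq)) iabc hpt).trans ?_
  rw [integral_add iab ic, integral_add ia ib, integral_const_mul, integral_const_mul,
    integral_const_mul, integral_sub ip iq, integral_sub ipq i2, integral_add ipq i2,
    integral_add ip iq, integral_const_mul, Ip, Iq, Ir]
  have h7 : 1 / t * (1 + 1 - 2 * ρ * 1) ≤ 1 / t * (t ^ 2 / 4) := by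
    gcongr
    linarith
  have h8 : t / 16 * (1 + 1 + 2 * ρ * 1) ≤ t / 16 * 4 := by
    gcongr
    linarith
  have h9 : 1 / t * (t ^ 2 / 4) = t / 4 := by field_simp
  linarith

/-- The total variation distance between two Gaussian laws with covariance `σ² I` is at most the
distance between the means divided by `2 σ`. -/
theorem integral_stdGaussian_sub_le {φ : E → ℝ} (hφ : Measurable φ)
    (hφ01 : ∀ z, φ z ∈ Icc (0 : ℝ) 1) {σ : ℝ} (hσ : 0 < σ) (x y : E) :
    ∫ z, φ (x + σ • z) ∂(stdGaussian E) - ∫ z, φ (y + σ • z) ∂(stdGaussian E)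
      ≤ dist x y / (2 * σ) := by
  rcases eq_or_ne x y with h | h
  · simp [h]
  have hn : 0 < ‖y - x‖ := norm_pos_iff.2 (sub_ne_zero.2 h.symm)
  set e : E := ‖y - x‖⁻¹ • (y - x) with he
  have he1 : ‖e‖ = 1 := by rw [he, norm_smul, norm_inv, norm_norm, inv_mul_cancel₀ hn.ne']
  set t := ‖y - x‖ / σ with ht
  have ht0 : 0 < t := div_pos hn hσ
  have hye : y = x + (σ * t) • e := by
    rw [ht, he, smul_smul, mul_div_cancel₀ _ hσ.ne', mul_inv_cancel₀ hn.ne', one_smul]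
    abel
  -- The Gaussian is resampled as its component orthogonal to `e` plus an independent scalar
  -- Gaussian along `e`. The means differ only along `e`, so the one-dimensional bound applies with
  -- the orthogonal part frozen.
  have hlaw := map_add_stdGaussian (F := E) (G := ℝ) (E := E)
    (A := fun z => z - (inner ℝ e z : ℝ) • e)
    (B := fun s => s • e) (by fun_prop) (by fun_prop) (fun z => z - (inner ℝ e z : ℝ) • e)
    (fun t => inner ℝ e t)
    (fun z t => by
      rw [inner_sub_left, inner_sub_right, real_inner_smul_left, real_inner_smul_right,
        real_inner_comm z e]
      ring)
    (fun s t => by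
      rw [real_inner_smul_left]
      simp [mul_comm])
    (fun t => by
      rw [norm_sub_sq_real, real_inner_smul_right, norm_smul, he1, real_inner_comm t e]
      simp only [Real.norm_eq_abs, mul_one, sq_abs]
      ring)
  rw [stdGaussian_real] at hlaw
  have hm : Measurable fun p : E × ℝ => (p.1 - (inner ℝ e p.1 : ℝ) • e) + p.2 • e := by fun_prop
  have key : ∀ w : E, ∫ z, φ (w + σ • z) ∂(stdGaussian E)
      = ∫ z, ∫ s, φ (w + σ • ((z - (inner ℝ e z : ℝ) • e) + s • e)) ∂(gaussianReal 0 1)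
        ∂(stdGaussian E) := by
    intro w
    conv_lhs => rw [← hlaw]
    rw [integral_map hm.aemeasurable (Measurable.aestronglyMeasurable (by fun_prop)),
      integral_prod]
    exact (BddMeas.of_mem_Icc (a := 0) (b := 1) (by fun_prop) fun p => hφ01 _).integrable _
  rw [key x, key y]
  have hB : ∀ w : E, BddMeas fun z : E =>
      ∫ s, φ (w + σ • ((z - (inner ℝ e z : ℝ) • e) + s • e)) ∂(gaussianReal 0 1) := by
    intro w
    have hs : Measurable fun p : E × ℝ =>
      φ (w + σ • ((p.1 - (inner ℝ e p.1 : ℝ) • e) + p.2 • e)) := by fun_prop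
    refine .of_mem_Icc (a := 0) (b := 1) hs.stronglyMeasurable.integral_prod_right.measurable
      fun z => ⟨integral_nonneg fun s => (hφ01 _).1, ?_⟩
    have hb : BddMeas fun s : ℝ => φ (w + σ • ((z - (inner ℝ e z : ℝ) • e) + s • e)) :=
      .of_mem_Icc (a := 0) (b := 1) (by fun_prop) fun s => hφ01 _
    have := integral_mono (hb.integrable (gaussianReal 0 1)) (integrable_const 1)
      fun s => (hφ01 _).2
    simpa using this
  rw [← integral_sub ((hB x).integrable _) ((hB y).integrable _)]
  have hle : ∀ z : E, ∫ s, φ (x + σ • ((z - (inner ℝ e z : ℝ) • e) + s • e)) ∂(gaussianReal 0 1)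
      - ∫ s, φ (y + σ • ((z - (inner ℝ e z : ℝ) • e) + s • e)) ∂(gaussianReal 0 1) ≤ t / 2 := by
    intro z
    have h1 := integral_sub_integral_add_le
      (ψ := fun s => φ (x + σ • ((z - (inner ℝ e z : ℝ) • e) + s • e))) (by fun_prop)
      (fun s => hφ01 _) ht0
    have h2 : ∀ s : ℝ, x + σ • ((z - (inner ℝ e z : ℝ) • e) + (s + t) • e)
        = y + σ • ((z - (inner ℝ e z : ℝ) • e) + s • e) := fun s => by
      rw [hye]
      rw [add_smul, mul_smul, ← add_assoc, smul_add σ _ (t • e)]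
      abel
    simp_rw [h2] at h1
    exact h1
  refine (integral_mono (((hB x).sub (hB y)).integrable _) (integrable_const _) hle).trans ?_
  simp only [integral_const, probReal_univ, one_smul]
  rw [ht, dist_comm, dist_eq_norm, div_div, mul_comm σ]

end Gaussian

/-! ### General Metropolis kernels -/

section Metropolis

variable {E : Type*} [MeasurableSpace E] {Q : Kernel E E} [IsMarkovKernel Q] {ϖ : E → ℝ}

omit [MeasurableSpace E] in
theorem acceptance_le_one (x y : E) : acceptance ϖ x y ≤ 1 := by
  rw [acceptance, ← ENNReal.ofReal_one]
  exact ENNReal.ofReal_le_ofReal (min_le_left _ _)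

theorem lintegral_acceptance_le_one (x : E) : ∫⁻ y, acceptance ϖ x y ∂(Q x) ≤ 1 := by
  calc ∫⁻ y, acceptance ϖ x y ∂(Q x) ≤ ∫⁻ _, 1 ∂(Q x) :=
        lintegral_mono fun y => acceptance_le_one x y
    _ = 1 := by simp

theorem isMarkovKernel_metropolisKernel (hϖ : Measurable ϖ) :
    IsMarkovKernel (metropolisKernel Q ϖ) := by
  refine ⟨fun x => ⟨?_⟩⟩
  rw [metropolisKernel_apply Q hϖ x MeasurableSet.univ, setLIntegral_univ, indicator_univ,
    add_tsub_cancel_of_le (lintegral_acceptance_le_one x)]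

theorem metropolisKernel_eq (hϖ : Measurable ϖ) (x : E) :
    metropolisKernel Q ϖ x = (Q x).withDensity (acceptance ϖ x) +
      (1 - ∫⁻ y, acceptance ϖ x y ∂(Q x)) • Measure.dirac x := by
  ext A hA
  rw [metropolisKernel_apply Q hϖ x hA, Measure.add_apply, withDensity_apply _ hA,
    Measure.smul_apply, Measure.dirac_apply' x hA]
  by_cases h : x ∈ A <;> simp [h]

theorem measurable_acceptance_right (hϖ : Measurable ϖ) (x : E) : Measurable (acceptance ϖ x) :=
  (measurable_acceptance hϖ).comp measurable_prodMk_left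

theorem setLIntegral_acceptance_le (hϖ : Measurable ϖ) (x : E) {A : Set E} (hA : MeasurableSet A) :
    ∫⁻ y in A, acceptance ϖ x y ∂(Q x) ≤ metropolisKernel Q ϖ x A := by
  rw [metropolisKernel_apply Q hϖ x hA]
  exact le_self_add

theorem markovOp_metropolisKernel (hϖ : Measurable ϖ) {f : E → ℝ} (hf : BddMeas f) (x : E) :
    markovOp (metropolisKernel Q ϖ) f x = ∫ y, (acceptance ϖ x y).toReal * f y ∂(Q x)
      + (1 - ∫⁻ y, acceptance ϖ x y ∂(Q x)).toReal * f x := by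
  have hM := isMarkovKernel_metropolisKernel (Q := Q) hϖ
  have hi := hf.integrable (metropolisKernel Q ϖ x)
  rw [metropolisKernel_eq hϖ] at hi
  rw [markovOp, metropolisKernel_eq hϖ, integral_add_measure hi.left_of_add_measure
    hi.right_of_add_measure, integral_withDensity_eq_integral_toReal_smul
    (measurable_acceptance_right hϖ x)
    (ae_of_all _ fun y => (acceptance_le_one x y).trans_lt ENNReal.one_lt_top),
    integral_smul_measure, integral_dirac' f x hf.measurable.stronglyMeasurable]
  rfl

-- The accepted flow has density `min (ϖ x) (ϖ y)` relative to the proposal. Its symmetry gives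
-- detailed balance, and its form as a minimum gives positivity.
omit [MeasurableSpace E] in
theorem ofReal_mul_acceptance {x y : E} (hx : 0 < ϖ x) :
    ENNReal.ofReal (ϖ x) * acceptance ϖ x y = ENNReal.ofReal (min (ϖ x) (ϖ y)) := by
  rw [acceptance, ← ENNReal.ofReal_mul hx.le, mul_min_of_nonneg _ _ hx.le, mul_one,
    mul_div_cancel₀ _ hx.ne']

/-- The kernel `min (g z₁) (g z₂)` is positive semidefinite. -/
theorem integral_mul_min_nonneg {μ : Measure E} [IsProbabilityMeasure μ] {h g : E → ℝ}
    (hh : Measurable h) (hg : Measurable g) (hg0 : ∀ z, 0 ≤ g z) :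
    0 ≤ ∫ p, h p.1 * h p.2 * min (g p.1) (g p.2) ∂(μ.prod μ) := by
  by_cases hint : Integrable (fun p : E × E => h p.1 * h p.2 * min (g p.1) (g p.2)) (μ.prod μ)
  swap
  -- Without integrability the integral is `0` by convention.
  · rw [integral_undef hint]
  -- `min (g z₁) (g z₂)` is the integral over `t > 0` of the product of the indicators of `t < g z₁`
  -- and `t < g z₂`. Exchanging the integrals leaves, for each `t`, the square of one integral.
  set H : (E × E) × ℝ → ℝ := fun q =>
    ({r : E × ℝ | r.2 < g r.1}.indicator (fun r => h r.1) (q.1.1, q.2)) *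
    ({r : E × ℝ | r.2 < g r.1}.indicator (fun r => h r.1) (q.1.2, q.2)) with hH
  have hm : Measurable ({r : E × ℝ | r.2 < g r.1}.indicator (fun r => h r.1)) :=
    (hh.comp measurable_fst).indicator
      (measurableSet_lt measurable_snd (hg.comp measurable_fst))
  have hHm : Measurable H := (hm.comp (by fun_prop)).mul (hm.comp (by fun_prop))
  set lam : Measure ℝ := volume.restrict (Ioi 0)
  have hHeq : ∀ p : E × E, (fun t => H (p, t))
      = (Iio (min (g p.1) (g p.2))).indicator fun _ => h p.1 * h p.2 := by
    intro p
    ext t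
    by_cases h1 : t < g p.1 <;> by_cases h2 : t < g p.2 <;> simp [hH, indicator, h1, h2]
  have hlam : ∀ m : ℝ, lam.real (Iio m) = max m 0 := fun m => by
    simp only [lam]
    rw [measureReal_restrict_apply measurableSet_Iio, inter_comm, Ioi_inter_Iio, measureReal_def,
      Real.volume_Ioo, sub_zero, ENNReal.toReal_ofReal']
  have hlamfin : ∀ m : ℝ, lam (Iio m) ≠ ∞ := fun m => by
    simp only [lam]
    rw [Measure.restrict_apply measurableSet_Iio, inter_comm, Ioi_inter_Iio, Real.volume_Ioo]
    exact ENNReal.ofReal_ne_top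
  have hmin0 : ∀ p : E × E, 0 ≤ min (g p.1) (g p.2) := fun p => le_min (hg0 _) (hg0 _)
  have hHint : Integrable H ((μ.prod μ).prod lam) := by
    rw [integrable_prod_iff hHm.aestronglyMeasurable]
    refine ⟨ae_of_all _ fun p => ?_, ?_⟩
    · rw [hHeq p]
      exact (integrableOn_const (hlamfin _)).integrable_indicator measurableSet_Iio
    · refine hint.norm.congr (ae_of_all _ fun p => ?_)
      have : (fun t => ‖H (p, t)‖)
          = (Iio (min (g p.1) (g p.2))).indicator fun _ => ‖h p.1 * h p.2‖ := by
        ext t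
        rw [show H (p, t) = (fun t => H (p, t)) t from rfl, hHeq p, norm_indicator_eq_indicator_norm]
      simp only [this]
      rw [integral_indicator_const _ measurableSet_Iio, hlam, max_eq_left (hmin0 p), norm_mul,
        Real.norm_of_nonneg (hmin0 p), smul_eq_mul, mul_comm]
  have e1 : ∫ p, h p.1 * h p.2 * min (g p.1) (g p.2) ∂(μ.prod μ)
      = ∫ p, ∫ t, H (p, t) ∂lam ∂(μ.prod μ) := by
    refine integral_congr_ae (ae_of_all _ fun p => ?_)
    simp only [hHeq p]
    rw [integral_indicator_const _ measurableSet_Iio, hlam, max_eq_left (hmin0 p), smul_eq_mul,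
      mul_comm]
  rw [e1, integral_integral_swap hHint]
  refine integral_nonneg fun t => ?_
  simp only [hH]
  rw [integral_prod_mul (fun z => {r : E × ℝ | r.2 < g r.1}.indicator (fun r => h r.1) (z, t))
    (fun z => {r : E × ℝ | r.2 < g r.1}.indicator (fun r => h r.1) (z, t))]
  exact mul_self_nonneg _

end Metropolis

/-! ### Reversibility and positivity of Random Walk Metropolis -/

section RandomWalk

variable {d : ℕ} {ϖ : EuclideanSpace ℝ (Fin d) → ℝ}

theorem measurePreserving_add_fst {F : Type*} [MeasurableSpace F] (ρ : Measure F) [SFinite ρ]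
    {a : F → EuclideanSpace ℝ (Fin d)} (ha : Measurable a) :
    MeasurePreserving (fun p : EuclideanSpace ℝ (Fin d) × F => (p.1 + a p.2, p.2))
      (volume.prod ρ) (volume.prod ρ) := by
  have h : MeasurePreserving (fun p : F × EuclideanSpace ℝ (Fin d) => (p.1, p.2 + a p.1))
      (ρ.prod volume) (ρ.prod volume) :=
    (MeasurePreserving.id ρ).skew_product (g := fun u x => x + a u) (by fun_prop)
      (ae_of_all _ fun u => (measurePreserving_add_right volume (a u)).map_eq)
  exact (Measure.measurePreserving_swap.comp h).comp Measure.measurePreserving_swap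

/-- Reversibility of the Gaussian random walk with respect to Lebesgue measure. -/
theorem measurePreserving_randomWalk (σ : ℝ) :
    MeasurePreserving (fun p : EuclideanSpace ℝ (Fin d) × EuclideanSpace ℝ (Fin d) =>
        (p.1 + σ • p.2, -p.2))
      (volume.prod (stdGaussian _)) (volume.prod (stdGaussian _)) :=
  ((MeasurePreserving.id volume).prod
    ⟨measurable_neg, map_neg_stdGaussian (EuclideanSpace ℝ (Fin d))⟩).comp
    (measurePreserving_add_fst (stdGaussian _) (a := fun z => σ • z) (by fun_prop))

/-- A Gaussian random walk step is the composition of two independent smaller steps. -/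
theorem measurePreserving_two_steps (τ : ℝ) :
    MeasurePreserving (fun p : EuclideanSpace ℝ (Fin d) ×
        (EuclideanSpace ℝ (Fin d) × EuclideanSpace ℝ (Fin d)) =>
        (p.1 + τ • p.2.1, (√2)⁻¹ • (p.2.2 - p.2.1)))
      (volume.prod ((stdGaussian _).prod (stdGaussian _))) (volume.prod (stdGaussian _)) :=
  ((MeasurePreserving.id volume).prod
    ⟨by fun_prop, map_sub_stdGaussian (EuclideanSpace ℝ (Fin d))⟩).comp
    (measurePreserving_add_fst ((stdGaussian _).prod (stdGaussian _)) (a := fun z => τ • z.1)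
      (by fun_prop))

theorem lintegral_gaussianProposal (σ : ℝ) (x : EuclideanSpace ℝ (Fin d))
    {f : EuclideanSpace ℝ (Fin d) → ℝ≥0∞} (hf : Measurable f) :
    ∫⁻ y, f y ∂(gaussianProposal d σ x) = ∫⁻ z, f (x + σ • z) ∂(stdGaussian _) := by
  rw [gaussianProposal_apply, lintegral_map hf (by fun_prop)]

theorem integral_gaussianProposal (σ : ℝ) (x : EuclideanSpace ℝ (Fin d))
    {f : EuclideanSpace ℝ (Fin d) → ℝ} (hf : Measurable f) :
    ∫ y, f y ∂(gaussianProposal d σ x) = ∫ z, f (x + σ • z) ∂(stdGaussian _) := by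
  rw [gaussianProposal_apply, integral_map (by fun_prop) hf.aestronglyMeasurable]

/-- The rejected part lives on `A ∩ B` and is visibly symmetric. The accepted part is an integral
over starting point and increment that path reversal leaves invariant. -/
theorem isReversible_metropolisKernel (σ : ℝ) (hϖ : Measurable ϖ) (hpos : ∀ x, 0 < ϖ x) :
    (metropolisKernel (gaussianProposal d σ) ϖ).IsReversible
      (volume.withDensity fun x => ENNReal.ofReal (ϖ x)) := by
  set π := volume.withDensity fun x => ENNReal.ofReal (ϖ x) with hπ
  set Q := gaussianProposal d σ with hQ
  set Φ : Set (EuclideanSpace ℝ (Fin d)) → Set (EuclideanSpace ℝ (Fin d)) →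
      EuclideanSpace ℝ (Fin d) × EuclideanSpace ℝ (Fin d) → ℝ≥0∞ := fun A B p =>
    A.indicator 1 p.1 * B.indicator 1 (p.1 + σ • p.2) *
      ENNReal.ofReal (min (ϖ p.1) (ϖ (p.1 + σ • p.2))) with hΦ
  have hind : ∀ {A : Set (EuclideanSpace ℝ (Fin d))}, MeasurableSet A →
      Measurable (A.indicator (1 : EuclideanSpace ℝ (Fin d) → ℝ≥0∞)) :=
    fun hA => measurable_one.indicator hA
  have hΦm : ∀ {A B}, MeasurableSet A → MeasurableSet B → Measurable (Φ A B) := by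
    intro A B hA hB
    have h1 : Measurable fun p : EuclideanSpace ℝ (Fin d) × EuclideanSpace ℝ (Fin d) =>
      A.indicator (1 : EuclideanSpace ℝ (Fin d) → ℝ≥0∞) p.1 := (hind hA).comp measurable_fst
    have h2 : Measurable fun p : EuclideanSpace ℝ (Fin d) × EuclideanSpace ℝ (Fin d) =>
      B.indicator (1 : EuclideanSpace ℝ (Fin d) → ℝ≥0∞) (p.1 + σ • p.2) := (hind hB).comp (by fun_prop)
    exact (h1.mul h2).mul (by fun_prop)
  have hmain : ∀ {A B}, MeasurableSet A → MeasurableSet B →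
      ∫⁻ x in A, ∫⁻ y in B, acceptance ϖ x y ∂(Q x) ∂π
        = ∫⁻ p, Φ A B p ∂(volume.prod (stdGaussian (EuclideanSpace ℝ (Fin d)))) := by
    intro A B hA hB
    have hin : Measurable fun x => ∫⁻ y in B, acceptance ϖ x y ∂(Q x) := by
      have := (measurable_acceptance hϖ).setLIntegral_kernel_prod_right (κ := Q) hB
      exact this
    rw [← lintegral_indicator hA, hπ, lintegral_withDensity_eq_lintegral_mul _ (by fun_prop)
      (hin.indicator hA), lintegral_prod _ (hΦm hA hB).aemeasurable]
    refine lintegral_congr fun x => ?_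
    simp only [Pi.mul_apply, hΦ]
    by_cases hx : x ∈ A
    · have hm : Measurable fun y => B.indicator (acceptance ϖ x) y :=
        (measurable_acceptance_right hϖ x).indicator hB
      rw [indicator_of_mem hx, ← lintegral_indicator hB, lintegral_gaussianProposal σ x hm,
        ← lintegral_const_mul _ (f := fun z => B.indicator (acceptance ϖ x) (x + σ • z))
          (hm.comp (by fun_prop : Measurable fun z => x + σ • z))]
      refine lintegral_congr fun z => ?_
      by_cases hz : x + σ • z ∈ B
      · simp [hx, hz, ofReal_mul_acceptance (hpos x)]
      · simp [hz]
    · simp [hx]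
  intro A B hA hB
  have hr : Measurable fun x => 1 - ∫⁻ y, acceptance ϖ x y ∂(Q x) :=
    measurable_const.sub (measurable_acceptance hϖ).lintegral_kernel_prod_right
  have hsplit : ∀ {A B : Set (EuclideanSpace ℝ (Fin d))}, MeasurableSet A → MeasurableSet B →
      ∫⁻ x in A, metropolisKernel Q ϖ x B ∂π
        = ∫⁻ p, Φ A B p ∂(volume.prod (stdGaussian (EuclideanSpace ℝ (Fin d)))) +
          ∫⁻ x in A ∩ B, (1 - ∫⁻ y, acceptance ϖ x y ∂(Q x)) ∂π := by
    intro A B hA hB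
    simp_rw [metropolisKernel_apply Q hϖ _ hB]
    rw [lintegral_add_right _ (hr.indicator hB), hmain hA hB, lintegral_indicator hB,
      Measure.restrict_restrict hB, inter_comm]
  rw [hsplit hA hB, hsplit hB hA, inter_comm]
  congr 1
  -- Reversal sends `(x, z)` to `(x + σ z, -z)`: it exchanges the endpoints of the step and
  -- preserves the law.
  rw [← (measurePreserving_randomWalk σ).lintegral_comp (hΦm hB hA)]
  refine lintegral_congr fun p => ?_
  simp only [hΦ, smul_neg, add_neg_cancel_right]
  rw [min_comm, mul_comm (A.indicator 1 p.1)]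

/-- Random Walk Metropolis with Gaussian increments is a positive operator. -/
theorem integral_mul_markovOp_nonneg (σ : ℝ) (hϖ : Measurable ϖ) (hpos : ∀ x, 0 < ϖ x)
    [hprob : IsProbabilityMeasure (volume.withDensity fun x => ENNReal.ofReal (ϖ x))]
    {f : EuclideanSpace ℝ (Fin d) → ℝ} (hf : BddMeas f) :
    0 ≤ ∫ x, f x * markovOp (metropolisKernel (gaussianProposal d σ) ϖ) f x
      ∂(volume.withDensity fun x => ENNReal.ofReal (ϖ x)) := by
  set π := volume.withDensity fun x => ENNReal.ofReal (ϖ x) with hπ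
  set Q := gaussianProposal d σ with hQ
  set γ := stdGaussian (EuclideanSpace ℝ (Fin d)) with hγ
  have hϖint : Integrable ϖ := by
    refine ⟨hϖ.aestronglyMeasurable, ?_⟩
    rw [hasFiniteIntegral_iff_ofReal (ae_of_all _ fun x => (hpos x).le)]
    have := hprob.measure_univ
    rw [withDensity_apply _ MeasurableSet.univ, setLIntegral_univ] at this
    rw [this]
    exact ENNReal.one_lt_top
  have hM := isMarkovKernel_metropolisKernel (Q := Q) hϖ
  set acc : EuclideanSpace ℝ (Fin d) → ℝ := fun x =>
    ∫ y, (acceptance ϖ x y).toReal * f y ∂(Q x) with hacc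
  set rej : EuclideanSpace ℝ (Fin d) → ℝ := fun x =>
    (1 - ∫⁻ y, acceptance ϖ x y ∂(Q x)).toReal with hrej
  have hrejm : Measurable rej :=
    (measurable_const.sub (measurable_acceptance hϖ).lintegral_kernel_prod_right).ennreal_toReal
  have hrejb : BddMeas fun x => f x * (rej x * f x) := by
    refine hf.mul ((BddMeas.of_mem_Icc (a := 0) (b := 1) hrejm fun x =>
      ⟨ENNReal.toReal_nonneg, ?_⟩).mul hf)
    exact ENNReal.toReal_mono ENNReal.one_ne_top tsub_le_self
  have hPf : ∀ x, markovOp (metropolisKernel Q ϖ) f x = acc x + rej x * f x := fun x =>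
    markovOp_metropolisKernel hϖ hf x
  have hPfb : BddMeas (markovOp (metropolisKernel Q ϖ) f) := hf.markovOp
  have hfacc : BddMeas fun x => f x * acc x := by
    have e : (fun x => f x * acc x) = fun x =>
        f x * markovOp (metropolisKernel Q ϖ) f x - f x * (rej x * f x) := by
      ext x
      rw [hPf]
      ring
    rw [e]
    exact (hf.mul hPfb).sub hrejb
  have e0 : ∫ x, f x * markovOp (metropolisKernel Q ϖ) f x ∂π
      = ∫ x, (f x * acc x + f x * (rej x * f x)) ∂π :=
    integral_congr_ae (ae_of_all _ fun x => by simp only [hPf, mul_add])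
  refine le_of_le_of_eq ?_ e0.symm
  rw [integral_add (hfacc.integrable π) (hrejb.integrable π)]
  -- Rejection contributes a nonnegative multiple of `f²`; only the accepted part needs an argument.
  refine add_nonneg ?_ (integral_nonneg fun x => ?_)
  swap
  · have h1 : 0 ≤ rej x := ENNReal.toReal_nonneg
    change 0 ≤ f x * (rej x * f x)
    nlinarith [mul_nonneg h1 (mul_self_nonneg (f x))]
  set Ψ : EuclideanSpace ℝ (Fin d) × EuclideanSpace ℝ (Fin d) → ℝ := fun p =>
    f p.1 * f (p.1 + σ • p.2) * min (ϖ p.1) (ϖ (p.1 + σ • p.2)) with hΨ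
  have hfm := hf.measurable
  have hΨm : Measurable Ψ := by fun_prop
  have hΨint : Integrable Ψ (volume.prod γ) := by
    obtain ⟨C, hC⟩ := hf.bdd
    have h1 : Integrable (fun p : EuclideanSpace ℝ (Fin d) × EuclideanSpace ℝ (Fin d) =>
        C * C * ϖ p.1) (volume.prod γ) := (hϖint.comp_fst γ).const_mul _
    refine h1.mono' hΨm.aestronglyMeasurable (ae_of_all _ fun p => ?_)
    rw [hΨ, Real.norm_eq_abs, abs_mul, abs_mul,
      abs_of_pos (lt_min (hpos p.1) (hpos (p.1 + σ • p.2)))]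
    have hC0 : 0 ≤ C := (abs_nonneg _).trans (hC p.1)
    exact mul_le_mul (mul_le_mul (hC _) (hC _) (abs_nonneg _) hC0) (min_le_left _ _)
      (lt_min (hpos _) (hpos _)).le (mul_nonneg hC0 hC0)
  have e1 : ∫ x, f x * acc x ∂π = ∫ p, Ψ p ∂(volume.prod γ) := by
    rw [hπ, integral_withDensity_eq_integral_toReal_smul (by fun_prop)
      (ae_of_all _ fun _ => ENNReal.ofReal_lt_top), integral_prod _ hΨint]
    refine integral_congr_ae (ae_of_all _ fun x => ?_)
    have hm : Measurable fun y => (acceptance ϖ x y).toReal * f y :=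
      (measurable_acceptance_right hϖ x).ennreal_toReal.mul hf.measurable
    simp only [hacc, hΨ, smul_eq_mul]
    rw [hQ, integral_gaussianProposal σ x hm, ENNReal.toReal_ofReal (hpos x).le,
      ← integral_const_mul, ← integral_const_mul]
    refine integral_congr_ae (ae_of_all _ fun z => ?_)
    have h2 := congrArg ENNReal.toReal (ofReal_mul_acceptance (ϖ := ϖ) (y := x + σ • z) (hpos x))
    rw [ENNReal.toReal_mul, ENNReal.toReal_ofReal (hpos x).le,
      ENNReal.toReal_ofReal (lt_min (hpos _) (hpos _)).le] at h2
    simp only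
    rw [← h2]
    ring
  -- Change of variables through a midpoint `w`: the endpoints become `w + τ z₁` and `w + τ z₂` with
  -- `z₁`, `z₂` independent. For fixed `w` the integrand is a quadratic form of the `min` kernel.
  set τ := σ * (√2)⁻¹ with hτ
  have hT := measurePreserving_two_steps (d := d) τ
  have hτ2 : ∀ w z₁ z₂ : EuclideanSpace ℝ (Fin d),
      w + τ • z₁ + σ • ((√2)⁻¹ • (z₂ - z₁)) = w + τ • z₂ := by
    intro w z₁ z₂
    rw [smul_smul, ← hτ, smul_sub]
    abel
  have e2 : ∫ p, Ψ p ∂(volume.prod γ) = ∫ q : EuclideanSpace ℝ (Fin d) ×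
      (EuclideanSpace ℝ (Fin d) × EuclideanSpace ℝ (Fin d)),
      f (q.1 + τ • q.2.1) * f (q.1 + τ • q.2.2) *
        min (ϖ (q.1 + τ • q.2.1)) (ϖ (q.1 + τ • q.2.2)) ∂(volume.prod (γ.prod γ)) := by
    rw [← hT.map_eq, integral_map hT.measurable.aemeasurable hΨm.aestronglyMeasurable]
    simp only [hΨ, hτ2]
    rfl
  have hint2 : Integrable (fun q : EuclideanSpace ℝ (Fin d) ×
      (EuclideanSpace ℝ (Fin d) × EuclideanSpace ℝ (Fin d)) =>
      f (q.1 + τ • q.2.1) * f (q.1 + τ • q.2.2) *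
        min (ϖ (q.1 + τ • q.2.1)) (ϖ (q.1 + τ • q.2.2))) (volume.prod (γ.prod γ)) := by
    have := hT.integrable_comp_of_integrable hΨint
    refine this.congr (ae_of_all _ fun q => ?_)
    simp only [hΨ, Function.comp_apply, hτ2]
  rw [e1, e2, integral_prod _ hint2]
  refine integral_nonneg fun w => ?_
  exact integral_mul_min_nonneg (h := fun z => f (w + τ • z)) (g := fun z => ϖ (w + τ • z))
    (by fun_prop) (by fun_prop) fun z => (hpos _).le

end RandomWalk

/-! ### Acceptance rate and overlap of transition laws -/

section Acceptance

variable {d : ℕ}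

/-- Lower bound on the acceptance rate of Random Walk Metropolis for an `L`-smooth potential. -/
theorem le_lintegral_acceptance {L : ℝ} (hL : 0 < L) {U : EuclideanSpace ℝ (Fin d) → ℝ}
    (hU : IsLSmooth L U) (σ : ℝ) (x : EuclideanSpace ℝ (Fin d)) :
    ENNReal.ofReal ((1 / 2) * Real.exp (-(L * σ ^ 2 / 2 * d))) ≤
      ∫⁻ y, acceptance (fun x => Real.exp (-U x)) x y ∂(gaussianProposal d σ x) := by
  set γ := stdGaussian (EuclideanSpace ℝ (Fin d)) with hγ
  have hUm : Measurable U := hU.1.continuous.measurable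
  have hϖ : Measurable fun x => Real.exp (-U x) := by fun_prop
  set c := L * σ ^ 2 / 2 with hc
  have hc0 : 0 ≤ c := by positivity
  -- Smoothness bounds the acceptance probability below by `a`, whose last factor contains the only
  -- term that is not even in `z`.
  set a : EuclideanSpace ℝ (Fin d) → ℝ := fun z =>
    Real.exp (-(c * ‖z‖ ^ 2)) * min 1 (Real.exp (-(σ * inner ℝ (gradient U x) z))) with ha
  have ham : Measurable a := by fun_prop
  have ha0 : ∀ z, 0 ≤ a z := fun z => by positivity
  have hexp1 : ∀ z : EuclideanSpace ℝ (Fin d), Real.exp (-(c * ‖z‖ ^ 2)) ≤ 1 := fun z => by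
    rw [Real.exp_le_one_iff]
    have : 0 ≤ c * ‖z‖ ^ 2 := by positivity
    linarith
  have hab : BddMeas a := .of_mem_Icc (a := 0) (b := 1) ham fun z =>
    ⟨ha0 z, mul_le_one₀ (hexp1 z) (by positivity) (min_le_left _ _)⟩
  have hgb : BddMeas fun z : EuclideanSpace ℝ (Fin d) => Real.exp (-(c * ‖z‖ ^ 2)) :=
    .of_mem_Icc (a := 0) (b := 1) (by fun_prop) fun z => ⟨(Real.exp_pos _).le, hexp1 z⟩
  have hle : ∀ z, ENNReal.ofReal (a z) ≤ acceptance (fun x => Real.exp (-U x)) x (x + σ • z) := by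
    intro z
    refine ENNReal.ofReal_le_ofReal ?_
    have h := hU.2 x (σ • z)
    rw [real_inner_smul_right, norm_smul, mul_pow, Real.norm_eq_abs, sq_abs] at h
    refine le_min (mul_le_one₀ (hexp1 z) (by positivity) (min_le_left _ _)) ?_
    calc a z ≤ Real.exp (-(c * ‖z‖ ^ 2)) * Real.exp (-(σ * inner ℝ (gradient U x) z)) :=
          mul_le_mul_of_nonneg_left (min_le_right _ _) (Real.exp_pos _).le
      _ = Real.exp (-(c * ‖z‖ ^ 2) + -(σ * inner ℝ (gradient U x) z)) := (Real.exp_add _ _).symm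
      _ ≤ Real.exp (-U (x + σ • z) - -U x) := by
          refine Real.exp_le_exp.2 ?_
          rw [hc]
          linarith
      _ = _ := Real.exp_sub _ _
  rw [lintegral_gaussianProposal σ x (measurable_acceptance_right hϖ x)]
  refine le_trans ?_ (lintegral_mono hle)
  rw [← ofReal_integral_eq_lintegral_ofReal (hab.integrable γ) (ae_of_all _ ha0)]
  refine ENNReal.ofReal_le_ofReal ?_
  have hneg : ∫ z, a (-z) ∂γ = ∫ z, a z ∂γ := by
    conv_rhs => rw [hγ, ← map_neg_stdGaussian (EuclideanSpace ℝ (Fin d))]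
    rw [integral_map (by fun_prop) ham.aestronglyMeasurable]
  -- At one of `z` and `-z` the minimum equals `1`. By symmetry of the Gaussian this costs only the
  -- factor `1/2`.
  have hsum : ∀ z, Real.exp (-(c * ‖z‖ ^ 2)) ≤ a z + a (-z) := by
    intro z
    simp only [ha, norm_neg, inner_neg_right, mul_neg, neg_neg]
    rw [← mul_add]
    refine le_mul_of_one_le_right (Real.exp_pos _).le ?_
    have p1 := Real.exp_pos (-(σ * inner ℝ (gradient U x) z))
    have p2 := Real.exp_pos (σ * inner ℝ (gradient U x) z)
    rcases le_total (σ * inner ℝ (gradient U x) z) 0 with h | h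
    · rw [min_eq_left (Real.one_le_exp (by linarith))]
      have := le_min zero_le_one p2.le
      linarith
    · rw [min_eq_left (Real.one_le_exp h)]
      have := le_min zero_le_one p1.le
      linarith
  have hab' : BddMeas fun z => a (-z) := hab.comp measurable_neg
  have h1 := integral_mono (hgb.integrable γ) ((hab.add hab').integrable γ) hsum
  rw [integral_add (hab.integrable γ) (hab'.integrable γ), hneg] at h1
  have h2 := exp_le_integral_exp_neg_sq_norm (E := EuclideanSpace ℝ (Fin d)) hc0
  rw [finrank_euclideanSpace_fin] at h2
  linarith

/-- Nearby points have overlapping transition laws. -/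
theorem sub_le_add_metropolisKernel {ϖ : EuclideanSpace ℝ (Fin d) → ℝ} (hϖ : Measurable ϖ)
    (hpos : ∀ x, 0 < ϖ x) {σ α : ℝ} (hσ : 0 < σ)
    (hα : ∀ x, ENNReal.ofReal α ≤ ∫⁻ y, acceptance ϖ x y ∂(gaussianProposal d σ x))
    (x y : EuclideanSpace ℝ (Fin d)) {A : Set (EuclideanSpace ℝ (Fin d))} (hA : MeasurableSet A) :
    α - dist x y / (2 * σ) ≤ (metropolisKernel (gaussianProposal d σ) ϖ x).real Aᶜ
      + (metropolisKernel (gaussianProposal d σ) ϖ y).real A := by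
  have hM := isMarkovKernel_metropolisKernel (Q := gaussianProposal d σ) hϖ
  -- The claim is unchanged on exchanging `x` with `y` and `A` with `Aᶜ`, so `x` may be taken as the
  -- point of higher density.
  suffices h : ∀ (x y : EuclideanSpace ℝ (Fin d)) (A : Set (EuclideanSpace ℝ (Fin d))),
      MeasurableSet A → ϖ y ≤ ϖ x →
      α - dist x y / (2 * σ) ≤ (metropolisKernel (gaussianProposal d σ) ϖ x).real Aᶜ
        + (metropolisKernel (gaussianProposal d σ) ϖ y).real A by
    rcases le_total (ϖ y) (ϖ x) with hxy | hxy
    · exact h x y A hA hxy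
    · have := h y x Aᶜ hA.compl hxy
      rw [compl_compl, dist_comm] at this
      linarith
  intro x y A hA hxy
  set Q := gaussianProposal d σ with hQ
  set a : EuclideanSpace ℝ (Fin d) → ℝ := fun z => min 1 (ϖ z / ϖ x) with ha
  have ham : Measurable a := by fun_prop
  have ha01 : ∀ z, a z ∈ Icc (0 : ℝ) 1 := fun z =>
    ⟨le_min zero_le_one (div_pos (hpos _) (hpos _)).le, min_le_left _ _⟩
  have hab := BddMeas.of_mem_Icc ham ha01
  have hind : ∀ B : Set (EuclideanSpace ℝ (Fin d)), ∀ z, B.indicator a z ∈ Icc (0 : ℝ) 1 :=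
    fun B z => by
      by_cases h : z ∈ B
      · rw [indicator_of_mem h]; exact ha01 z
      · rw [indicator_of_notMem h]; exact ⟨le_rfl, zero_le_one⟩
  have hlow : ∀ w, (∀ z, a z ≤ min 1 (ϖ z / ϖ w)) →
      ∀ B, MeasurableSet B → ∫ z, B.indicator a z ∂(Q w) ≤ (metropolisKernel Q ϖ w).real B := by
    intro w hw B hB
    have hb := BddMeas.of_mem_Icc (ham.indicator hB) (hind B)
    rw [← ENNReal.ofReal_le_ofReal_iff measureReal_nonneg, ofReal_measureReal,
      ofReal_integral_eq_lintegral_ofReal (hb.integrable _) (ae_of_all _ fun z => (hind B z).1)]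
    refine le_trans ?_ (setLIntegral_acceptance_le hϖ w hB)
    rw [← lintegral_indicator hB]
    refine lintegral_mono fun z => ?_
    by_cases h : z ∈ B
    · simp only [indicator_of_mem h, acceptance]
      exact ENNReal.ofReal_le_ofReal (hw z)
    · simp [h]
  have h1 := hlow x (fun z => le_rfl) Aᶜ hA.compl
  -- The acceptance function of the higher point `x` is also a lower bound for that of `y`. With
  -- this common weight the deficit is a difference of two Gaussian integrals of a function valued
  -- in `[0, 1]`.
  have h2 := hlow y (fun z => min_le_min_left _
    (div_le_div_of_nonneg_left (hpos z).le (hpos y) hxy)) A hA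
  have hbA := BddMeas.of_mem_Icc (ham.indicator hA) (hind A)
  have hbAc := BddMeas.of_mem_Icc (ham.indicator hA.compl) (hind Aᶜ)
  have h3 : α ≤ ∫ z, a z ∂(Q x) := by
    have := hα x
    rw [← ENNReal.ofReal_le_ofReal_iff (integral_nonneg fun z => (ha01 z).1),
      ofReal_integral_eq_lintegral_ofReal (hab.integrable _) (ae_of_all _ fun z => (ha01 z).1)]
    exact this
  have h4 : ∫ z, a z ∂(Q x) = ∫ z, A.indicator a z ∂(Q x) + ∫ z, Aᶜ.indicator a z ∂(Q x) := by
    rw [← integral_add (hbA.integrable _) (hbAc.integrable _)]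
    exact integral_congr_ae (ae_of_all _ fun z => (congrFun (indicator_self_add_compl A a) z).symm)
  have h5 := integral_stdGaussian_sub_le (ham.indicator hA) (hind A) hσ x y
  rw [← integral_gaussianProposal σ x (ham.indicator hA),
    ← integral_gaussianProposal σ y (ham.indicator hA)] at h5
  linarith

end Acceptance

/-! ### Flow out of a set from overlap and isoperimetry -/

section Conductance

variable {E : Type*} [NormedAddCommGroup E] [NormedSpace ℝ E] [MeasurableSpace E] [BorelSpace E]
  {π : Measure E} [IsProbabilityMeasure π] {P : Kernel E E} [IsMarkovKernel P] {I : ℝ → ℝ}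

/-- Close coupling and isoperimetry imply a lower bound on the flow out of a set. -/
theorem le_flow_of_closeCoupling (hP : P.IsReversible π) (hI : IsRegularConvexIsoMinorant π I)
    {α δ : ℝ} (hα : 0 < α) (hδ : 0 < δ)
    (hcc : ∀ (x y : E) (A : Set E), MeasurableSet A → dist x y ≤ δ →
      α / 2 ≤ (P x).real Aᶜ + (P y).real A)
    {A : Set E} (hA : MeasurableSet A) {p : ℝ} (hp : π.real A = p) (hp0 : 0 < p)
    (hp2 : p ≤ 1 / 2) :
    ENNReal.ofReal (min (α / 8 * p) (α / 8 * (I (p / 2) * δ))) ≤ ∫⁻ x in A, P x Aᶜ ∂π := by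
  set F := ∫⁻ x in A, P x Aᶜ ∂π with hF
  have hrev : ∫⁻ x in Aᶜ, P x A ∂π = F := hP hA.compl hA |>.trans rfl
  -- `A₁` and `A₂` are the sticky points on each side; from `B₁` and `B₂` the chain crosses with
  -- probability at least `α/4`.
  set A₁ : Set E := A ∩ {x | (P x).real Aᶜ < α / 4} with hA₁
  set A₂ : Set E := Aᶜ ∩ {x | (P x).real A < α / 4} with hA₂
  set B₁ : Set E := A ∩ {x | α / 4 ≤ (P x).real Aᶜ} with hB₁
  set B₂ : Set E := Aᶜ ∩ {x | α / 4 ≤ (P x).real A} with hB₂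
  have hmP : ∀ {B : Set E}, MeasurableSet B → Measurable fun x => (P x).real B := fun hB =>
    (Kernel.measurable_coe P hB).ennreal_toReal
  have mA₂ : MeasurableSet A₂ := hA.compl.inter (measurableSet_lt (hmP hA) measurable_const)
  have hflow : ∀ {C D : Set E}, MeasurableSet D →
      ENNReal.ofReal (α / 4 * π.real (C ∩ {x | α / 4 ≤ (P x).real D}))
        ≤ ∫⁻ x in C, P x D ∂π := by
    intro C D hD
    have hset : {x | α / 4 ≤ (P x).real D} = {x | ENNReal.ofReal (α / 4) ≤ P x D} := by
      ext x
      rw [mem_ofPred_eq, mem_ofPred_eq, ← ofReal_measureReal,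
        ENNReal.ofReal_le_ofReal_iff measureReal_nonneg]
    have hmeas : MeasurableSet {x | ENNReal.ofReal (α / 4) ≤ P x D} :=
      measurableSet_le measurable_const (Kernel.measurable_coe P hD)
    rw [ENNReal.ofReal_mul (by positivity), ofReal_measureReal, hset, inter_comm,
      ← Measure.restrict_apply hmeas]
    exact mul_meas_ge_le_lintegral (Kernel.measurable_coe P hD) _
  have h1 : ENNReal.ofReal (α / 4 * π.real B₁) ≤ F := hflow hA.compl
  have h2 : ENNReal.ofReal (α / 4 * π.real B₂) ≤ F := hrev ▸ hflow hA
  have hs1 : π.real A ≤ π.real A₁ + π.real B₁ := by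
    refine (measureReal_mono fun x hx => ?_).trans (measureReal_union_le _ _)
    rcases lt_or_ge ((P x).real Aᶜ) (α / 4) with h | h
    exacts [Or.inl ⟨hx, h⟩, Or.inr ⟨hx, h⟩]
  have hs2 : π.real Aᶜ ≤ π.real A₂ + π.real B₂ := by
    refine (measureReal_mono fun x hx => ?_).trans (measureReal_union_le _ _)
    rcases lt_or_ge ((P x).real A) (α / 4) with h | h
    exacts [Or.inl ⟨hx, h⟩, Or.inr ⟨hx, h⟩]
  have hAc : π.real Aᶜ = 1 - π.real A := by rw [measureReal_compl hA, probReal_univ]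
  -- If either sticky set has mass below `p/2`, the nonsticky set on that side has mass at least
  -- `p/2`; on the side of `Aᶜ` this uses `p ≤ 1/2`.
  rcases lt_or_ge (π.real A₁) (p / 2) with hc1 | hc1
  · refine (ENNReal.ofReal_le_ofReal ((min_le_left _ _).trans ?_)).trans h1
    nlinarith
  rcases lt_or_ge (π.real A₂) (p / 2) with hc2 | hc2
  · refine (ENNReal.ofReal_le_ofReal ((min_le_left _ _).trans ?_)).trans h2
    nlinarith
  -- Sticky points at distance at most `δ` would violate the overlap bound. The larger of `B₁`, `B₂`
  -- carries at least half of the mass left between the sticky sets.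
  have hiso := hI.three_set mA₂ hδ (fun x hx y hy => by
    by_contra! h
    have := hcc x y A hA h.le
    have h3 : (P x).real Aᶜ < α / 4 := hx.2
    have h4 : (P y).real A < α / 4 := hy.2
    linarith) (half_pos hp0) hc1 hc2
  have hs3 : π.real (A₁ ∪ A₂)ᶜ ≤ π.real B₁ + π.real B₂ := by
    refine (measureReal_mono fun x hx => ?_).trans (measureReal_union_le _ _)
    by_cases h : x ∈ A
    · refine Or.inl ⟨h, ?_⟩
      rw [mem_ofPred_eq]
      exact le_of_not_gt fun h' => hx (Or.inl ⟨h, h'⟩)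
    · refine Or.inr ⟨h, ?_⟩
      rw [mem_ofPred_eq]
      exact le_of_not_gt fun h' => hx (Or.inr ⟨h, h'⟩)
  rcases le_total (π.real B₁) (π.real B₂) with hB | hB
  · refine (ENNReal.ofReal_le_ofReal ((min_le_right _ _).trans ?_)).trans h2
    nlinarith
  · refine (ENNReal.ofReal_le_ofReal ((min_le_right _ _).trans ?_)).trans h1
    nlinarith

end Conductance

/-! ### Flow and conductance bounds with explicit constants -/

section Main

variable {d : ℕ} {L ς σ : ℝ} {U : EuclideanSpace ℝ (Fin d) → ℝ}
  {π : Measure (EuclideanSpace ℝ (Fin d))} [IsProbabilityMeasure π] {I : ℝ → ℝ}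

/-- The flow bound for the Random Walk Metropolis kernel in terms of an isoperimetric minorant. -/
theorem le_flow_rwmKernel (hL : 0 < L) (hU : IsLSmooth L U)
    (hπ : π = volume.withDensity (fun x => ENNReal.ofReal (Real.exp (-U x))))
    (hI : IsRegularConvexIsoMinorant π I) (hJ : IsConvexProfile (zeroExt I)) (hσ : 0 < σ)
    (hς : L * σ ^ 2 * d = ς ^ 2) (hstep : σ * I (1 / 4) ≤ 1 / 2)
    {A : Set (EuclideanSpace ℝ (Fin d))} (hA : MeasurableSet A) (hA2 : π A ≤ 1 / 2) :
    ENNReal.ofReal (2 * ((1 / 2 ^ 6) * Real.exp (-ς ^ 2) * σ) * zeroExt I (π.real A / 2))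
      ≤ ∫⁻ x in A, rwmKernel σ U x Aᶜ ∂π := by
  have hϖ : Measurable fun x => Real.exp (-U x) :=
    (hU.1.continuous.neg.rexp).measurable
  have hpos : ∀ x, 0 < Real.exp (-U x) := fun x => Real.exp_pos _
  have hM : IsMarkovKernel (rwmKernel σ U) := isMarkovKernel_metropolisKernel hϖ
  have hrev : (rwmKernel σ U).IsReversible π := hπ ▸ isReversible_metropolisKernel σ hϖ hpos
  set e := Real.exp (-ς ^ 2 / 2) with he
  have he0 : 0 < e := Real.exp_pos _
  have he1 : e ≤ 1 := Real.exp_le_one_iff.2 (by nlinarith [sq_nonneg ς])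
  have hee : Real.exp (-ς ^ 2) = e * e := by rw [he, ← Real.exp_add]; ring_nf
  have hα : ∀ x, ENNReal.ofReal (1 / 2 * e) ≤
      ∫⁻ y, acceptance (fun x => Real.exp (-U x)) x y ∂(gaussianProposal d σ x) := by
    intro x
    have h := le_lintegral_acceptance hL hU σ x
    rwa [show -(L * σ ^ 2 / 2 * d) = -ς ^ 2 / 2 by rw [← hς]; ring] at h
  set p := π.real A with hp
  have hp2 : p ≤ 1 / 2 := by
    have := ENNReal.toReal_mono (by simp) hA2
    simpa [hp, measureReal_def] using this
  rcases (measureReal_nonneg : 0 ≤ π.real A).eq_or_lt with h0 | h0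
  · rw [hp, ← h0]
    simp [zeroExt]
  -- With `δ = α σ` the total variation loss `δ/(2σ)` is `α/2`, leaving overlap `α/2`. The
  -- isoperimetric term is then `e² σ I(p/2) / 32`, which is the claimed constant.
  have key := le_flow_of_closeCoupling hrev hI (α := 1 / 2 * e) (δ := 1 / 2 * e * σ)
    (by positivity) (by positivity) (fun x y B hB hxy => by
      have h := sub_le_add_metropolisKernel hϖ hpos hσ hα x y hB
      have h2 : dist x y / (2 * σ) ≤ 1 / 2 * e / 2 := by
        rw [div_le_iff₀ (by positivity)]; linarith
      exact le_trans (by linarith) h) hA rfl h0 hp2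
  refine le_trans (ENNReal.ofReal_le_ofReal ?_) key
  rw [zeroExt_of_pos (by linarith : 0 < p / 2), hee]
  have hIp : 0 < I (p / 2) := hI.pos _ ⟨by linarith, by linarith⟩
  refine le_min ?_ (le_of_eq (by ring))
  -- Comparing `J(t)/t` at `p/2` and `1/4` and using the step-size condition gives `σ I(p/2) ≤ p`,
  -- so the linear term of the minimum also dominates.
  have h3 := hJ.mul_le_mul (s := p / 2) (t := 1 / 4) (by linarith) (by linarith) (by norm_num)
  rw [zeroExt_of_pos (by linarith : 0 < p / 2), zeroExt_of_pos (by norm_num)] at h3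
  have h4 : σ * I (p / 2) ≤ p := by
    have : σ * I (p / 2) ≤ 2 * p * (σ * I (1 / 4)) := by nlinarith
    nlinarith
  have h5 : e * e * (σ * I (p / 2)) ≤ e * 1 * p := by gcongr
  have h6 : 0 < e * p := mul_pos he0 h0
  calc _ = 1 / 32 * (e * e * (σ * I (p / 2))) := by ring
    _ ≤ 1 / 32 * (e * 1 * p) := by gcongr
    _ ≤ 1 / 2 * e / 8 * p := by linarith

/-- A flow bound by a convex profile gives a lower bound on the weak conductance profile. -/
theorem le_weakConductanceProfile {E : Type*} [MeasurableSpace E] {μ : Measure E}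
    [IsProbabilityMeasure μ] {P : Kernel E E} {J : ℝ → ℝ} (hJ : IsConvexProfile J) {k : ℝ}
    (hk : 0 < k)
    (hflow : ∀ A, MeasurableSet A → μ A ≤ 1 / 2 →
      ENNReal.ofReal (2 * k * J (μ.real A / 2)) ≤ ∫⁻ x in A, P x Aᶜ ∂μ)
    {v : ℝ} (hv : v ∈ Ioc (0 : ℝ) (1 / 2)) :
    ENNReal.ofReal (k * (J (v / 2) / (v / 2))) ≤ weakConductanceProfile μ P v := by
  refine le_iInf₂ fun A ⟨hA, hvA, hA2⟩ => ?_
  have hvp : v ≤ μ.real A := (ENNReal.ofReal_le_iff_le_toReal (measure_ne_top _ _)).1 hvA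
  have hp2 : μ.real A ≤ 1 / 2 := by
    have := ENNReal.toReal_mono (by simp) hA2
    simpa [measureReal_def] using this
  have hv0 := hv.1
  rw [ENNReal.le_div_iff_mul_le (Or.inl (hvA.trans_lt' (by simpa using hv0)).ne')
    (Or.inl (measure_ne_top _ _)), ← ofReal_measureReal, ← ENNReal.ofReal_mul' measureReal_nonneg]
  refine (ENNReal.ofReal_le_ofReal ?_).trans (hflow A hA hA2)
  -- The worst set has the smallest allowed mass, as `J(t)/t` is nondecreasing; the factor `2` in
  -- the flow matches the halved argument.
  have h := hJ.mul_le_mul (s := v / 2) (t := μ.real A / 2) (by linarith) (by linarith)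
    (by linarith)
  have h2 : J (v / 2) / (v / 2) * μ.real A ≤ 2 * J (μ.real A / 2) := by
    rw [div_mul_eq_mul_div, div_le_iff₀ (by linarith)]
    linarith
  calc _ = k * (J (v / 2) / (v / 2) * μ.real A) := by ring
    _ ≤ k * (2 * J (μ.real A / 2)) := by gcongr
    _ = _ := by ring

end Main

end RWMWeakPoincare

theorem mainTheorem7
    (d : ℕ) (hd : 0 < d)
    (L : ℝ) (hL : 0 < L)
    (ς : ℝ) (hς : 0 < ς)
    (U : EuclideanSpace ℝ (Fin d) → ℝ) (hU : RWMWeakPoincare.IsLSmooth L U)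
    (π : Measure (EuclideanSpace ℝ (Fin d))) [IsProbabilityMeasure π]
    (hπ : π = volume.withDensity (fun x => ENNReal.ofReal (Real.exp (-U x))))
    (I : ℝ → ℝ) (hI : RWMWeakPoincare.IsRegularConvexIsoMinorant π I)
    (hstep : 2 * ς * ((√L)⁻¹ * I (1 / 4)) ≤ √(d : ℝ))
    (P : Kernel (EuclideanSpace ℝ (Fin d)) (EuclideanSpace ℝ (Fin d)))
    (hP : P = RWMWeakPoincare.rwmKernel (ς * (√(L * d))⁻¹) U) :
    -- positive weak conductance profile with an explicit lower bound
    (RWMWeakPoincare.HasPositiveWCP π P ∧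
      ∀ v ∈ Ioc (0 : ℝ) (1 / 2),
        ENNReal.ofReal ((1 / 2 ^ 6) * ς * Real.exp (-ς ^ 2) * (√(L * d))⁻¹ *
            (I (v / 2) / (v / 2)))
          ≤ RWMWeakPoincare.weakConductanceProfile π P v) ∧
    -- weak Poincaré inequality with an explicit lower bound on its function
    (∃ K : ℝ → ℝ,
      RWMWeakPoincare.KStarWPI π P (fun f => RWMWeakPoincare.eOsc π f ^ 2) K ∧
      ∀ v ∈ Ioc (0 : ℝ) (1 / 4),
        (1 / 2 ^ 11) * ς ^ 2 * Real.exp (-2 * ς ^ 2) * (L * d)⁻¹ *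
            (I (v / 8) ^ 2 / (v / 8)) ≤ K v) ∧
    -- bounded functions
    (∀ f : EuclideanSpace ℝ (Fin d) → ℝ, Measurable f →
      RWMWeakPoincare.eOsc π f ≠ 0 → RWMWeakPoincare.eOsc π f ≠ ∞ →
      ∀ n : ℕ,
        RWMWeakPoincare.decayRatio π P f n ≤ 1 / 4 ∧
        (n : ℝ≥0∞) ≤
          ENNReal.ofReal (2 ^ 14 * (ς ^ 2)⁻¹ * Real.exp (2 * ς ^ 2) * L * d) *
            ∫⁻ v in Ioc ((RWMWeakPoincare.decayRatio π P f n).toReal / 8)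
                ((RWMWeakPoincare.decayRatio π P f 0).toReal / 8),
              ENNReal.ofReal (v / I v ^ 2)) ∧
    -- initial laws whose density has finite oscillation; the integral is oriented
    (∀ ν : Measure (EuclideanSpace ℝ (Fin d)), IsProbabilityMeasure ν → ν ≪ π →
      RWMWeakPoincare.eOsc π (fun x => (ν.rnDeriv π x).toReal) ≠ ∞ →
      ∀ u : ℝ, u = (RWMWeakPoincare.eOsc π (fun x => (ν.rnDeriv π x).toReal)).toReal ^ 2 →
      ∀ ε : ℝ, 0 < ε → ∀ n : ℕ,
        1 + 2 ^ 14 * (ς ^ 2)⁻¹ * Real.exp (2 * ς ^ 2) * L * d *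
            (∫ v in (ε / (8 * u))..(1 / 32), v / I v ^ 2) ≤ (n : ℝ) →
        RWMWeakPoincare.chiSq (ν.bind (P ^ n)) π ≤ ENNReal.ofReal ε) := by
  have hLd : 0 < L * d := mul_pos hL (Nat.cast_pos.2 hd)
  set σ := ς * (√(L * d))⁻¹ with hσd
  have hσ : 0 < σ := mul_pos hς (inv_pos.2 (Real.sqrt_pos.2 hLd))
  have hσ2 : σ ^ 2 = ς ^ 2 * (L * d)⁻¹ := by
    rw [hσd, mul_pow, inv_pow, Real.sq_sqrt hLd.le]
  have hςd : L * σ ^ 2 * d = ς ^ 2 := by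
    rw [hσ2]; field_simp
  have hstep' : σ * I (1 / 4) ≤ 1 / 2 := by
    have hd' : 0 < √(d : ℝ) := Real.sqrt_pos.2 (Nat.cast_pos.2 hd)
    have : σ * I (1 / 4) = 2 * ς * ((√L)⁻¹ * I (1 / 4)) / (2 * √(d : ℝ)) := by
      rw [hσd, Real.sqrt_mul hL.le]; field_simp
    rw [this, div_le_iff₀ (by positivity)]
    linarith
  have hϖ : Measurable fun x => Real.exp (-U x) := hU.1.continuous.neg.rexp.measurable
  have hpos : ∀ x, 0 < Real.exp (-U x) := fun x => Real.exp_pos _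
  have hM : IsMarkovKernel P :=
    hP ▸ RWMWeakPoincare.isMarkovKernel_metropolisKernel hϖ
  have hrev : P.IsReversible π := by
    subst hP hπ
    exact RWMWeakPoincare.isReversible_metropolisKernel σ hϖ hpos
  have hposP : ∀ f, RWMWeakPoincare.BddMeas f →
      0 ≤ ∫ x, f x * RWMWeakPoincare.markovOp P f x ∂π := by
    subst hP hπ
    exact fun f hf => RWMWeakPoincare.integral_mul_markovOp_nonneg σ hϖ hpos hf
  have hvol : volume ≪ π := by
    rw [hπ]
    exact withDensity_absolutelyContinuous' hϖ.ennreal_ofReal.aemeasurable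
      (ae_of_all _ fun x => by simpa using hpos x)
  have hJ := RWMWeakPoincare.isConvexProfile_zeroExt hd hI hvol
  set k := (1 / 2 ^ 6) * Real.exp (-ς ^ 2) * σ with hkd
  have hk : 0 < k := by positivity
  have hflow : ∀ A, MeasurableSet A → π A ≤ 1 / 2 →
      ENNReal.ofReal (2 * k * RWMWeakPoincare.zeroExt I (π.real A / 2))
        ≤ ∫⁻ x in A, P x Aᶜ ∂π := fun A hA hA2 => by
    rw [hP]
    exact RWMWeakPoincare.le_flow_rwmKernel hL hU hπ hI hJ hσ hςd hstep' hA hA2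
  have hexp : Real.exp (-ς ^ 2) ^ 2 = Real.exp (-2 * ς ^ 2) := by
    rw [← Real.exp_nat_mul]; congr 1; push_cast; ring
  have hk2 : k ^ 2 = 1 / 2 ^ 12 * ς ^ 2 * Real.exp (-2 * ς ^ 2) * (L * d)⁻¹ := by
    rw [hkd, mul_pow, mul_pow, hexp, hσ2]; ring
  have hk4 : 4 / k ^ 2 = 2 ^ 14 * (ς ^ 2)⁻¹ * Real.exp (2 * ς ^ 2) * L * d := by
    rw [hk2, neg_mul, Real.exp_neg]; field_simp; norm_num
  refine ⟨?_, ⟨RWMWeakPoincare.wpiFun (RWMWeakPoincare.zeroExt I) (2 * k ^ 2),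
    RWMWeakPoincare.kStarWPI_of_flow hrev hJ hk hflow, fun v hv => ?_⟩, ?_, ?_⟩
  · have hlow : ∀ v ∈ Ioc (0 : ℝ) (1 / 2),
        ENNReal.ofReal (k * (I (v / 2) / (v / 2)))
          ≤ RWMWeakPoincare.weakConductanceProfile π P v := fun v hv => by
      rw [← RWMWeakPoincare.zeroExt_of_pos (I := I) (half_pos hv.1)]
      exact RWMWeakPoincare.le_weakConductanceProfile hJ hk hflow hv
    refine ⟨fun v hv => (ENNReal.ofReal_pos.2 ?_).trans_le (hlow v hv), fun v hv => ?_⟩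
    · have := hv.1
      have := hI.pos (v / 2) ⟨half_pos hv.1, by linarith [hv.2]⟩
      positivity
    · convert hlow v hv using 3
      rw [hkd, hσd]; ring
  · have hv8 : 0 < v / 8 := by linarith [hv.1]
    rw [RWMWeakPoincare.wpiFun, RWMWeakPoincare.zeroExt_of_pos hv8, hk2]
    exact le_of_eq (by ring)
  · intro f hf hosc0 hosc n
    obtain ⟨h1, h2⟩ := RWMWeakPoincare.decayRatio_le_and_le_lintegral hrev hposP hJ hk hflow
      hf hosc0 hosc n
    refine ⟨h1, ?_⟩
    rw [hk4] at h2
    convert h2 using 2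
    refine setLIntegral_congr_fun measurableSet_Ioc fun v hv => ?_
    have hv0 : 0 < v := lt_of_le_of_lt (by positivity) hv.1
    simp only [RWMWeakPoincare.zeroExt_of_pos hv0]
  · intro ν hν hac hosc u hu ε hε n hn
    refine RWMWeakPoincare.chiSq_bind_pow_le hrev hposP hJ hk hflow hac hosc hu hε (n := n) ?_
    rw [hk4]
    convert hn using 3
    have hu0 : 0 ≤ u := hu ▸ sq_nonneg _
    -- Both limits are nonnegative (the lower one is `0` if `u = 0`, by convention), so the variable
    -- is positive and the extension by zero agrees with `I` in either orientation.
    refine intervalIntegral.integral_congr_ae (ae_of_all _ fun v hv => ?_)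
    have hv0 : 0 < v := lt_of_le_of_lt (le_min (by positivity) (by norm_num)) hv.1
    simp only [RWMWeakPoincare.zeroExt_of_pos hv0]
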